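/- **Setting.** A plane map is a connected planar multigraph (loops and multiple edges allowed) drawn in the plane, up to deformation. An arc is an oriented edge, and $-a$ is the arc opposite to $a$. A corner is the sector between two consecutive edges around a vertex; the degree of a vertex or face is its number of corners. Let $d\ge 3$. A *$d$-map* is a plane map whose inner faces have degree at most $d$, and whose outer face has degree $d$ and is incident to $d$ distinct vertices, denoted by $v_1,\dots,v_d$ in clockwise order around the outer face. Vertices and edges incident to the outer face are outer, the others are inner; an arc is inner (outer) if its edge is; a corner is inner if it lies in an inner face. Indices, labels and colors in $[d]=\{1,\dots,d\}$ are taken modulo $d$. *$d$-GS labelings.* These assign to each inner corner a label in $[d]$. The jump from a corner labeled $i$ to a corner labeled $i'$ is the $\delta\in\{0,\dots,d-1\}$ with $i+\delta\equiv i' \pmod d$. Conditions: (L0) inner corners at $v_i$ have label $i$; (L1) for each inner vertex and each inner face, the jumps between consecutive corners in clockwise order around it add up to $d$; (L2) the jumps between consecutive corners clockwise around inner faces are positive; (L3) if $c,c'$ are the consecutive corners incident to an inner edge in clockwise order around an incident face $f$, and $c''$ is the corner following $c'$ clockwise around the vertex of $c'$, then the jumps from $c$ to $c'$ and from $c'$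 to $c''$ have sum $>d-\deg(f)$. *$d$-GS marked orientations.* These assign weights in $\mathbb N$ to the arcs and numbers of marks in $\mathbb N$ to the inner corners so that: (M0) outer arcs have weight $0$, and for an inner arc $a$ starting at an outer vertex, with $f$ the face on its left, the weight of $a$ and the number of marks of the corner on the left of $a$ at its initial vertex are both $d-\deg(f)$; (M1) the corners of each inner face $f$ have $d-\deg(f)$ marks in total; (M2) the two arcs of each inner edge have total weight $d-2$, and the arcs out of each inner vertex $v$ have total weight $d+m$, where $m$ is the number of marks at $v$; (M3) each inner arc has weight at least $d-\deg(f)$, with $f$ the face on its left. *$d$-GS angular orientations.* The angular map $G^+$ has an additional star vertex $v_f$ in each inner face $f$, joined by one star edge to each corner of $f$. The orientations assign weights in $\mathbb N$ to the arcs of $G^+$ so that: (A0) outer arcs have weight $0$, and so do all inner arcs of $G^+$ starting at an outer vertex $v_i$, except possibly the star arc immediately preceding the outer arc $(v_i,v_{i-1})$ in clockwise order around $v_i$; (A1) the outgoing weight of $v_f$ and the weight of every star edge at $v_f$ are $d-\deg(f)$; (A2) the outgoing weight of every inner vertex of $G$ is $d$, and the weight of every inner edge of $G$ is $\deg(f)+\deg(f')-d-2$,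 where $f,f'$ are its incident faces. *$d$-GS woods.* These are $d$-tuples $(W_1,\dots,W_d)$ of sets of arcs such that: (W0) every vertex $v\ne v_i$ has exactly one outgoing arc in $W_i$, and $v_i$ has none; for $k\neq i$ the arc of $W_i$ out of $v_k$ is the outer arc $(v_k,v_{k+1})$; and $W_i$ contains no inner arc ending at $v_i$ or $v_{i+1}$; (W1) at each inner vertex the outgoing arcs $a_1,\dots,a_d$ in $W_1,\dots,W_d$ are not all equal and appear in clockwise order (equalities allowed); (W2) if an arc $a\in W_i$ ends at an inner vertex $v$, it is strictly between $a_{i+1}$ and $a_{i-1}$ in clockwise order around $v$; (W3) let $a$ be an inner arc ending at a vertex $v$, let $f$ be the face on its right, let $\epsilon$ be the number of sets $W_j$ containing $-a$, and suppose $k=d-\deg(f)-\epsilon\ge 0$. If $a\in W_i$, or if $a$ is in none of the sets but lies between the outgoing arcs of colors $i$ and $i+1$ in clockwise order around its initial vertex, then $a$ is strictly between $a_{i+1+k}$ and $a_i$ in clockwise order around $v$. In (W3), at $v=v_k$ the outgoing arc $a_k$ is by convention $(v_k,v_{k-1})$. "Strictly between $a_i$ and $a_j$" refers to the clockwise sweep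 through $a_i,a_{i+1},\dots,a_j$: nothing is strictly between if these are all equal, and everything but $a_i$ is if $a_i=a_j$ but the sweep makes a full turn. **Bipartite case.** Let $b\ge2$ and let $G$ be a bipartite $2b$-map, with its vertices properly colored black and white and $v_1$ black. *$b$-BGS labelings* are the $2b$-GS labelings with odd labels at black vertices and even labels at white vertices. A $2b$-GS marked (angular) orientation is *even* if all its weights (and numbers of marks) are even. A $2b$-GS wood is *even* if for all $i\in[b]$, at each black (resp. white) inner vertex the outgoing arcs in $W_{2i}$ and $W_{2i-1}$ (resp. $W_{2i}$ and $W_{2i+1}$) coincide. *$b$-BGS marked orientations* satisfy (M0)–(M3) with $d-\deg(f)$, $d-2$, $d+m$ replaced by $b-\deg(f)/2$, $b-1$, $b+m$. *$b$-BGS angular orientations* satisfy (A0)–(A2) with $d-\deg(f)$, $d$, $\deg(f)+\deg(f')-d-2$ replaced by $b-\deg(f)/2$, $b$, $\deg(f)/2+\deg(f')/2-b-1$. *$b$-BGS woods* are $b$-tuples $(W'_1,\dots,W'_b)$ of sets of arcs (indices modulo $b$) such that: - (BW0) every vertex $v\ne v_{2i}$ has exactly one outgoing arc in $W'_i$, and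 $v_{2i}$ has none; for $k\ne 2i$ the arc of $W'_i$ out of $v_k$ is $(v_k,v_{k+1})$; $W'_i$ contains no inner arc ending at $v_{2i}$ or $v_{2i+1}$. - (BW1) at each inner vertex the outgoing arcs $a'_1,\dots,a'_b$ in $W'_1,\dots,W'_b$ are not all equal and appear in clockwise order. - (BW2) Let $a$ be an inner arc ending at a black (resp. white) vertex $v$ with outgoing arcs $a'_1,\dots,a'_b$, let $f$ be the face on the right of $a$, let $\epsilon$ be the number of sets $W'_j$ containing $-a$, and let $m=\max(0,b-\deg(f)/2-\epsilon)$. If $a\in W'_i$, then $a$ is strictly between $a'_{i+1+m}$ and $a'_i$ (resp. $a'_{i+m}$ and $a'_{i-1}$) in clockwise order around $v$. If $a$ is in none of the sets but lies between the outgoing arcs of colors $i$ and $i+1$ in clockwise order around its initial vertex, then $a$ is strictly between $a'_{i+1+m}$ and $a'_{i+1}$ (resp. $a'_{i+m}$ and $a'_i$) in clockwise order around $v$. Here, at the outer vertices $v_{2i}$ and $v_{2i-1}$, the outgoing arc of color $i$ is by convention $(v_{2i},v_{2i-1})$, resp. $(v_{2i-1},v_{2i-2})$. When the two bounding arcs have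 the same index, the sweep from the first to the second consists of $0$ steps (nothing is strictly between) if $a\in W'_i$, and of a full turn (everything but that arc is strictly between) if $a$ is in none of the sets. **Maps between the incarnations.** For an inner corner $c$, let $c^-$ be the preceding corner clockwise around its face and $c^+$ the next corner clockwise around its vertex. - $\Phi$ sends a labeling to the marked orientation in which $c$ has $\delta-1$ marks, where $\delta$ is the jump from $c^-$ to $c$, and an inner arc $a$ has weight $\delta+\epsilon-1$, where $c$ is the corner on the left of $a$ at its initial vertex, $\delta$ is the jump from $c^-$ to $c$, and $\epsilon$ is the jump from $c$ to $c^+$; outer arcs have weight $0$. - $\Psi$ sends a marked orientation with weights $\omega$ to the weighted orientation of $G^+$ in which an inner arc $a$ of $G$ with left face $f$ has weight $\omega(a)+\deg(f)-2b$, outer arcs have weight $0$, and for a corner $c$ of an inner face $f$ with $m$ marks, the star arc from $v_f$ to $c$ has weight $m$ and its opposite has weight $2b-\deg(f)-m$. - $\Theta$ sends a labeling to the tuple of arc sets in which an inner arc with labels $i$ on its left and $j$ on its right at its initial vertex belongs exactly to $W_i,W_{i+1},\dots,W_{j-1}$ (to no set if $i=j$), the outer arc $(v_k,v_{k+1})$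 to all sets except $W_k$, and $(v_{k+1},v_k)$ to none. **Theorem.** Let $b\ge 2$ and let $G$ be a bipartite $2b$-map. The sets of $b$-BGS labelings, $b$-BGS woods, $b$-BGS marked orientations and $b$-BGS angular orientations of $G$ are in bijection. More precisely: - $\Phi$ is a bijection from $b$-BGS labelings to even $2b$-GS marked orientations, $\Psi$ is a bijection from even $2b$-GS marked orientations to even $2b$-GS angular orientations, and $\Theta$ is a bijection from $b$-BGS labelings to even $2b$-GS woods; - dividing all weights and numbers of marks by $2$ is a bijection from even $2b$-GS marked orientations to $b$-BGS marked orientations, and dividing all weights by $2$ is a bijection from even $2b$-GS angular orientations to $b$-BGS angular orientations; - $(W_1,\dots,W_{2b})\mapsto(W_2,W_4,\dots,W_{2b})$ is a bijection from even $2b$-GS woods to $b$-BGS woods. -/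

import Mathlib

open scoped Classical

noncomputable section

/-- A finite rotation system.  The type `D` is the set of arcs; an arc is recorded at its initial
vertex.  `cw a` is the next arc in clockwise order around the initial vertex of `a`,
and `rev a` is the opposite arc `-a`. -/
structure RotationSystem (D : Type*) where
  cw : Equiv.Perm D
  rev : Equiv.Perm D
  rev_rev : ∀ a, rev (rev a) = a
  rev_ne : ∀ a, rev a ≠ a

namespace RotationSystem

variable {D : Type*} (G : RotationSystem D)

/-- Vertices are the orbits of the clockwise rotation. -/
def Vertex : Type _ := Quotient (Equiv.Perm.SameCycle.setoid G.cw)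

/-- The sector on the left of the arc `a` at its initial vertex (between `cw⁻¹ a` and `a`) is the
corner represented by `a`; every corner is represented in this way exactly once.  The permutation
`faceCw` sends a corner to the next corner clockwise around the face that contains it
(walking with the face on the right, one leaves the corner of `a` along the arc `cw⁻¹ a`). -/
def faceCw : Equiv.Perm D := G.rev * G.cw⁻¹

/-- Faces are the orbits of `faceCw`. -/
def Face : Type _ := Quotient (Equiv.Perm.SameCycle.setoid G.faceCw)

/-- Edges are the orbits of `rev`. -/
def Edge : Type _ := Quotient (Equiv.Perm.SameCycle.setoid G.rev)

/-- Initial vertex of an arc. -/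
def tail (a : D) : G.Vertex := Quotient.mk (Equiv.Perm.SameCycle.setoid G.cw) a

/-- Terminal vertex of an arc. -/
def head (a : D) : G.Vertex := G.tail (G.rev a)

/-- The face on the left of an arc; this is also the face that contains the corner of `a`. -/
def leftFace (a : D) : G.Face := Quotient.mk (Equiv.Perm.SameCycle.setoid G.faceCw) a

/-- The face on the right of an arc. -/
def rightFace (a : D) : G.Face := G.leftFace (G.rev a)

/-- Degree of a vertex: the number of incident corners. -/
def vdeg (v : G.Vertex) : ℕ := Nat.card {a : D // G.tail a = v}

/-- Degree of a face: the number of incident corners. -/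
def fdeg (f : G.Face) : ℕ := Nat.card {a : D // G.leftFace a = f}

/-- The number of clockwise rotation steps that lead from `a` to `a'`
(for two arcs with the same initial vertex): a number in `{0, …, deg - 1}`. -/
def turn (a a' : D) : ℕ := sInf {k : ℕ | (G.cw ^ k) a = a'}

/-- Total clockwise turn made when going from `a j` to `a (j + 1)`, then to `a (j + 2)`, …,
up to `a (j + n)`, for cyclically indexed arcs `a` out of one vertex. -/
def sweep {m : ℕ} (a : ZMod m → D) (j : ZMod m) (n : ℕ) : ℕ :=
  ∑ t ∈ Finset.range n, G.turn (a (j + t)) (a (j + t + 1))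

/-- The arc `x` appears strictly between `a j` and `a (j + n)` in clockwise order, going through
`a j, a (j + 1), …, a (j + n)`.  If these arcs all coincide, then nothing is strictly between;
if `a j = a (j + n)` but a full turn is made in between, then every arc other than `a j` is. -/
def StrictlyBetween {m : ℕ} (a : ZMod m → D) (j : ZMod m) (n : ℕ) (x : D) : Prop :=
  0 < G.turn (a j) x ∧ G.turn (a j) x < G.sweep a j n

end RotationSystem

/-- A `d`-map: a plane map (a connected rotation system that satisfies the Euler relation) with
a distinguished outer face of degree `d`, incident to `d` distinct vertices, all of
whose inner faces have degree at most `d`.  Indices in `{1, …, d}` are taken in `ZMod d`.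
`outer i` is the outer arc from `v i` to `v (i + 1)`, where the `v i` are the outer vertices in
clockwise order; the outer face is on its left. -/
structure DMap (d : ℕ) (D : Type*) extends RotationSystem D where
  connected : MulAction.IsPretransitive (Subgroup.closure {cw, rev}) D
  euler : Nat.card toRotationSystem.Vertex + Nat.card toRotationSystem.Face
    = Nat.card toRotationSystem.Edge + 2
  outer : ZMod d → D
  outer_next : ∀ i, cw (rev (outer i)) = outer (i + 1)
  outer_distinct : ∀ i j, toRotationSystem.tail (outer i) = toRotationSystem.tail (outer j) → i = j
  fdeg_le : ∀ a, (∀ i, a ≠ outer i) →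
    toRotationSystem.fdeg (toRotationSystem.leftFace a) ≤ d

namespace DMap

variable {d : ℕ} {D : Type*} (G : DMap d D)

/-- The outer vertices, in clockwise order. -/
def v (i : ZMod d) : G.Vertex := G.tail (G.outer i)

def IsInnerVertex (x : G.Vertex) : Prop := ∀ i, x ≠ G.v i

/-- An arc is inner if its edge is not incident to the outer face. -/
def IsInnerArc (a : D) : Prop := ∀ i, a ≠ G.outer i ∧ a ≠ G.rev (G.outer i)

/-- Inner corners: all corners but those of the arcs `outer i` (these are the corners of the outer
face). -/
def InnerCorner : Type _ := {a : D // ∀ i, a ≠ G.outer i}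

/-- The inner faces are the faces containing an inner corner. -/
def IsInnerFace (f : G.Face) : Prop := ∃ c : G.InnerCorner, G.leftFace c.1 = f

instance [Finite D] : Fintype G.InnerCorner :=
  haveI : Finite G.InnerCorner := Subtype.finite
  Fintype.ofFinite _

variable {G} in
/-- The corner on the left of an inner arc, at its initial vertex. -/
def IsInnerArc.corner {a : D} (h : G.IsInnerArc a) : G.InnerCorner := ⟨a, fun i => (h i).1⟩

theorem faceCw_inner (x : D) :
    (∀ i, G.faceCw x ≠ G.outer i) ↔ (∀ i, x ≠ G.outer i) := by
  have key : ∀ i, G.faceCw (G.outer (i + 1)) = G.outer i := by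
    intro i
    rw [← G.outer_next i]
    simp [RotationSystem.faceCw, G.rev_rev]
  constructor
  · intro h i hx
    apply h (i - 1)
    rw [hx, ← key (i - 1), sub_add_cancel]
  · intro h i hx
    apply h (i + 1)
    apply G.faceCw.injective
    rw [hx, key i]

/-- The next corner in clockwise order around an inner face. -/
def nextInFace : Equiv.Perm G.InnerCorner := G.faceCw.subtypePerm G.faceCw_inner

/-- The next corner in clockwise order around a vertex.  (The value for the last inner corner
before an outer corner is irrelevant.) -/
def nextAtVertex (c : G.InnerCorner) : G.InnerCorner :=
  if h : ∀ i, G.cw c.1 ≠ G.outer i then ⟨G.cw c.1, h⟩ else c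

/-! ### Corner labelings -/

/-- A `d`-labeling: a label in `{1, …, d}` for each inner corner, read modulo `d`. -/
abbrev Labeling : Type _ := G.InnerCorner → ZMod d

variable {G} in
/-- The label jump from `c` to `c'`, an integer in `{0, …, d - 1}`. -/
def Labeling.jump (L : G.Labeling) (c c' : G.InnerCorner) : ℕ := (L c' - L c).val

/-- `d`-grand-Schnyder corner labelings. -/
structure IsGSLabeling [Finite D] (L : G.Labeling) : Prop where
  outer_label : ∀ (i : ZMod d) (c : G.InnerCorner), G.tail c.1 = G.v i → L c = i
  sum_vertex : ∀ x : G.Vertex, G.IsInnerVertex x →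
    ∑ c : G.InnerCorner with G.tail c.1 = x, L.jump c (G.nextAtVertex c) = d
  sum_face : ∀ f : G.Face, G.IsInnerFace f →
    ∑ c : G.InnerCorner with G.leftFace c.1 = f, L.jump c (G.nextInFace c) = d
  jump_pos : ∀ c : G.InnerCorner, 0 < L.jump c (G.nextInFace c)
  /-- Here `c'` is the corner on the left of the inner arc `a`; the corner `c` that precedes `c'`
  clockwise around their face `f` is the one at the other end of the edge of `a`. -/
  edge_jump : ∀ (a : D) (h : G.IsInnerArc a),
    (d : ℤ) - G.fdeg (G.leftFace a) <
      L.jump (G.nextInFace.symm h.corner) h.corner + L.jump h.corner (G.nextAtVertex h.corner)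

/-! ### Marked orientations -/

/-- A weighted orientation together with a corner marking. -/
structure MarkedOrientation where
  weight : D → ℕ
  marks : G.InnerCorner → ℕ

/-- `d`-grand-Schnyder marked orientations. -/
structure IsGSMarked [Fintype D] (M : G.MarkedOrientation) : Prop where
  outer_weight : ∀ a, ¬ G.IsInnerArc a → M.weight a = 0
  at_outer : ∀ (a : D) (h : G.IsInnerArc a), ¬ G.IsInnerVertex (G.tail a) →
    M.weight a = d - G.fdeg (G.leftFace a) ∧ M.marks h.corner = d - G.fdeg (G.leftFace a)
  face_marks : ∀ f : G.Face, G.IsInnerFace f →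
    ∑ c : G.InnerCorner with G.leftFace c.1 = f, M.marks c = d - G.fdeg f
  edge_weight : ∀ a, G.IsInnerArc a → M.weight a + M.weight (G.rev a) = d - 2
  vertex_weight : ∀ x : G.Vertex, G.IsInnerVertex x →
    ∑ a : D with G.tail a = x, M.weight a
      = d + ∑ c : G.InnerCorner with G.tail c.1 = x, M.marks c
  arc_weight : ∀ a, G.IsInnerArc a → d - G.fdeg (G.leftFace a) ≤ M.weight a

/-! ### Angular orientations -/

/-- The arcs of the angular map: the original arcs and, for each inner corner `c` (of a
vertex `x` in an inner face `f`), the arc `toStar c` from `x` to the star vertex of `f`,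
and its opposite arc `fromStar c`. -/
inductive AngularArc where
  | orig (a : D)
  | toStar (c : G.InnerCorner)
  | fromStar (c : G.InnerCorner)

/-- A weighted orientation of the angular map. -/
abbrev AngularOrientation : Type _ := G.AngularArc → ℕ

/-- `d`-grand-Schnyder angular orientations. -/
structure IsGSAngular [Fintype D] (A : G.AngularOrientation) : Prop where
  outer_weight : ∀ a, ¬ G.IsInnerArc a → A (.orig a) = 0
  at_outer_orig : ∀ a, G.IsInnerArc a → ¬ G.IsInnerVertex (G.tail a) → A (.orig a) = 0
  /-- The excluded star arc is the one that immediately precedes the outer arc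
  `rev (outer i)` in clockwise order around its initial vertex `v (i + 1)`. -/
  at_outer_star : ∀ c : G.InnerCorner, ¬ G.IsInnerVertex (G.tail c.1) →
    (∀ i, c.1 ≠ G.rev (G.outer i)) → A (.toStar c) = 0
  star_out : ∀ f : G.Face, G.IsInnerFace f →
    ∑ c : G.InnerCorner with G.leftFace c.1 = f, A (.fromStar c) = d - G.fdeg f
  star_edge : ∀ c : G.InnerCorner,
    A (.toStar c) + A (.fromStar c) = d - G.fdeg (G.leftFace c.1)
  vertex_out : ∀ x : G.Vertex, G.IsInnerVertex x →
    ∑ a : D with G.tail a = x, A (.orig a)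
      + ∑ c : G.InnerCorner with G.tail c.1 = x, A (.toStar c) = d
  edge_weight : ∀ a, G.IsInnerArc a → (A (.orig a) + A (.orig (G.rev a)) : ℤ)
    = G.fdeg (G.leftFace a) + G.fdeg (G.rightFace a) - d - 2

/-! ### Woods -/

/-- A tuple of sets of arcs, indexed modulo `n`. -/
abbrev ArcTuple (_G : DMap d D) (n : ℕ) : Type _ := ZMod n → Set D

/-- The number of sets of a tuple that contain the arc `a`. -/
def numColors {n : ℕ} (W : G.ArcTuple n) (a : D) : ℕ := Nat.card {i : ZMod n // a ∈ W i}

/-- `a` is the outgoing arc of color `i` at `x`, with the convention that at the root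
`v i` of `W i` it is the outer arc from `v i` to `v (i - 1)`. -/
def IsOutArc (W : G.ArcTuple d) (x : G.Vertex) (i : ZMod d) (a : D) : Prop :=
  (x = G.v i ∧ a = G.rev (G.outer (i - 1))) ∨ (x ≠ G.v i ∧ G.tail a = x ∧ a ∈ W i)

/-- The set of all outgoing arcs at `x`, given as a function of the color. -/
def IsOutFamily (W : G.ArcTuple d) (x : G.Vertex) (a : ZMod d → D) : Prop :=
  ∀ i, G.IsOutArc W x i (a i)

/-- `d`-grand-Schnyder woods. -/
structure IsGSWood (W : G.ArcTuple d) : Prop where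
  existsUnique_out : ∀ i x, x ≠ G.v i → ∃! a, G.tail a = x ∧ a ∈ W i
  root_out : ∀ i a, G.tail a = G.v i → a ∉ W i
  outer_mem : ∀ i k, k ≠ i → G.outer k ∈ W i
  inner_root : ∀ i a, G.IsInnerArc a → (G.head a = G.v i ∨ G.head a = G.v (i + 1)) → a ∉ W i
  /-- The outgoing arcs at an inner vertex make exactly one clockwise turn: they are in clockwise
  order (coincidences being allowed) and are not all equal. -/
  cw_order : ∀ x, G.IsInnerVertex x → ∀ a, G.IsOutFamily W x a → G.sweep a 0 d = G.vdeg x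
  /-- Strictly between the colors `i + 1` and `i - 1`. -/
  incoming : ∀ e i, G.IsInnerVertex (G.head e) → e ∈ W i →
    ∀ a, G.IsOutFamily W (G.head e) a → G.StrictlyBetween a (i + 1) (d - 2) (G.rev e)
  /-- Strictly between the colors `i + 1 + k` and `i`, where `k = d - deg f - ε ≥ 0`. -/
  incoming_face : ∀ (e : D) (i : ZMod d) (k : ℕ), G.IsInnerArc e →
    k + G.fdeg (G.rightFace e) + G.numColors W (G.rev e) = d →
    (e ∈ W i ∨ ((∀ j, e ∉ W j) ∧
      ∃ a, G.IsOutFamily W (G.tail e) a ∧ G.StrictlyBetween a i 1 e)) →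
    ∀ a, G.IsOutFamily W (G.head e) a → G.StrictlyBetween a (i + 1 + k) (d - 1 - k) (G.rev e)

/-! ### The maps between the incarnations -/

/-- From corner labelings to marked orientations. -/
def Phi (L : G.Labeling) : G.MarkedOrientation where
  marks c := L.jump (G.nextInFace.symm c) c - 1
  weight a := if h : G.IsInnerArc a then
      L.jump (G.nextInFace.symm h.corner) h.corner + L.jump h.corner (G.nextAtVertex h.corner) - 1
    else 0

/-- From marked orientations to angular orientations. -/
def Psi (M : G.MarkedOrientation) : G.AngularOrientation
  | .orig a => if G.IsInnerArc a then M.weight a + G.fdeg (G.leftFace a) - d else 0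
  | .fromStar c => M.marks c
  | .toStar c => d - G.fdeg (G.leftFace c.1) - M.marks c

/-- From corner labelings to woods: an inner arc `a` with label `i` on its left and label `j` on
its right at its initial vertex gets the colors `i, i + 1, …, j - 1` modulo `d`, and the outer
arc from `v k` to `v (k + 1)` gets all colors but `k`. -/
def Theta (L : G.Labeling) : G.ArcTuple d := fun k =>
  {a | (∃ i, i ≠ k ∧ a = G.outer i) ∨ ∃ h : G.IsInnerArc a,
    (k - L h.corner).val < L.jump h.corner (G.nextAtVertex h.corner)}

end DMap

/-! ### The bipartite case -/

namespace DMap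

/-- A proper bicoloring of the vertices in which the outer vertex `v 1` is black.
(It exists if and only if the map is bipartite, and is then unique.) -/
structure Bicoloring {d : ℕ} {D : Type*} (G : DMap d D) where
  black : G.Vertex → Prop
  proper : ∀ a, black (G.head a) ↔ ¬ black (G.tail a)
  black_one : black (G.v 1)

variable {b : ℕ} {D : Type*} (G : DMap (2 * b) D) (κ : G.Bicoloring)

/-- The color `2 i` modulo `2 b`, for `i` modulo `b`. -/
def dbl (i : ZMod b) : ZMod (2 * b) := ((2 * i.val : ℕ) : ZMod (2 * b))

/-- `b`-BGS labelings.  (As `2 b` is even, parity makes sense modulo `2 b`.) -/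
def BGSLabelings [Finite D] : Set G.Labeling :=
  {L | G.IsGSLabeling L ∧ ∀ c : G.InnerCorner,
    (κ.black (G.tail c.1) → Odd (L c).val) ∧ (¬ κ.black (G.tail c.1) → Even (L c).val)}

/-- Even `2 b`-GS marked orientations. -/
def EvenGSMarked [Fintype D] : Set G.MarkedOrientation :=
  {M | G.IsGSMarked M ∧ (∀ a, G.IsInnerArc a → Even (M.weight a)) ∧ ∀ c, Even (M.marks c)}

/-- Even `2 b`-GS angular orientations. -/
def EvenGSAngular [Fintype D] : Set G.AngularOrientation :=
  {A | G.IsGSAngular A ∧ ∀ a, Even (A a)}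

/-- Even `2 b`-GS woods: at black (resp. white) inner vertices the outgoing arcs in `W (2 i)`
and `W (2 i - 1)` (resp. `W (2 i + 1)`) are the same. -/
def EvenGSWoods : Set (G.ArcTuple (2 * b)) :=
  {W | G.IsGSWood W ∧ ∀ (i : ZMod b) (a : D), G.IsInnerVertex (G.tail a) →
    (κ.black (G.tail a) → (a ∈ W (dbl i) ↔ a ∈ W (dbl i - 1))) ∧
    (¬ κ.black (G.tail a) → (a ∈ W (dbl i) ↔ a ∈ W (dbl i + 1)))}

/-- `b`-BGS marked orientations. -/
structure IsBGSMarked [Fintype D] (M : G.MarkedOrientation) : Prop where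
  outer_weight : ∀ a, ¬ G.IsInnerArc a → M.weight a = 0
  at_outer : ∀ (a : D) (h : G.IsInnerArc a), ¬ G.IsInnerVertex (G.tail a) →
    M.weight a = b - G.fdeg (G.leftFace a) / 2 ∧
    M.marks h.corner = b - G.fdeg (G.leftFace a) / 2
  face_marks : ∀ f : G.Face, G.IsInnerFace f →
    ∑ c : G.InnerCorner with G.leftFace c.1 = f, M.marks c = b - G.fdeg f / 2
  edge_weight : ∀ a, G.IsInnerArc a → M.weight a + M.weight (G.rev a) = b - 1
  vertex_weight : ∀ x : G.Vertex, G.IsInnerVertex x →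
    ∑ a : D with G.tail a = x, M.weight a
      = b + ∑ c : G.InnerCorner with G.tail c.1 = x, M.marks c
  arc_weight : ∀ a, G.IsInnerArc a → b - G.fdeg (G.leftFace a) / 2 ≤ M.weight a

/-- `b`-BGS angular orientations. -/
structure IsBGSAngular [Fintype D] (A : G.AngularOrientation) : Prop where
  outer_weight : ∀ a, ¬ G.IsInnerArc a → A (.orig a) = 0
  at_outer_orig : ∀ a, G.IsInnerArc a → ¬ G.IsInnerVertex (G.tail a) → A (.orig a) = 0
  at_outer_star : ∀ c : G.InnerCorner, ¬ G.IsInnerVertex (G.tail c.1) →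
    (∀ i, c.1 ≠ G.rev (G.outer i)) → A (.toStar c) = 0
  star_out : ∀ f : G.Face, G.IsInnerFace f →
    ∑ c : G.InnerCorner with G.leftFace c.1 = f, A (.fromStar c) = b - G.fdeg f / 2
  star_edge : ∀ c : G.InnerCorner,
    A (.toStar c) + A (.fromStar c) = b - G.fdeg (G.leftFace c.1) / 2
  vertex_out : ∀ x : G.Vertex, G.IsInnerVertex x →
    ∑ a : D with G.tail a = x, A (.orig a)
      + ∑ c : G.InnerCorner with G.tail c.1 = x, A (.toStar c) = b
  edge_weight : ∀ a, G.IsInnerArc a → (A (.orig a) + A (.orig (G.rev a)) : ℤ)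
    = ((G.fdeg (G.leftFace a) / 2 : ℕ) : ℤ) + ((G.fdeg (G.rightFace a) / 2 : ℕ) : ℤ) - b - 1

/-- `a` is the outgoing arc of color `i` at `x` for a tuple indexed modulo `b`.  By convention, at
the white outer vertex `v (2 i)` (the root of the `i`-th set) and at the black outer vertex
`v (2 i - 1)` it is the outer arc leading to the previous outer vertex. -/
def IsBGSOutArc (W : G.ArcTuple b) (x : G.Vertex) (i : ZMod b) (a : D) : Prop :=
  (x = G.v (dbl i) ∧ a = G.rev (G.outer (dbl i - 1))) ∨
  (x = G.v (dbl i - 1) ∧ a = G.rev (G.outer (dbl i - 2))) ∨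
  (x ≠ G.v (dbl i) ∧ x ≠ G.v (dbl i - 1) ∧ G.tail a = x ∧ a ∈ W i)

def IsBGSOutFamily (W : G.ArcTuple b) (x : G.Vertex) (a : ZMod b → D) : Prop :=
  ∀ i, G.IsBGSOutArc W x i (a i)

/-- `b`-BGS woods.  In the last two conditions `m = max (0, b - deg f / 2 - ε)`, where `f` is the
face on the right of the arc `e` and `ε` is the number of colors of `-e`. -/
structure IsBGSWood (W : G.ArcTuple b) : Prop where
  existsUnique_out : ∀ i x, x ≠ G.v (dbl i) → ∃! a, G.tail a = x ∧ a ∈ W i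
  root_out : ∀ i a, G.tail a = G.v (dbl i) → a ∉ W i
  outer_mem : ∀ i k, k ≠ dbl i → G.outer k ∈ W i
  inner_root : ∀ i a, G.IsInnerArc a →
    (G.head a = G.v (dbl i) ∨ G.head a = G.v (dbl i + 1)) → a ∉ W i
  cw_order : ∀ x, G.IsInnerVertex x → ∀ a, G.IsBGSOutFamily W x a → G.sweep a 0 b = G.vdeg x
  /-- Strictly between the colors `i + 1 + m` and `i` (resp. `i + m` and `i - 1`). -/
  incoming : ∀ (e : D) (i : ZMod b) (m : ℕ), G.IsInnerArc e →
    m = b - G.fdeg (G.rightFace e) / 2 - G.numColors W (G.rev e) → e ∈ W i →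
    ∀ a, G.IsBGSOutFamily W (G.head e) a →
      (κ.black (G.head e) → G.StrictlyBetween a (i + 1 + m) (b - 1 - m) (G.rev e)) ∧
      (¬ κ.black (G.head e) → G.StrictlyBetween a (i + m) (b - 1 - m) (G.rev e))
  /-- Strictly between the colors `i + 1 + m` and `i + 1` (resp. `i + m` and `i`); for `m = 0`
  this is a full turn. -/
  incoming_uncolored : ∀ (e : D) (i : ZMod b) (m : ℕ), G.IsInnerArc e →
    m = b - G.fdeg (G.rightFace e) / 2 - G.numColors W (G.rev e) → (∀ j, e ∉ W j) →
    (∃ a, G.IsBGSOutFamily W (G.tail e) a ∧ G.StrictlyBetween a i 1 e) →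
    ∀ a, G.IsBGSOutFamily W (G.head e) a →
      (κ.black (G.head e) → G.StrictlyBetween a (i + 1 + m) (b - m) (G.rev e)) ∧
      (¬ κ.black (G.head e) → G.StrictlyBetween a (i + m) (b - m) (G.rev e))

def BGSMarked [Fintype D] : Set G.MarkedOrientation := {M | G.IsBGSMarked M}

def BGSAngular [Fintype D] : Set G.AngularOrientation := {A | G.IsBGSAngular A}

def BGSWoods : Set (G.ArcTuple b) := {W | G.IsBGSWood κ W}

/-- Dividing all weights and numbers of marks by 2. -/
def halveMarked (M : G.MarkedOrientation) : G.MarkedOrientation where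
  weight a := M.weight a / 2
  marks c := M.marks c / 2

/-- Dividing all weights by 2. -/
def halveAngular (A : G.AngularOrientation) : G.AngularOrientation := fun a => A a / 2

/-- Keeping only the sets of even color: `(W 2, W 4, …, W (2 b))`. -/
def keepEven (W : G.ArcTuple (2 * b)) : G.ArcTuple b := fun i => W (dbl i)

end DMap

end

/-!
Everything is read off from the labels of the corners and their jumps.  For an arc `a`, let `vjump a`
be the jump across `a` at its initial vertex, and `fjump a` the jump along the left side of its edge
to the corner of `a`.  The labels are extended to the corners of the outer face (`extend`) in such a
way that the jumps across the arcs add up to `d` around the outer vertices too, and that the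
conventions on outgoing arcs at the roots of woods become instances of the general rule; see
`isGSLabeling_iff`.

The Euler relation balances the jumps (`sum_balance`): with total jump `d` around every vertex, the
defects `(total jump) - d` of the faces and of the edges compensate each other (`sum_edge_defect`).
The total of the four jumps around an edge is a multiple of `d`, positive for a labeling, so that it
must be equal to `d` (`IsFullLabeling.edge_sum`); conversely, if it is equal to `d` for all edges,
then the totals around the faces are forced (`isFullLabeling_of_edge_sum`).

*Marked and angular orientations.*  `Phi` records the jumps, which gives `isGSMarked_Phi` and, by
connectedness, injectivity.  Conversely, a marked orientation prescribes jumps with total `0` modulo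
`d` around vertices, faces and edges.  On a plane map such jumps come from labels (`exists_labels`):
this exactness is proved by counting, as all groups involved are finite.  `Psi` has an explicit
inverse, `angularToMarked`.  Labels have the parity of the bicoloring exactly when all weights and
numbers of marks are even, and halving is then immediate because the face degrees are even.

*Woods.*  Around a vertex, labels modulo `N` with total jump `N` are the same as arcs of colors
`1, …, N` that make one clockwise turn, the colors of an arc forming the cyclic interval between
the labels on both of its sides (`existsUnique_hasColor`, `sweep_eq_vdeg`, `exists_hasColor_iff`).
That an arc is strictly between two outgoing arcs becomes a condition on the two labels next to it
(`strictlyBetween_iff`), so that the axioms of woods turn into inequalities between the four jumps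
around an edge; these are equivalent to the conditions on labelings.

*Bipartite woods.*  A labeling with the parity of the bicoloring amounts to labels modulo `b`
(`Halves`): `2 l - 1` at black vertices and `2 l` at white ones.  The sets of even colors are
described by these half labels, around every vertex, modulo `b`.  Running the same argument for them
shows that `keepEven ∘ Theta` is a bijection onto the `b`-BGS woods (`bijOn_keepEven_Theta`), while
`Theta` is one onto the even woods, which gives the bijection between both kinds of woods.
-/

noncomputable section

/-! ### Clockwise turns around a vertex -/

namespace RotationSystem

variable {D : Type*} (G : RotationSystem D)

theorem tail_eq_iff {a a' : D} : G.tail a = G.tail a' ↔ G.cw.SameCycle a a' := Quotient.eq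

theorem leftFace_eq_iff {a a' : D} : G.leftFace a = G.leftFace a' ↔ G.faceCw.SameCycle a a' :=
  Quotient.eq

@[simp] theorem tail_cw (a : D) : G.tail (G.cw a) = G.tail a :=
  G.tail_eq_iff.2 (Equiv.Perm.sameCycle_apply_left.2 (Equiv.Perm.SameCycle.refl _ _))

@[simp] theorem tail_cw_pow (a : D) (k : ℕ) : G.tail ((G.cw ^ k) a) = G.tail a :=
  G.tail_eq_iff.2 (Equiv.Perm.sameCycle_pow_left.2 (Equiv.Perm.SameCycle.refl _ _))

@[simp] theorem leftFace_faceCw (a : D) : G.leftFace (G.faceCw a) = G.leftFace a :=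
  G.leftFace_eq_iff.2 (Equiv.Perm.sameCycle_apply_left.2 (Equiv.Perm.SameCycle.refl _ _))

theorem faceCw_apply (a : D) : G.faceCw a = G.rev (G.cw.symm a) := rfl

theorem faceCw_cw_rev (a : D) : G.faceCw (G.cw (G.rev a)) = a := by
  simp [faceCw_apply, G.rev_rev]

theorem faceCw_symm_apply (a : D) : G.faceCw.symm a = G.cw (G.rev a) := by
  rw [Equiv.symm_apply_eq, faceCw_cw_rev]

@[simp] theorem leftFace_cw_rev (a : D) : G.leftFace (G.cw (G.rev a)) = G.leftFace a := by
  rw [← G.leftFace_faceCw, faceCw_cw_rev]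

theorem leftFace_cw (a : D) : G.leftFace (G.cw a) = G.rightFace a := by
  have := G.leftFace_cw_rev (G.rev a)
  rwa [G.rev_rev] at this

theorem rev_injective {a a' : D} (h : G.rev a = G.rev a') : a = a' := G.rev.injective h

section Turn

theorem sweep_zero {m : ℕ} (a : ZMod m → D) (j : ZMod m) : G.sweep a j 0 = 0 := by
  simp [sweep]

theorem sweep_succ {m : ℕ} (a : ZMod m → D) (j : ZMod m) (n : ℕ) :
    G.sweep a j (n + 1) = G.sweep a j n + G.turn (a (j + n)) (a (j + n + 1)) := by
  simp [sweep, Finset.sum_range_succ]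

variable [Finite D]

theorem exists_pow_of_tail_eq {a a' : D} (h : G.tail a = G.tail a') :
    ∃ k, (G.cw ^ k) a = a' := by
  obtain ⟨k, -, hk⟩ := (G.tail_eq_iff.1 h).exists_pow_eq'
  exact ⟨k, hk⟩

theorem mem_periodicPts_cw (a : D) : a ∈ Function.periodicPts G.cw :=
  Function.mem_periodicPts.2 ⟨orderOf G.cw, orderOf_pos G.cw, by
    rw [Function.IsPeriodicPt, Function.IsFixedPt, Equiv.Perm.iterate_eq_pow, pow_orderOf_eq_one]
    rfl⟩

theorem cw_pow_eq_iff_modEq (a : D) (k l : ℕ) :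
    (G.cw ^ k) a = (G.cw ^ l) a ↔ k ≡ l [MOD Function.minimalPeriod G.cw a] := by
  have hp := Function.minimalPeriod_pos_of_mem_periodicPts (G.mem_periodicPts_cw a)
  rw [← Equiv.Perm.iterate_eq_pow, ← Equiv.Perm.iterate_eq_pow,
    ← Function.iterate_mod_minimalPeriod_eq, ← Function.iterate_mod_minimalPeriod_eq (n := l),
    Function.iterate_eq_iterate_iff_of_lt_minimalPeriod (Nat.mod_lt _ hp) (Nat.mod_lt _ hp)]
  rfl

/-- Summing over the arcs out of a vertex amounts to summing along one clockwise turn. -/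
theorem sum_tail_eq_sum_minimalPeriod [Fintype D] {M : Type*} [AddCommMonoid M] (a : D)
    (f : D → M) : ∑ y : D with G.tail y = G.tail a, f y
      = ∑ t ∈ Finset.range (Function.minimalPeriod G.cw a), f ((G.cw ^ t) a) := by
  have hp := Function.minimalPeriod_pos_of_mem_periodicPts (G.mem_periodicPts_cw a)
  symm
  refine Finset.sum_bij (fun t _ => (G.cw ^ t) a) ?_ ?_ ?_ ?_
  · intro t _
    simp
  · intro s hs t ht h
    rw [G.cw_pow_eq_iff_modEq] at h
    exact Nat.ModEq.eq_of_lt_of_lt h (Finset.mem_range.1 hs) (Finset.mem_range.1 ht)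
  · intro y hy
    obtain ⟨k, rfl⟩ := G.exists_pow_of_tail_eq (Finset.mem_filter.1 hy).2.symm
    refine ⟨k % Function.minimalPeriod G.cw a, Finset.mem_range.2 (Nat.mod_lt _ hp), ?_⟩
    rw [G.cw_pow_eq_iff_modEq]
    exact Nat.mod_modEq _ _
  · intros; rfl

theorem vdeg_tail (a : D) : G.vdeg (G.tail a) = Function.minimalPeriod G.cw a := by
  have := Fintype.ofFinite D
  have h := G.sum_tail_eq_sum_minimalPeriod a (fun _ => 1)
  simp only [Finset.sum_const, Finset.card_range, smul_eq_mul, mul_one] at h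
  rw [← h, vdeg, Nat.card_eq_fintype_card, Fintype.card_subtype]

theorem vdeg_pos (a : D) : 0 < G.vdeg (G.tail a) := by
  rw [vdeg_tail]
  exact Function.minimalPeriod_pos_of_mem_periodicPts (G.mem_periodicPts_cw a)

theorem cw_pow_eq_iff (a : D) (k l : ℕ) :
    (G.cw ^ k) a = (G.cw ^ l) a ↔ k ≡ l [MOD G.vdeg (G.tail a)] := by
  rw [vdeg_tail, cw_pow_eq_iff_modEq]

theorem cw_pow_add_vdeg (a : D) (k : ℕ) : (G.cw ^ (k + G.vdeg (G.tail a))) a = (G.cw ^ k) a := by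
  rw [cw_pow_eq_iff]
  exact Nat.add_modEq_right

theorem sum_tail [Fintype D] {M : Type*} [AddCommMonoid M] (a : D) (f : D → M) :
    ∑ y : D with G.tail y = G.tail a, f y
      = ∑ t ∈ Finset.range (G.vdeg (G.tail a)), f ((G.cw ^ t) a) := by
  rw [vdeg_tail, sum_tail_eq_sum_minimalPeriod]

theorem cw_pow_turn {a a' : D} (h : G.tail a = G.tail a') : (G.cw ^ G.turn a a') a = a' :=
  Nat.sInf_mem (s := {k : ℕ | (G.cw ^ k) a = a'}) (G.exists_pow_of_tail_eq h)

theorem turn_lt {a a' : D} (h : G.tail a = G.tail a') : G.turn a a' < G.vdeg (G.tail a) := by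
  obtain ⟨k, hk⟩ := G.exists_pow_of_tail_eq h
  refine lt_of_le_of_lt (Nat.sInf_le ?_) (Nat.mod_lt k (G.vdeg_pos a))
  show (G.cw ^ _) a = a'
  rw [← hk, cw_pow_eq_iff]
  exact Nat.mod_modEq _ _

theorem turn_eq {a a' : D} {k : ℕ} (hk : (G.cw ^ k) a = a') (hlt : k < G.vdeg (G.tail a)) :
    G.turn a a' = k := by
  have h : G.tail a = G.tail a' := by rw [← hk]; simp
  have h1 := G.cw_pow_turn h
  rw [← hk, cw_pow_eq_iff] at h1
  rw [hk] at h1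
  exact Nat.ModEq.eq_of_lt_of_lt h1 (G.turn_lt h) hlt

theorem cw_pow_sweep {m : ℕ} {a : ZMod m → D} {x : G.Vertex} (ha : ∀ i, G.tail (a i) = x)
    (j : ZMod m) (n : ℕ) : (G.cw ^ G.sweep a j n) (a j) = a (j + n) := by
  induction n with
  | zero => simp [sweep_zero]
  | succ n ih =>
    rw [sweep_succ, add_comm, pow_add, Equiv.Perm.mul_apply, ih, cw_pow_turn _ (by rw [ha, ha])]
    push_cast
    rw [add_assoc]

end Turn

/-! ### Labels around a vertex -/

section Labels

variable {N : ℕ}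

/-- The jump, in `{0, …, N - 1}`, from the label on the left of the arc `a` to the label on its
right, for labels modulo `N` of all the corners. -/
def vjump (lam : D → ZMod N) (a : D) : ℕ := (lam (G.cw a) - lam a).val

/-- The arc `a` receives the color `i` from the labels `lam` when `i` lies in the cyclic interval
that goes from the label on the left of `a` to the label on its right, the latter excluded. -/
def HasColor (lam : D → ZMod N) (i : ZMod N) (a : D) : Prop := (i - lam a).val < G.vjump lam a

/-- The cumulated label jump across the first `t` arcs of a clockwise turn that starts at `y`. -/
def cumul (lam : D → ZMod N) (y : D) (t : ℕ) : ℕ :=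
  ∑ u ∈ Finset.range t, G.vjump lam ((G.cw ^ u) y)

theorem cumul_succ (lam : D → ZMod N) (y : D) (t : ℕ) :
    G.cumul lam y (t + 1) = G.cumul lam y t + G.vjump lam ((G.cw ^ t) y) :=
  Finset.sum_range_succ _ _

theorem cumul_one (lam : D → ZMod N) (y : D) : G.cumul lam y 1 = G.vjump lam y := by
  simp [cumul]

theorem cumul_mono (lam : D → ZMod N) (y : D) : Monotone (G.cumul lam y) :=
  monotone_nat_of_le_succ fun t => by rw [cumul_succ]; exact Nat.le_add_right _ _

variable [NeZero N]

theorem vjump_lt (lam : D → ZMod N) (a : D) : G.vjump lam a < N := ZMod.val_lt _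

theorem lam_cw (lam : D → ZMod N) (a : D) : lam (G.cw a) = lam a + G.vjump lam a := by
  simp [vjump]

theorem hasColor_iff {lam : D → ZMod N} {i : ZMod N} {a : D} :
    G.HasColor lam i a ↔ ∃ u < G.vjump lam a, i = lam a + u := by
  constructor
  · intro h
    exact ⟨_, h, by simp⟩
  · rintro ⟨u, hu, rfl⟩
    rw [HasColor, add_sub_cancel_left, ZMod.val_cast_of_lt (hu.trans (G.vjump_lt _ _))]
    exact hu

theorem natCard_hasColor (lam : D → ZMod N) (a : D) :
    Nat.card {i // G.HasColor lam i a} = G.vjump lam a := by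
  have e : Fin (G.vjump lam a) ≃ {i // G.HasColor lam i a} :=
    Equiv.ofBijective (fun u => ⟨lam a + (u : ℕ), G.hasColor_iff.2 ⟨u, u.2, rfl⟩⟩) <| by
      constructor
      · intro u w h
        have h := congrArg ZMod.val (add_left_cancel (Subtype.ext_iff.1 h))
        rw [ZMod.val_cast_of_lt (u.2.trans (G.vjump_lt _ _)),
          ZMod.val_cast_of_lt (w.2.trans (G.vjump_lt _ _))] at h
        exact Fin.ext h
      · rintro ⟨i, hi⟩
        obtain ⟨u, hu, rfl⟩ := G.hasColor_iff.1 hi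
        exact ⟨⟨u, hu⟩, rfl⟩
  rw [← Nat.card_congr e, Nat.card_fin]

/-- Passing from the color `i` to the color `i + 1`: an arc loses it at its right end and gains it
at its left end. -/
theorem hasColor_succ_indicator (lam : D → ZMod N) (i : ZMod N) (a : D) :
    ((if G.HasColor lam (i + 1) a then 1 else 0) + if i + 1 = lam (G.cw a) then 1 else 0 : ℕ)
      = (if G.HasColor lam i a then 1 else 0) + if i + 1 = lam a then 1 else 0 := by
  have hN : 0 < N := Nat.pos_of_neZero N
  obtain ⟨w, hw, hi⟩ : ∃ w < N, i = lam a + (w : ℕ) :=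
    ⟨(i - lam a).val, ZMod.val_lt _, by simp⟩
  have e1 : (i - lam a).val = w := by
    rw [hi, add_sub_cancel_left, ZMod.val_cast_of_lt hw]
  have hlt := G.vjump_lt lam a
  have cast_eq {p q : ℕ} (hp : p < N) (hq : q < N) : ((p : ZMod N) = q) ↔ p = q := by
    rw [ZMod.natCast_eq_natCast_iff]
    exact ⟨fun h => Nat.ModEq.eq_of_lt_of_lt h hp hq, fun h => h ▸ rfl⟩
  have e3 : i + 1 = lam a + ((w + 1 : ℕ) : ZMod N) := by rw [hi]; push_cast; ring
  rcases (Nat.succ_le_of_lt hw).lt_or_eq with h | h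
  · have e2 : (i + 1 - lam a).val = w + 1 := by
      rw [e3, add_sub_cancel_left, ZMod.val_cast_of_lt h]
    have e4 : i + 1 = lam (G.cw a) ↔ w + 1 = G.vjump lam a := by
      rw [e3, G.lam_cw lam a, add_right_inj, cast_eq h hlt]
    have e5 : ¬ i + 1 = lam a := by
      rw [e3]
      intro hh
      have := (cast_eq (p := w + 1) (q := 0) h hN).1 (by simpa using hh)
      omega
    have c1 : G.HasColor lam i a ↔ w < G.vjump lam a := by rw [HasColor, e1]
    have c2 : G.HasColor lam (i + 1) a ↔ w + 1 < G.vjump lam a := by rw [HasColor, e2]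
    rw [if_neg e5, if_congr c2 rfl rfl, if_congr c1 rfl rfl, if_congr e4 rfl rfl]
    split_ifs <;> omega
  · have e6 : i + 1 = lam a := by
      rw [e3, ← Nat.succ_eq_add_one, h]; simp
    have e2 : (i + 1 - lam a).val = 0 := by rw [e6]; simp
    have e4 : i + 1 = lam (G.cw a) ↔ 0 = G.vjump lam a := by
      rw [e6, G.lam_cw lam a, ← cast_eq hN hlt]; simp [eq_comm]
    have c1 : ¬ G.HasColor lam i a := by rw [HasColor, e1]; omega
    have c2 : G.HasColor lam (i + 1) a ↔ 0 < G.vjump lam a := by rw [HasColor, e2]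
    rw [if_neg c1, if_pos e6]
    split_ifs with h1 h2 h2 <;> simp only [c2, e4] at h1 h2 <;> omega

theorem lam_cw_pow (lam : D → ZMod N) (y : D) (t : ℕ) :
    lam ((G.cw ^ t) y) = lam y + (G.cumul lam y t : ℕ) := by
  induction t with
  | zero => simp [cumul]
  | succ t ih =>
    rw [pow_succ', Equiv.Perm.mul_apply, G.lam_cw lam, ih, cumul_succ]
    push_cast
    ring

section Fintype

variable [Fintype D]

theorem sum_tail_comp_cw {M : Type*} [AddCommMonoid M] (x : G.Vertex) (f : D → M) :
    ∑ a : D with G.tail a = x, f (G.cw a) = ∑ a : D with G.tail a = x, f a :=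
  Finset.sum_equiv G.cw (by simp) (by simp)

/-- If the jumps around a vertex add up to `N`, then every color occurs exactly once around it:
the number of occurrences does not depend on the color, and the total is `N`. -/
theorem sum_hasColor {lam : D → ZMod N} {x : G.Vertex}
    (hsum : ∑ a : D with G.tail a = x, G.vjump lam a = N) (i : ZMod N) :
    ∑ a : D with G.tail a = x, (if G.HasColor lam i a then 1 else 0) = 1 := by
  have hN : 0 < N := Nat.pos_of_neZero N
  set S : ZMod N → ℕ := fun i => ∑ a : D with G.tail a = x, (if G.HasColor lam i a then 1 else 0)
    with hS
  have step : ∀ i, S (i + 1) = S i := by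
    intro i
    have h := Finset.sum_congr (rfl : (Finset.univ.filter fun a : D => G.tail a = x) = _)
      (fun a _ => G.hasColor_succ_indicator lam i a)
    rw [Finset.sum_add_distrib, Finset.sum_add_distrib,
      G.sum_tail_comp_cw x (fun a => if i + 1 = lam a then 1 else 0)] at h
    exact Nat.add_right_cancel h
  have const : ∀ i, S i = S 0 := by
    intro i
    rw [← ZMod.natCast_zmod_val i]
    induction i.val with
    | zero => simp
    | succ n ih => push_cast; rw [step, ih]
  have total : ∑ i, S i = N := by
    rw [hS, Finset.sum_comm]
    refine Eq.trans ?_ hsum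
    refine Finset.sum_congr rfl fun a _ => ?_
    rw [← G.natCard_hasColor lam a, Nat.card_eq_fintype_card, Fintype.card_subtype,
      Finset.sum_boole, Nat.cast_id]
  rw [Finset.sum_congr rfl (fun i _ => const i), Finset.sum_const, Finset.card_univ, ZMod.card,
    smul_eq_mul] at total
  show S i = 1
  rw [const]
  exact Nat.eq_of_mul_eq_mul_left hN (by omega)

theorem existsUnique_hasColor {lam : D → ZMod N} {x : G.Vertex}
    (hsum : ∑ a : D with G.tail a = x, G.vjump lam a = N) (i : ZMod N) :
    ∃! a, G.tail a = x ∧ G.HasColor lam i a := by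
  have h := G.sum_hasColor hsum i
  rw [Finset.sum_boole, Nat.cast_id, Finset.filter_filter, Finset.card_eq_one] at h
  obtain ⟨a, ha⟩ := h
  simp only [Finset.ext_iff, Finset.mem_filter, Finset.mem_univ, true_and,
    Finset.mem_singleton] at ha
  exact ⟨a, (ha a).2 rfl, fun y hy => (ha y).1 hy⟩

section Family

variable {lam : D → ZMod N} {x : G.Vertex} (hsum : ∑ a : D with G.tail a = x, G.vjump lam a = N)
  {a : ZMod N → D} (ha : ∀ i, G.tail (a i) = x ∧ G.HasColor lam i (a i))
include hsum

omit [NeZero N] in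
theorem cumul_add_vdeg {y : D} (hy : G.tail y = x) (t : ℕ) :
    G.cumul lam y (t + G.vdeg x) = G.cumul lam y t + N := by
  have h0 : G.cumul lam y (G.vdeg x) = N := by
    refine Eq.trans ?_ hsum
    rw [← hy, G.sum_tail]
    rfl
  induction t with
  | zero => rw [zero_add, h0]; simp [cumul]
  | succ t ih =>
    rw [add_right_comm, cumul_succ, ih, cumul_succ, ← hy, cw_pow_add_vdeg]
    ring

include ha

/-- The arc of color `j + m` is the one that is reached, clockwise from the arc of color `j`, when
the cumulated jump passes the position of the color. -/
theorem cumul_sweep (j : ZMod N) (m : ℕ) :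
    G.cumul lam (a j) (G.sweep a j m) ≤ (j - lam (a j)).val + m ∧
      (j - lam (a j)).val + m < G.cumul lam (a j) (G.sweep a j m + 1) := by
  set r := (j - lam (a j)).val with hr
  have hjr : j = lam (a j) + (r : ℕ) := by simp [hr]
  induction m with
  | zero =>
    rw [sweep_zero, zero_add, cumul_one]
    exact ⟨by simp [cumul], (ha j).2⟩
  | succ m ih =>
    set t := G.sweep a j m with ht
    have ht' : (G.cw ^ t) (a j) = a (j + m) := G.cw_pow_sweep (fun i => (ha i).1) j m
    rw [sweep_succ, ← ht]
    set τ := G.turn (a (j + m)) (a (j + m + 1)) with hτ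
    have hτ' : (G.cw ^ τ) (a (j + m)) = a (j + m + 1) :=
      G.cw_pow_turn (by rw [(ha _).1, (ha _).1])
    have hτlt : τ < G.vdeg x := by
      rw [← (ha (j + m)).1]
      exact G.turn_lt (by rw [(ha _).1, (ha _).1])
    have hpos : (G.cw ^ (t + τ)) (a j) = a (j + m + 1) := by
      rw [add_comm, pow_add, Equiv.Perm.mul_apply, ht', hτ']
    obtain ⟨u, hu, hju⟩ := G.hasColor_iff.1 (ha (j + m + 1)).2
    rw [← hpos, G.lam_cw_pow lam] at hju
    rw [← hpos] at hu
    have hs1 := G.cumul_succ lam (a j) (t + τ)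
    have hs0 := G.cumul_succ lam (a j) t
    have hv0 := G.vjump_lt lam ((G.cw ^ t) (a j))
    have hv1 := G.vjump_lt lam ((G.cw ^ (t + τ)) (a j))
    have hmod : r + (m + 1) ≡ G.cumul lam (a j) (t + τ) + u [MOD N] := by
      rw [← ZMod.natCast_eq_natCast_iff]
      push_cast
      linear_combination hju - hjr
    -- both sides are congruent modulo `N`, and the cumulated jumps keep them less than `N` apart
    have key : r + (m + 1) = G.cumul lam (a j) (t + τ) + u := by
      rcases Nat.eq_zero_or_pos τ with h0 | h0
      · rw [h0, add_zero] at hs1 hv1 hu hmod ⊢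
        refine Nat.ModEq.eq_of_abs_lt hmod ?_
        rw [abs_lt]
        constructor <;> push_cast <;> omega
      · have h1 := G.cumul_mono lam (a j) (show t + 1 ≤ t + τ by omega)
        have h2 := G.cumul_mono lam (a j) (show t + τ + 1 ≤ t + G.vdeg x by omega)
        rw [G.cumul_add_vdeg hsum (ha j).1] at h2
        refine Nat.ModEq.eq_of_abs_lt hmod ?_
        rw [abs_lt]
        constructor <;> push_cast <;> omega
    omega

/-- The arcs of colors `j, j + 1, …, j + N` make exactly one turn. -/
theorem sweep_eq_vdeg (j : ZMod N) : G.sweep a j N = G.vdeg x := by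
  obtain ⟨h1, h2⟩ := G.cumul_sweep hsum ha j N
  have hn := G.cumul_add_vdeg hsum (ha j).1 0
  have hn1 := G.cumul_add_vdeg hsum (ha j).1 1
  have h0 : G.cumul lam (a j) 0 = 0 := by simp [cumul]
  have hr := (ha j).2
  rw [HasColor, ← cumul_one] at hr
  rw [zero_add] at hn
  rcases lt_trichotomy (G.sweep a j N) (G.vdeg x) with h | h | h
  · have := G.cumul_mono lam (a j) (show G.sweep a j N + 1 ≤ G.vdeg x from h)
    omega
  · exact h
  · have := G.cumul_mono lam (a j) (show 1 + G.vdeg x ≤ G.sweep a j N by omega)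
    omega

/-- The arc `y` is strictly between the arcs of colors `j` and `j + m` when the labels on both of
its sides lie in the cyclic interval from `j + 1` to `j + m`, in this order. -/
theorem strictlyBetween_iff {y : D} (hy : G.tail y = x) (j : ZMod N) {m : ℕ} (hm : m ≤ N) :
    G.StrictlyBetween a j m y ↔
      ∃ u : ℕ, lam y = j + 1 + u ∧ u + 1 + G.vjump lam y ≤ m := by
  obtain ⟨h1, h2⟩ := G.cumul_sweep hsum ha j m
  have hr := (ha j).2
  have hxy : G.tail (a j) = G.tail y := by rw [(ha j).1, hy]
  set r := (j - lam (a j)).val with hrdef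
  have hjr : lam (a j) = j - (r : ℕ) := by simp [hrdef]
  rw [HasColor, ← hrdef, ← cumul_one] at hr
  set τ := G.turn (a j) y with hτ
  have hτy : (G.cw ^ τ) (a j) = y := G.cw_pow_turn hxy
  have hτlt : τ < G.vdeg x := by rw [← (ha j).1]; exact G.turn_lt hxy
  have hlam : lam y = j - (r : ℕ) + (G.cumul lam (a j) τ : ℕ) := by
    rw [← hτy, G.lam_cw_pow lam, hjr]
  have hs := G.cumul_succ lam (a j) τ
  rw [hτy] at hs
  have hle := G.cumul_mono lam (a j) (show τ + 1 ≤ 0 + G.vdeg x by omega)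
  rw [G.cumul_add_vdeg hsum (ha j).1 0] at hle
  have h0 : G.cumul lam (a j) 0 = 0 := by simp [cumul]
  rw [StrictlyBetween, ← hτ]
  have hmod {u : ℕ} (hu : lam y = j + 1 + u) : G.cumul lam (a j) τ ≡ r + 1 + u [MOD N] := by
    rw [← ZMod.natCast_eq_natCast_iff]
    rw [hlam] at hu
    push_cast
    linear_combination hu
  rcases Nat.eq_zero_or_pos τ with hz | hp
  · constructor
    · intro h; omega
    · rintro ⟨u, hu, hle'⟩
      exfalso
      have h3 := hmod hu
      rw [hz, h0] at h3
      rw [hz] at hs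
      have h4 := Nat.ModEq.eq_of_abs_lt h3 (by
        rw [abs_lt]
        rw [zero_add, h0] at hs
        constructor <;> push_cast <;> omega)
      omega
  · have hge := G.cumul_mono lam (a j) (show 1 ≤ τ from hp)
    constructor
    · rintro ⟨-, hlt⟩
      have h3 := G.cumul_mono lam (a j) (show τ + 1 ≤ G.sweep a j m from hlt)
      refine ⟨G.cumul lam (a j) τ - r - 1, ?_, by omega⟩
      rw [hlam]
      have : ((G.cumul lam (a j) τ - r - 1 : ℕ) : ZMod N)
          = (G.cumul lam (a j) τ : ZMod N) - r - 1 := by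
        rw [Nat.sub_sub, Nat.cast_sub (by omega)]
        push_cast
        ring
      rw [this]
      ring
    · rintro ⟨u, hu, hle'⟩
      refine ⟨hp, ?_⟩
      have h3 := Nat.ModEq.eq_of_abs_lt (hmod hu) (by
        rw [abs_lt]
        constructor <;> push_cast <;> omega)
      by_contra hcon
      have h4 := G.cumul_mono lam (a j) (show G.sweep a j m + 1 ≤ τ + 1 by omega)
      omega

end Family

/-- The colors of the arcs out of a vertex determine the labels around it. -/
theorem eq_of_hasColor_iff {lam lam' : D → ZMod N} {x : G.Vertex}
    (hsum : ∑ a : D with G.tail a = x, G.vjump lam a = N)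
    (hsum' : ∑ a : D with G.tail a = x, G.vjump lam' a = N)
    (h : ∀ y, G.tail y = x → ∀ i, G.HasColor lam i y ↔ G.HasColor lam' i y)
    {y : D} (hy : G.tail y = x) : lam y = lam' y := by
  choose a ha _ using fun i => G.existsUnique_hasColor hsum i
  have ha' : ∀ i, G.tail (a i) = x ∧ G.HasColor lam' i (a i) := fun i =>
    ⟨(ha i).1, (h _ (ha i).1 i).1 (ha i).2⟩
  have hv : G.vjump lam y = G.vjump lam' y := by
    rw [← natCard_hasColor, ← natCard_hasColor]
    exact Nat.card_congr (Equiv.subtypeEquivRight (h y hy))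
  have hlt := G.vjump_lt lam y
  have h1 : G.StrictlyBetween a (lam y - 1) (1 + G.vjump lam y) y :=
    (G.strictlyBetween_iff hsum ha hy _ (by omega)).2 ⟨0, by simp, by omega⟩
  obtain ⟨u, hu, hle⟩ := (G.strictlyBetween_iff hsum' ha' hy _ (by omega)).1 h1
  have : u = 0 := by omega
  rw [hu, this]
  simp

end Fintype

end Labels

end RotationSystem

/-! ### Labels from the arcs of all colors -/

namespace RotationSystem

variable {D : Type*} (G : RotationSystem D) {N : ℕ}

theorem sweep_mono (a : ZMod N → D) (j : ZMod N) : Monotone (G.sweep a j) :=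
  monotone_nat_of_le_succ fun k => by rw [sweep_succ]; exact Nat.le_add_right _ _

theorem sweep_add_period {a : ZMod N → D} {x : G.Vertex} (hsw : G.sweep a 0 N = G.vdeg x) (k : ℕ) :
    G.sweep a 0 (k + N) = G.sweep a 0 k + G.vdeg x := by
  induction k with
  | zero => simp [hsw, sweep_zero]
  | succ k ih =>
    rw [add_right_comm, sweep_succ, ih, sweep_succ]
    push_cast
    rw [ZMod.natCast_self, add_zero]
    ring

variable [NeZero N] [Fintype D]

/-- If the arcs `a i` out of a vertex make exactly one clockwise turn, then they are the arcs of
the respective colors for some labels of the corners around the vertex.  The label of the corner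
before the arc reached after `s` steps from `a 0` is the least `k` for which going through
`a 0, …, a k` makes at least `s` steps.  Steps are counted from `vdeg x` on, so that this least `k`
is positive and quasi-periodic in `s`. -/
theorem exists_hasColor_iff {a : ZMod N → D} {x : G.Vertex} (ha : ∀ i, G.tail (a i) = x)
    (hsw : G.sweep a 0 N = G.vdeg x) :
    ∃ lam : D → ZMod N, ∀ y, G.tail y = x → ∀ i, G.HasColor lam i y ↔ a i = y := by
  have hN : 0 < N := Nat.pos_of_neZero N
  set n := G.vdeg x with hn
  have hnpos : 0 < n := by rw [hn, ← ha 0]; exact G.vdeg_pos _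
  set S : ℕ → ℕ := G.sweep a 0 with hS
  have hS0 : S 0 = 0 := G.sweep_zero a 0
  have hper : ∀ k, S (k + N) = S k + n := fun k => G.sweep_add_period hsw k
  have hmono : Monotone S := G.sweep_mono a 0
  have hstep : ∀ k, S (k + 1) < S k + n := by
    intro k
    rw [hS, sweep_succ]
    refine Nat.add_lt_add_left ?_ _
    rw [hn, ← ha (0 + k)]
    exact G.turn_lt (by rw [ha, ha])
  have harc : ∀ k : ℕ, (G.cw ^ S k) (a 0) = a k := by
    intro k
    have := G.cw_pow_sweep ha 0 k
    rwa [zero_add] at this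
  have hex : ∀ s, ∃ k, s ≤ S k := by
    intro s
    refine ⟨s * N, ?_⟩
    induction s with
    | zero => simp
    | succ s ih => rw [Nat.succ_mul, hper]; omega
  set K : ℕ → ℕ := fun s => Nat.find (hex s) with hK
  have gal : ∀ s k, K s ≤ k ↔ s ≤ S k := by
    intro s k
    constructor
    · intro h
      exact (Nat.find_spec (hex s)).trans (hmono h)
    · intro h
      exact Nat.find_min' (hex s) h
  have hKper : ∀ s, 0 < s → K (s + n) = K s + N := by
    intro s hs
    apply le_antisymm
    · rw [gal, hper]
      exact Nat.add_le_add_right ((gal s _).1 le_rfl) _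
    · have h := (gal (s + n) _).1 le_rfl
      have hlt : N < K (s + n) := by
        by_contra hcon
        have := hmono (not_lt.1 hcon)
        have h3 : S N = n := hsw
        omega
      obtain ⟨k, hk⟩ := Nat.exists_eq_add_of_lt hlt
      have hk' : K (s + n) = (k + 1) + N := by omega
      rw [hk', hper] at h
      have := (gal s (k + 1)).2 (by omega)
      omega
  refine ⟨fun y => K (G.turn (a 0) y + n), fun y hy i => ?_⟩
  have hay : G.tail (a 0) = G.tail y := by rw [ha, hy]
  set τ := G.turn (a 0) y with hτ
  have hτy : (G.cw ^ τ) (a 0) = y := G.cw_pow_turn hay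
  have hτlt : τ < n := by rw [hn, ← ha 0]; exact G.turn_lt hay
  have hnext : ((K (G.turn (a 0) (G.cw y) + n) : ℕ) : ZMod N) = (K (τ + n + 1) : ℕ) := by
    rcases (Nat.succ_le_of_lt hτlt).lt_or_eq with h | h
    · rw [G.turn_eq (a := a 0) (k := τ + 1) (by rw [pow_succ', Equiv.Perm.mul_apply, hτy])
        (by rw [ha, ← hn]; exact h)]
      congr 2
      omega
    · rw [G.turn_eq (a := a 0) (k := 0)
        (by
          rw [← hτy, ← Equiv.Perm.mul_apply, ← pow_succ', G.cw_pow_eq_iff, ha, ← hn,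
            show τ + 1 = n from h]
          exact (Nat.modEq_zero_iff_dvd.2 dvd_rfl).symm)
        (by rw [ha, ← hn]; exact hnpos)]
      rw [show τ + n + 1 = n + n by omega, hKper n hnpos, zero_add]
      simp
  set s := τ + n with hs
  have hspos : 0 < s := by omega
  have hcws : (G.cw ^ s) (a 0) = y := by
    rw [← hτy, hs, hn, ← ha 0, G.cw_pow_add_vdeg]
  have hKpos : 0 < K s := by
    by_contra h
    have := (gal s 0).1 (by omega)
    omega
  have hpred : S (K s - 1) < s := by
    by_contra h
    have := (gal s (K s - 1)).2 (by omega)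
    omega
  have hKle : K s ≤ K (s + 1) := (gal _ _).2 (by have := (gal (s + 1) _).1 le_rfl; omega)
  have hKs := (gal s (K s)).1 le_rfl
  have hlast : K s - 1 + N = K s + N - 1 := by omega
  have hKlt : K (s + 1) < K s + N := by
    have h1 := hstep (K s - 1)
    rw [Nat.sub_add_cancel hKpos] at h1
    have h2 := hper (K s - 1)
    have := (gal (s + 1) (K s - 1 + N)).2 (by omega)
    omega
  have hv : G.vjump (fun y => ((K (G.turn (a 0) y + n) : ℕ) : ZMod N)) y = K (s + 1) - K s := by
    rw [vjump, hnext, ← hτ, ← hs, ← Nat.cast_sub hKle, ZMod.val_cast_of_lt (by omega)]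
  rw [hasColor_iff, hv, ← hτ, ← hs]
  constructor
  · rintro ⟨u, hu, rfl⟩
    have h1 := (gal s (K s + u)).1 (by omega)
    have h2 : ¬ s + 1 ≤ S (K s + u) := fun h => by
      have := (gal _ _).2 h
      omega
    have h3 := harc (K s + u)
    rw [show S (K s + u) = s by omega, hcws] at h3
    rw [h3]
    push_cast
    rfl
  · intro hi
    obtain ⟨u, hu, hiu⟩ : ∃ u < N, i = (K s : ℕ) + ((u : ℕ) : ZMod N) :=
      ⟨(i - (K s : ℕ)).val, ZMod.val_lt _, by simp⟩
    refine ⟨u, ?_, hiu⟩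
    have h1 := (gal s (K s + u)).1 (by omega)
    have h2 := harc (K s + u)
    rw [Nat.cast_add, ← hiu, hi, ← hcws, G.cw_pow_eq_iff, ha, ← hn] at h2
    have h3 : S (K s + u) ≤ S (K s - 1 + N) := hmono (by omega)
    rw [hper] at h3
    have h4 := h2.symm.eq_of_abs_lt (by
      rw [abs_lt]
      constructor <;> omega)
    by_contra hcon
    have := (gal (s + 1) (K s + u)).1 (by omega)
    omega

/-- The jumps around a vertex add up to `N` when every color has exactly one arc. -/
theorem sum_vjump_of_hasColor_iff {lam : D → ZMod N} {a : ZMod N → D} {x : G.Vertex}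
    (ha : ∀ i, G.tail (a i) = x)
    (h : ∀ y, G.tail y = x → ∀ i, G.HasColor lam i y ↔ a i = y) :
    ∑ y : D with G.tail y = x, G.vjump lam y = N := by
  have h1 : ∀ y ∈ Finset.univ.filter (fun y : D => G.tail y = x), G.vjump lam y
      = (Finset.univ.filter fun i => a i = y).card := by
    intro y hy
    rw [← G.natCard_hasColor lam y, Nat.card_eq_fintype_card, Fintype.card_subtype]
    congr 1
    ext i
    simp [h y (Finset.mem_filter.1 hy).2 i]
  rw [Finset.sum_congr rfl h1]
  have h2 := Finset.card_eq_sum_card_fiberwise (f := a) (s := Finset.univ)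
    (t := Finset.univ.filter fun y : D => G.tail y = x) (by simp [ha, Set.MapsTo])
  rw [Finset.card_univ, ZMod.card] at h2
  convert h2.symm

end RotationSystem

/-! ### The Euler relation and exactness -/

namespace RotationSystem

variable {D : Type*} (G : RotationSystem D)

/-- The edge of an arc. -/
def edge (a : D) : G.Edge := Quotient.mk (Equiv.Perm.SameCycle.setoid G.rev) a

theorem edge_eq_iff {a a' : D} : G.edge a = G.edge a' ↔ a = a' ∨ a = G.rev a' := by
  have h : G.edge a = G.edge a' ↔ G.rev.SameCycle a a' := Quotient.eq
  rw [h]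
  constructor
  · rintro ⟨k, rfl⟩
    have h2 : G.rev ^ (2 : ℤ) = 1 := by
      ext x
      simp [zpow_ofNat, pow_two, G.rev_rev]
    rcases Int.even_or_odd' k with ⟨m, rfl | rfl⟩
    · left; rw [zpow_mul, h2]; simp
    · right; rw [zpow_add, zpow_mul, h2]; simp [G.rev_rev]
  · rintro (rfl | rfl)
    · exact Equiv.Perm.SameCycle.refl _ _
    · exact Equiv.Perm.sameCycle_apply_left.2 (Equiv.Perm.SameCycle.refl _ _)

@[simp] theorem edge_rev (a : D) : G.edge (G.rev a) = G.edge a := G.edge_eq_iff.2 (Or.inr rfl)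

theorem forall_of_connected (hconn : MulAction.IsPretransitive (Subgroup.closure {G.cw, G.rev}) D)
    {P : D → Prop} (hcw : ∀ a, P (G.cw a) ↔ P a) (hrev : ∀ a, P (G.rev a) ↔ P a) {a₀ : D}
    (h₀ : P a₀) (a : D) : P a := by
  have key : ∀ g ∈ Subgroup.closure {G.cw, G.rev}, ∀ x, P (g x) ↔ P x := by
    intro g hg
    induction hg using Subgroup.closure_induction with
    | mem g hg =>
      rcases hg with rfl | rfl
      · exact hcw
      · exact hrev
    | one => intro x; rfl
    | mul g h _ _ ihg ihh => intro x; rw [Equiv.Perm.mul_apply, ihg, ihh]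
    | inv g _ ih => exact fun x => (ih (g⁻¹ x)).symm.trans (by simp)
  obtain ⟨g, hg⟩ := hconn.exists_smul_eq a₀ a
  rw [← hg]
  exact (key g.1 g.2 a₀).2 h₀

instance [Finite D] : Finite G.Vertex := inferInstanceAs (Finite (Quotient _))
instance [Finite D] : Finite G.Face := inferInstanceAs (Finite (Quotient _))
instance [Finite D] : Finite G.Edge := inferInstanceAs (Finite (Quotient _))
instance [Finite D] : Fintype G.Vertex := Fintype.ofFinite _
instance [Finite D] : Fintype G.Face := Fintype.ofFinite _
instance [Finite D] : Fintype G.Edge := Fintype.ofFinite _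

variable [Fintype D]

theorem card_arcs : Fintype.card D = 2 * Nat.card G.Edge := by
  have h := Finset.card_eq_sum_card_fiberwise (f := G.edge) (s := Finset.univ)
    (t := Finset.univ) (by simp [Set.MapsTo])
  rw [Finset.card_univ] at h
  have h2 : ∀ e ∈ (Finset.univ : Finset G.Edge),
      (Finset.univ.filter fun a => G.edge a = e).card = 2 := by
    intro e _
    obtain ⟨a, rfl⟩ : ∃ a, G.edge a = e := Quotient.exists_rep e
    rw [show (Finset.univ.filter fun y => G.edge y = G.edge a) = {a, G.rev a} by
      ext y; simp [G.edge_eq_iff]]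
    exact Finset.card_pair (G.rev_ne a).symm
  rw [h, Finset.sum_congr rfl h2, Finset.sum_const, Finset.card_univ, Nat.card_eq_fintype_card,
    smul_eq_mul, mul_comm]

theorem sum_leftFace_comp {M : Type*} [AddCommMonoid M] (f : G.Face) (g : D → M) :
    ∑ a : D with G.leftFace a = f, g (G.cw (G.rev a)) = ∑ a : D with G.leftFace a = f, g a :=
  Finset.sum_equiv G.faceCw.symm (by simp [faceCw_symm_apply])
    (by simp [faceCw_symm_apply])

theorem sum_edge_comp_rev {M : Type*} [AddCommMonoid M] (e : G.Edge) (g : D → M) :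
    ∑ a : D with G.edge a = e, g (G.rev a) = ∑ a : D with G.edge a = e, g a :=
  Finset.sum_equiv G.rev (by simp) (by simp)

theorem sum_edge {M : Type*} [AddCommMonoid M] (a : D) (g : D → M) :
    ∑ y : D with G.edge y = G.edge a, g y = g a + g (G.rev a) := by
  rw [show (Finset.univ.filter fun y => G.edge y = G.edge a) = {a, G.rev a} by
    ext y; simp [G.edge_eq_iff]]
  exact Finset.sum_pair (G.rev_ne a).symm

/-- The Euler relation, as a balance of the jumps around the vertices, faces and edges: `ε a` is
thought of as the jump across the arc `a` at its initial vertex, and `φ a` as the jump along the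
left side of the edge of `a`, to the corner of `a`. -/
theorem sum_balance (heuler : Nat.card G.Vertex + Nat.card G.Face = Nat.card G.Edge + 2)
    (d : ℤ) (φ ε : D → ℤ) :
    ∑ a : D, (φ a + ε a + φ (G.rev a) + ε (G.rev a) - d)
      = 2 * (∑ x : G.Vertex, (∑ a : D with G.tail a = x, ε a - d)
          + ∑ f : G.Face, (∑ a : D with G.leftFace a = f, φ a - d)) + 4 * d := by
  simp only [Finset.sum_sub_distrib, Finset.sum_add_distrib, Finset.sum_const, Finset.card_univ,
    nsmul_eq_mul]
  have hV : ∑ x : G.Vertex, ∑ a : D with G.tail a = x, ε a = ∑ a, ε a := by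
    convert Finset.sum_fiberwise Finset.univ G.tail ε
  have hF : ∑ f : G.Face, ∑ a : D with G.leftFace a = f, φ a = ∑ a, φ a := by
    convert Finset.sum_fiberwise Finset.univ G.leftFace φ
  rw [Equiv.sum_comp G.rev φ, Equiv.sum_comp G.rev ε, G.card_arcs, hV, hF]
  rw [Nat.card_eq_fintype_card, Nat.card_eq_fintype_card, Nat.card_eq_fintype_card] at heuler
  rw [Nat.card_eq_fintype_card]
  have h : (Fintype.card G.Vertex : ℤ) + Fintype.card G.Face = Fintype.card G.Edge + 2 := by
    exact_mod_cast heuler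
  push_cast
  linear_combination 2 * d * h

section Exactness

variable (A : Type*) [AddCommGroup A]

/-- The coboundary of a labeling of the corners: its jumps along the face sides of the arcs and
its jumps across the arcs. -/
def cornerCoboundary : (D → A) →+ (D → A) × (D → A) where
  toFun lam := (fun a => lam a - lam (G.cw (G.rev a)), fun a => lam (G.cw a) - lam a)
  map_zero' := by ext <;> simp
  map_add' := by intro x y; ext <;> simp <;> abel

/-- The total jumps of a pair of jump functions around the vertices, the faces and the edges. -/
def jumpCoboundary :
    (D → A) × (D → A) →+ (G.Vertex → A) × (G.Face → A) × (G.Edge → A) where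
  toFun p := (fun x => ∑ a : D with G.tail a = x, p.2 a,
    fun f => ∑ a : D with G.leftFace a = f, p.1 a,
    fun e => ∑ a : D with G.edge a = e, (p.1 a + p.2 a))
  map_zero' := by ext <;> simp
  map_add' := by
    intro x y
    refine Prod.ext ?_ (Prod.ext ?_ ?_)
    · funext x; simp [Finset.sum_add_distrib]
    · funext f; simp [Finset.sum_add_distrib]
    · funext e; simp [Finset.sum_add_distrib]; abel

theorem range_cornerCoboundary_le :
    (G.cornerCoboundary A).range ≤ (G.jumpCoboundary A).ker := by
  rintro _ ⟨lam, rfl⟩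
  rw [AddMonoidHom.mem_ker]
  refine Prod.ext ?_ (Prod.ext ?_ ?_)
  · funext x
    simp [jumpCoboundary, cornerCoboundary, G.sum_tail_comp_cw]
  · funext f
    simp [jumpCoboundary, cornerCoboundary, G.sum_leftFace_comp]
  · funext e
    have h := G.sum_edge_comp_rev e (fun a => lam (G.cw a))
    simp [jumpCoboundary, cornerCoboundary, h]

variable {A}

/-- Modulo total jumps, an amount `x` at an edge may be moved to any other edge, and traded for
`-x` at any vertex or face. -/
theorem quotient_jumpCoboundary_surjective
    (hconn : MulAction.IsPretransitive (Subgroup.closure {G.cw, G.rev}) D) (a₀ : D) :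
    Function.Surjective (fun x : A => (QuotientAddGroup.mk (0, 0, Pi.single (G.edge a₀) x) :
      ((G.Vertex → A) × (G.Face → A) × (G.Edge → A)) ⧸ (G.jumpCoboundary A).range)) := by
  set q := QuotientAddGroup.mk' (G.jumpCoboundary A).range with hq
  let iV (x : G.Vertex) : A →+ (G.Vertex → A) × (G.Face → A) × (G.Edge → A) :=
    (AddMonoidHom.inl _ _).comp (AddMonoidHom.single (fun _ => A) x)
  let iF (f : G.Face) : A →+ (G.Vertex → A) × (G.Face → A) × (G.Edge → A) :=
    (AddMonoidHom.inr _ _).comp ((AddMonoidHom.inl _ _).comp (AddMonoidHom.single (fun _ => A) f))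
  let iE (e : G.Edge) : A →+ (G.Vertex → A) × (G.Face → A) × (G.Edge → A) :=
    (AddMonoidHom.inr _ _).comp ((AddMonoidHom.inr _ _).comp (AddMonoidHom.single (fun _ => A) e))
  have hVE : ∀ a, q.comp (iV (G.tail a)) = -q.comp (iE (G.edge a)) := by
    intro a
    ext x
    rw [AddMonoidHom.neg_apply, eq_neg_iff_add_eq_zero]
    show q (iV (G.tail a) x) + q (iE (G.edge a) x) = 0
    rw [← map_add, hq, QuotientAddGroup.mk'_apply, QuotientAddGroup.eq_zero_iff]
    refine ⟨(0, Pi.single a x), ?_⟩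
    refine Prod.ext ?_ (Prod.ext ?_ ?_)
    · funext t; simp [jumpCoboundary, iV, iE, Pi.single_apply, eq_comm]
    · simp [jumpCoboundary, iV, iE]; rfl
    · funext t; simp [jumpCoboundary, iV, iE, Pi.single_apply, eq_comm]
  have hFE : ∀ a, q.comp (iF (G.leftFace a)) = -q.comp (iE (G.edge a)) := by
    intro a
    ext x
    rw [AddMonoidHom.neg_apply, eq_neg_iff_add_eq_zero]
    show q (iF (G.leftFace a) x) + q (iE (G.edge a) x) = 0
    rw [← map_add, hq, QuotientAddGroup.mk'_apply, QuotientAddGroup.eq_zero_iff]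
    refine ⟨(Pi.single a x, 0), ?_⟩
    refine Prod.ext ?_ (Prod.ext ?_ ?_)
    · simp [jumpCoboundary, iF, iE]; rfl
    · funext t; simp [jumpCoboundary, iF, iE, Pi.single_apply, eq_comm]
    · funext t; simp [jumpCoboundary, iF, iE, Pi.single_apply, eq_comm]
  have hEE : ∀ a, q.comp (iE (G.edge a)) = q.comp (iE (G.edge a₀)) := by
    refine G.forall_of_connected hconn (fun a => ?_) (fun a => by rw [edge_rev]) rfl
    have h : q.comp (iE (G.edge (G.cw a))) = q.comp (iE (G.edge a)) := by
      have h1 := hVE (G.cw a)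
      rw [tail_cw, hVE a] at h1
      ext x
      exact (neg_injective (DFunLike.congr_fun h1 x)).symm
    rw [h]
  have hE : ∀ e, q.comp (iE e) = q.comp (iE (G.edge a₀)) := by
    intro e
    obtain ⟨a, rfl⟩ : ∃ a, G.edge a = e := Quotient.exists_rep e
    exact hEE a
  have hV : ∀ v, q.comp (iV v) = -q.comp (iE (G.edge a₀)) := by
    intro v
    obtain ⟨a, rfl⟩ : ∃ a, G.tail a = v := Quotient.exists_rep v
    rw [hVE, hEE]
  have hF : ∀ f, q.comp (iF f) = -q.comp (iE (G.edge a₀)) := by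
    intro f
    obtain ⟨a, rfl⟩ : ∃ a, G.leftFace a = f := Quotient.exists_rep f
    rw [hFE, hEE]
  intro c
  obtain ⟨⟨cV, cF, cE⟩, rfl⟩ := QuotientAddGroup.mk'_surjective _ c
  refine ⟨∑ e, cE e - ∑ v, cV v - ∑ f, cF f, ?_⟩
  have hdecomp : ((cV, cF, cE) : (G.Vertex → A) × (G.Face → A) × (G.Edge → A))
      = ∑ v, iV v (cV v) + ∑ f, iF f (cF f) + ∑ e, iE e (cE e) := by
    have h1 : ∑ v, iV v (cV v) = (cV, 0, 0) := by
      simp only [iV, AddMonoidHom.comp_apply, AddMonoidHom.single_apply]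
      rw [← map_sum, Finset.univ_sum_single]
      rfl
    have h2 : ∑ f, iF f (cF f) = (0, cF, 0) := by
      simp only [iF, AddMonoidHom.comp_apply, AddMonoidHom.single_apply]
      rw [← map_sum, ← map_sum, Finset.univ_sum_single]
      rfl
    have h3 : ∑ e, iE e (cE e) = (0, 0, cE) := by
      simp only [iE, AddMonoidHom.comp_apply, AddMonoidHom.single_apply]
      rw [← map_sum, ← map_sum, Finset.univ_sum_single]
      rfl
    rw [h1, h2, h3]
    simp
  have hV' : ∀ v x, q (iV v x) = -q (iE (G.edge a₀) x) := fun v x => DFunLike.congr_fun (hV v) x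
  have hF' : ∀ v x, q (iF v x) = -q (iE (G.edge a₀) x) := fun v x => DFunLike.congr_fun (hF v) x
  have hE' : ∀ v x, q (iE v x) = q (iE (G.edge a₀) x) := fun v x => DFunLike.congr_fun (hE v) x
  have hL : (QuotientAddGroup.mk (0, 0, Pi.single (G.edge a₀)
      (∑ e, cE e - ∑ v, cV v - ∑ f, cF f)) :
      ((G.Vertex → A) × (G.Face → A) × (G.Edge → A)) ⧸ (G.jumpCoboundary A).range)
      = q (iE (G.edge a₀) (∑ e, cE e - ∑ v, cV v - ∑ f, cF f)) := rfl
  show _ = q (cV, cF, cE)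
  rw [hdecomp]
  simp only [map_add, map_sum, hV', hF', hE']
  rw [hL]
  simp only [map_sub, map_sum, Finset.sum_neg_distrib]
  abel

/-- On a connected map with `V - E + F = 2`, jumps that are closed (their totals around the
vertices, faces and edges vanish) come from a labeling of the corners.  Both groups are finite, and
are compared by counting: the labelings up to constants number at least `|A| ^ (|D| - 1)`, while
total jumps fill a subgroup of index at most `|A|`, so that there are at most `|A| ^ (|D| - 1)`
closed pairs of jump functions. -/
theorem exists_labels [Finite A]
    (hconn : MulAction.IsPretransitive (Subgroup.closure {G.cw, G.rev}) D)
    (heuler : Nat.card G.Vertex + Nat.card G.Face = Nat.card G.Edge + 2) (a₀ : D)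
    (φ ε : D → A) (hv : ∀ x : G.Vertex, ∑ a : D with G.tail a = x, ε a = 0)
    (hf : ∀ f : G.Face, ∑ a : D with G.leftFace a = f, φ a = 0)
    (he : ∀ a, φ a + ε a + φ (G.rev a) + ε (G.rev a) = 0) :
    ∃ lam : D → A, ∀ a, lam a = lam (G.cw (G.rev a)) + φ a ∧ lam (G.cw a) = lam a + ε a := by
  have := Fintype.ofFinite A
  set n := Nat.card A with hn
  have hnpos : 0 < n := Nat.card_pos
  set d0 := G.cornerCoboundary A
  set d1 := G.jumpCoboundary A
  -- kernel of `d0`: only the constant labelings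
  have hker0 : Nat.card d0.ker ≤ n := by
    refine Nat.card_le_card_of_injective (fun lam : d0.ker => lam.1 a₀) ?_
    intro lam mu h
    apply Subtype.ext
    funext a
    have hl {nu : D → A} (h : nu ∈ d0.ker) : (∀ a, nu (G.cw a) = nu a) ∧
        ∀ a, nu (G.rev a) = nu a := by
      have h' : d0 nu = 0 := h
      have h1 : ∀ a, nu a - nu (G.cw (G.rev a)) = 0 := fun a => congrFun (congrArg Prod.fst h') a
      have h2 : ∀ a, nu (G.cw a) - nu a = 0 := fun a => congrFun (congrArg Prod.snd h') a
      refine ⟨fun a => sub_eq_zero.1 (h2 a), fun a => ?_⟩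
      rw [sub_eq_zero.1 (h1 a), ← sub_eq_zero.1 (h2 (G.rev a))]
    refine G.forall_of_connected hconn (P := fun a => lam.1 a = mu.1 a)
      (fun a => ?_) (fun a => ?_) h a
    · rw [(hl lam.2).1, (hl mu.2).1]
    · rw [(hl lam.2).2, (hl mu.2).2]
  have hcoker : Nat.card (((G.Vertex → A) × (G.Face → A) × (G.Edge → A)) ⧸ d1.range) ≤ n :=
    Nat.card_le_card_of_surjective _ (G.quotient_jumpCoboundary_surjective hconn a₀)
  have hc0 : Nat.card d0.range * Nat.card d0.ker = n ^ Fintype.card D := by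
    have h := AddSubgroup.card_eq_card_quotient_mul_card_addSubgroup d0.ker
    rw [Nat.card_congr (QuotientAddGroup.quotientKerEquivRange d0).toEquiv] at h
    rw [← h, Nat.card_fun, Nat.card_eq_fintype_card (α := D)]
  have hc1 : Nat.card d1.range * Nat.card d1.ker = n ^ (2 * Fintype.card D) := by
    have h := AddSubgroup.card_eq_card_quotient_mul_card_addSubgroup d1.ker
    rw [Nat.card_congr (QuotientAddGroup.quotientKerEquivRange d1).toEquiv] at h
    rw [← h, Nat.card_prod, Nat.card_fun, Nat.card_eq_fintype_card (α := D), two_mul, pow_add]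
  have hc2 := AddSubgroup.card_eq_card_quotient_mul_card_addSubgroup d1.range
  rw [Nat.card_prod, Nat.card_prod, Nat.card_fun, Nat.card_fun, Nat.card_fun, ← pow_add,
    ← pow_add, ← hn] at hc2
  have hD := G.card_arcs
  have hle : Nat.card d1.ker ≤ Nat.card d0.range := by
    set r := Nat.card d1.range
    set k := Nat.card d1.ker
    set r0 := Nat.card d0.range
    have h1 : n ^ (Nat.card G.Vertex + (Nat.card G.Face + Nat.card G.Edge)) ≤ n * r := by
      rw [hc2]; exact Nat.mul_le_mul_right _ hcoker
    have h2 : n ^ Fintype.card D ≤ r0 * n := by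
      rw [← hc0]; exact Nat.mul_le_mul_left _ hker0
    -- `n ^ (V + F + E) * k ≤ n * r * k = n ^ (2 D + 1) ≤ n ^ (D + 1) * r0 * n`
    have h3 : n ^ (Nat.card G.Vertex + (Nat.card G.Face + Nat.card G.Edge)) * k
        ≤ n ^ (Nat.card G.Vertex + (Nat.card G.Face + Nat.card G.Edge)) * r0 := by
      calc _ ≤ n * r * k := Nat.mul_le_mul_right _ h1
        _ = n * n ^ Fintype.card D * n ^ Fintype.card D := by
          rw [mul_assoc, hc1, two_mul, pow_add, mul_assoc]
        _ ≤ n * n ^ Fintype.card D * (r0 * n) := Nat.mul_le_mul_left _ h2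
        _ = n ^ (Fintype.card D + 2) * r0 := by ring
        _ = _ := by congr 2; omega
    exact Nat.le_of_mul_le_mul_left h3 (pow_pos hnpos _)
  have heq : d0.range = d1.ker :=
    AddSubgroup.eq_of_le_of_card_ge (G.range_cornerCoboundary_le A) hle
  have hmem : (φ, ε) ∈ d1.ker := by
    rw [AddMonoidHom.mem_ker]
    refine Prod.ext (funext hv) (Prod.ext (funext hf) (funext fun e => ?_))
    obtain ⟨a, rfl⟩ : ∃ a, G.edge a = e := Quotient.exists_rep e
    show ∑ y : D with G.edge y = G.edge a, (φ y + ε y) = 0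
    rw [G.sum_edge, ← he a]
    abel
  rw [← heq] at hmem
  obtain ⟨lam, hlam⟩ := hmem
  refine ⟨lam, fun a => ?_⟩
  have h1 : lam a - lam (G.cw (G.rev a)) = φ a := congrFun (congrArg Prod.fst hlam) a
  have h2 : lam (G.cw a) - lam a = ε a := congrFun (congrArg Prod.snd hlam) a
  exact ⟨by rw [← h1]; abel, by rw [← h2]; abel⟩

end Exactness

end RotationSystem

/-! ### Outer arcs and inner corners -/

/-- The jump, in `{0, …, N - 1}`, from the label of the preceding corner clockwise around the
face to the label of the corner of `a`. -/
def RotationSystem.fjump {D : Type*} (G : RotationSystem D) {N : ℕ} (lam : D → ZMod N) (a : D) :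
    ℕ := (lam a - lam (G.cw (G.rev a))).val

theorem RotationSystem.fjump_lt {D : Type*} (G : RotationSystem D) {N : ℕ} [NeZero N]
    (lam : D → ZMod N) (a : D) : G.fjump lam a < N := ZMod.val_lt _

theorem RotationSystem.lam_fjump {D : Type*} (G : RotationSystem D) {N : ℕ} [NeZero N]
    (lam : D → ZMod N) (a : D) : lam a = lam (G.cw (G.rev a)) + G.fjump lam a := by
  simp [RotationSystem.fjump]

namespace DMap

variable {d : ℕ} {D : Type*} (G : DMap d D)

theorem outer_injective {i j : ZMod d} (h : G.outer i = G.outer j) : i = j :=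
  G.outer_distinct i j (by rw [h])

theorem v_injective {i j : ZMod d} (h : G.v i = G.v j) : i = j := G.outer_distinct i j h

theorem tail_outer (i : ZMod d) : G.tail (G.outer i) = G.v i := rfl

theorem tail_rev_outer (i : ZMod d) : G.tail (G.rev (G.outer i)) = G.v (i + 1) := by
  rw [v, ← G.outer_next, G.tail_cw]

theorem cw_eq_outer_iff {a : D} {i : ZMod d} :
    G.cw a = G.outer i ↔ a = G.rev (G.outer (i - 1)) := by
  have h := G.outer_next (i - 1)
  rw [sub_add_cancel] at h
  rw [← h, G.cw.injective.eq_iff]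

theorem not_isInnerArc_iff {a : D} :
    ¬ G.IsInnerArc a ↔ ∃ i, a = G.outer i ∨ a = G.rev (G.outer i) := by
  simp only [IsInnerArc, not_forall, not_and_or, not_not]

variable {G} in
theorem IsInnerArc.rev {a : D} (h : G.IsInnerArc a) : G.IsInnerArc (G.rev a) := fun i =>
  ⟨fun h' => (h i).2 (by rw [← h', G.rev_rev]), fun h' => (h i).1 (G.rev_injective h')⟩

variable {G} in
theorem IsInnerArc.cw_ne {a : D} (h : G.IsInnerArc a) (i : ZMod d) : G.cw a ≠ G.outer i :=
  fun h' => (h _).2 (G.cw_eq_outer_iff.1 h')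

theorem isInnerArc_of_isInnerVertex {a : D} (h : G.IsInnerVertex (G.tail a)) :
    G.IsInnerArc a := fun i =>
  ⟨fun h' => h i (by rw [h', tail_outer]), fun h' => h (i + 1) (by rw [h', tail_rev_outer])⟩

theorem not_isInnerVertex_iff {x : G.Vertex} : ¬ G.IsInnerVertex x ↔ ∃ i, x = G.v i := by
  simp only [IsInnerVertex, not_forall, not_not]

theorem eq_of_outer_of_tail {a : D} {k : ZMod d} (h : G.tail a = G.v k) (ha : ¬ G.IsInnerArc a) :
    a = G.outer k ∨ a = G.rev (G.outer (k - 1)) := by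
  obtain ⟨i, rfl | rfl⟩ := G.not_isInnerArc_iff.1 ha
  · left; rw [G.v_injective (h.symm.trans (G.tail_outer i))]
  · right; rw [G.v_injective (h.symm.trans (G.tail_rev_outer i)), add_sub_cancel_right]

/-- The outer face. -/
def outerFace : G.Face := G.leftFace (G.outer 0)

theorem leftFace_outer (i : ZMod d) [NeZero d] : G.leftFace (G.outer i) = G.outerFace := by
  have step : ∀ i, G.leftFace (G.outer (i + 1)) = G.leftFace (G.outer i) := fun i => by
    rw [← G.outer_next, G.leftFace_cw, RotationSystem.rightFace, G.rev_rev]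
  rw [← ZMod.natCast_zmod_val i]
  induction i.val with
  | zero => simp [outerFace]
  | succ n ih => push_cast; rw [step, ih]

theorem isInnerFace_iff [Finite D] [NeZero d] {f : G.Face} :
    G.IsInnerFace f ↔ f ≠ G.outerFace := by
  constructor
  · rintro ⟨c, rfl⟩ h
    obtain ⟨k, -, hk⟩ := (G.leftFace_eq_iff.1 h.symm).exists_pow_eq'
    have key : ∀ k : ℕ, ¬ ∀ i, (G.faceCw ^ k) (G.outer 0) ≠ G.outer i := by
      intro k
      induction k with
      | zero => exact fun h => h 0 rfl
      | succ k ih =>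
        rw [pow_succ', Equiv.Perm.mul_apply, G.faceCw_inner]
        exact ih
    exact key k (by rw [hk]; exact c.2)
  · intro h
    obtain ⟨a, rfl⟩ : ∃ a, G.leftFace a = f := Quotient.exists_rep f
    exact ⟨⟨a, fun i hi => h (by rw [hi, leftFace_outer])⟩, rfl⟩

theorem isInnerFace_leftFace {a : D} (h : ∀ i, a ≠ G.outer i) : G.IsInnerFace (G.leftFace a) :=
  ⟨⟨a, h⟩, rfl⟩

theorem ne_outer_of_isInnerFace [Finite D] [NeZero d] {a : D}
    (h : G.IsInnerFace (G.leftFace a)) (i : ZMod d) : a ≠ G.outer i := fun hi =>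
  G.isInnerFace_iff.1 h (by rw [hi, leftFace_outer])

theorem fdeg_leftFace_le {a : D} (h : ∀ i, a ≠ G.outer i) : G.fdeg (G.leftFace a) ≤ d :=
  G.fdeg_le a h

/-- Every inner corner either belongs to an inner arc, or precedes an outer corner. -/
theorem isInnerArc_or {a : D} (h : ∀ i, a ≠ G.outer i) :
    G.IsInnerArc a ∨ ∃ i, a = G.rev (G.outer i) := by
  by_cases ha : G.IsInnerArc a
  · exact Or.inl ha
  · obtain ⟨i, hi | hi⟩ := G.not_isInnerArc_iff.1 ha
    · exact absurd hi (h i)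
    · exact Or.inr ⟨i, hi⟩

section Distinct

variable (hd : 3 ≤ d)
include hd

theorem rev_outer_ne_outer (i j : ZMod d) : G.rev (G.outer i) ≠ G.outer j := by
  intro h
  have h1 : i + 1 = j := G.v_injective (by rw [← tail_rev_outer, h, tail_outer])
  subst h1
  have h2 : i = i + 1 + 1 := G.v_injective (by
    rw [← tail_rev_outer, ← h, G.rev_rev, tail_outer])
  have h3 : ((2 : ℕ) : ZMod d) = 0 := by
    push_cast
    linear_combination -h2
  rw [ZMod.natCast_eq_zero_iff] at h3
  have := Nat.le_of_dvd (by norm_num) h3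
  omega

theorem cw_outer_ne_outer (i j : ZMod d) : G.cw (G.outer i) ≠ G.outer j := fun h =>
  G.rev_outer_ne_outer hd (j - 1) i (G.cw_eq_outer_iff.1 h).symm

end Distinct

/-- The inner corner on the left of an arc. -/
def innerCorner {a : D} (h : ∀ i, a ≠ G.outer i) : G.InnerCorner := ⟨a, h⟩

section Sums

variable [Fintype D] {M : Type*} [AddCommMonoid M]

theorem sum_innerCorner (p : D → Prop) (hp : ∀ a, p a → ∀ i, a ≠ G.outer i) (g : D → M) :
    ∑ c : G.InnerCorner with p c.1, g c.1 = ∑ a : D with p a, g a := by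
  refine Finset.sum_bij (fun c _ => c.1) ?_ ?_ ?_ ?_
  · intro c hc
    exact Finset.mem_filter.2 ⟨Finset.mem_univ _, (Finset.mem_filter.1 hc).2⟩
  · intro c _ c' _ h
    exact Subtype.ext h
  · intro a ha
    have ha := (Finset.mem_filter.1 ha).2
    exact ⟨G.innerCorner (hp a ha), Finset.mem_filter.2 ⟨Finset.mem_univ _, ha⟩, rfl⟩
  · intros; rfl

theorem sum_innerCorner_tail {x : G.Vertex} (hx : G.IsInnerVertex x) (g : D → M) :
    ∑ c : G.InnerCorner with G.tail c.1 = x, g c.1 = ∑ a : D with G.tail a = x, g a :=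
  G.sum_innerCorner (fun a => G.tail a = x) (fun a ha i =>
    (G.isInnerArc_of_isInnerVertex (show G.IsInnerVertex (G.tail a) by rwa [ha]) i).1) g

theorem sum_innerCorner_leftFace [NeZero d] {f : G.Face} (hf : G.IsInnerFace f) (g : D → M) :
    ∑ c : G.InnerCorner with G.leftFace c.1 = f, g c.1 = ∑ a : D with G.leftFace a = f, g a :=
  G.sum_innerCorner (fun a => G.leftFace a = f) (fun a ha i =>
    G.ne_outer_of_isInnerFace (show G.IsInnerFace (G.leftFace a) by rwa [ha]) i) g

theorem fdeg_eq_sum (f : G.Face) : G.fdeg f = ∑ a : D with G.leftFace a = f, 1 := by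
  rw [RotationSystem.fdeg, Nat.card_eq_fintype_card, Fintype.card_subtype, Finset.sum_const,
    smul_eq_mul, mul_one]

/-- Around the outer vertex `v k`: the two outer arcs, and arcs that are all inner. -/
theorem sum_tail_v (hd : 3 ≤ d) (k : ZMod d) (g : D → M)
    (hg : ∀ a, G.IsInnerArc a → G.tail a = G.v k → g a = 0) :
    ∑ a : D with G.tail a = G.v k, g a = g (G.outer k) + g (G.rev (G.outer (k - 1))) := by
  rw [← Finset.sum_pair (G.rev_outer_ne_outer hd (k - 1) k).symm]
  symm
  refine Finset.sum_subset ?_ ?_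
  · intro a ha
    rw [Finset.mem_filter]
    rcases Finset.mem_insert.1 ha with rfl | ha
    · exact ⟨Finset.mem_univ _, rfl⟩
    · rw [Finset.mem_singleton.1 ha, tail_rev_outer, sub_add_cancel]
      exact ⟨Finset.mem_univ _, rfl⟩
  · intro a ha hn
    have ha := (Finset.mem_filter.1 ha).2
    refine hg a ?_ ha
    by_contra hcon
    rcases G.eq_of_outer_of_tail ha hcon with h | h <;> simp [h] at hn

end Sums

/-! ### Labels of all corners -/

/-- Extension of a labeling to the outer corners: the outer corner at `v i` gets the label
`i + 1`.  With this choice the jumps add up to `d` around the outer vertices too, and the outer arc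
from `v i` to `v (i - 1)` receives precisely the color `i`. -/
def extend (L : G.Labeling) (a : D) : ZMod d :=
  if h : ∀ i, a ≠ G.outer i then L (G.innerCorner h) else (not_forall.1 h).choose + 1

theorem extend_inner (L : G.Labeling) {a : D} (h : ∀ i, a ≠ G.outer i) :
    G.extend L a = L (G.innerCorner h) := dif_pos h

theorem extend_corner (L : G.Labeling) (c : G.InnerCorner) : G.extend L c.1 = L c :=
  G.extend_inner L c.2

theorem extend_outer (L : G.Labeling) (i : ZMod d) : G.extend L (G.outer i) = i + 1 := by
  have h : ¬ ∀ j, G.outer i ≠ G.outer j := fun h => h i rfl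
  rw [extend, dif_neg h]
  have := (not_forall.1 h).choose_spec
  rw [← G.outer_injective (not_not.1 this)]

theorem extend_injective : Function.Injective G.extend := fun L L' h =>
  funext fun c => by
  rw [← G.extend_corner L, h, G.extend_corner L']

theorem exists_extend {lam : D → ZMod d} (h : ∀ i, lam (G.outer i) = i + 1) :
    ∃ L, G.extend L = lam := by
  refine ⟨fun c => lam c.1, funext fun a => ?_⟩
  by_cases ha : ∀ i, a ≠ G.outer i
  · rw [extend_inner _ _ ha]
    rfl
  · simp only [not_forall, not_not] at ha
    obtain ⟨i, rfl⟩ := ha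
    rw [extend_outer, h]

theorem nextInFace_symm_val (c : G.InnerCorner) :
    (G.nextInFace.symm c).1 = G.cw (G.rev c.1) := by
  rw [← G.faceCw_symm_apply]
  rfl

theorem nextAtVertex_val {a : D} (h : G.IsInnerArc a) :
    (G.nextAtVertex h.corner).1 = G.cw a := by
  have h' : ∀ i, G.cw h.corner.1 ≠ G.outer i := h.cw_ne
  exact congrArg Subtype.val (dif_pos h' : G.nextAtVertex h.corner = ⟨G.cw h.corner.1, h'⟩)

theorem jump_nextInFace_symm (L : G.Labeling) (c : G.InnerCorner) :
    L.jump (G.nextInFace.symm c) c = G.fjump (G.extend L) c.1 := by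
  rw [Labeling.jump, RotationSystem.fjump, extend_corner, ← nextInFace_symm_val, extend_corner]

theorem jump_nextAtVertex (L : G.Labeling) {a : D} (h : G.IsInnerArc a) :
    L.jump h.corner (G.nextAtVertex h.corner) = G.vjump (G.extend L) a := by
  rw [Labeling.jump, RotationSystem.vjump, ← nextAtVertex_val G h, extend_corner]
  exact congrArg (fun z => (L (G.nextAtVertex h.corner) - z).val) (G.extend_corner L h.corner).symm

/-- Grand-Schnyder labelings, in terms of the labels of all the corners, those of the outer face
included. -/
structure IsFullLabeling [Fintype D] (lam : D → ZMod d) : Prop where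
  outer : ∀ i, lam (G.outer i) = i + 1
  at_outer : ∀ i a, (∀ j, a ≠ G.outer j) → G.tail a = G.v i → lam a = i
  sum_vertex : ∀ x, ∑ a : D with G.tail a = x, G.vjump lam a = d
  sum_face : ∀ f, G.IsInnerFace f → ∑ a : D with G.leftFace a = f, G.fjump lam a = d
  fjump_pos : ∀ a, (∀ j, a ≠ G.outer j) → 0 < G.fjump lam a
  edge : ∀ a, G.IsInnerArc a →
    d < G.fjump lam a + G.vjump lam a + G.fdeg (G.leftFace a)

section Outer

variable {G} {N : ℕ} {lam : D → ZMod N} {out : ZMod d → ZMod N} (hd : 3 ≤ d) (hN : 2 ≤ N)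
  (ho : ∀ i, lam (G.outer i) = out i + 1)
  (ha : ∀ i a, (∀ j, a ≠ G.outer j) → G.tail a = G.v i → lam a = out i)

include ha in
theorem vjump_at_outer {a : D} (h : G.IsInnerArc a) {i : ZMod d} (ht : G.tail a = G.v i) :
    G.vjump lam a = 0 := by
  rw [RotationSystem.vjump, ha i _ h.cw_ne (by rw [G.tail_cw, ht]),
    ha i _ (fun j => (h j).1) ht, sub_self, ZMod.val_zero]

include hd hN ho ha

theorem vjump_outer (i : ZMod d) : G.vjump lam (G.outer i) = N - 1 := by
  rw [RotationSystem.vjump, ho, ha i _ (G.cw_outer_ne_outer hd i) (by rw [G.tail_cw, tail_outer])]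
  have h : out i - (out i + 1) = ((N - 1 : ℕ) : ZMod N) := by
    rw [Nat.cast_sub (by omega), ZMod.natCast_self]
    push_cast
    ring
  rw [h, ZMod.val_cast_of_lt (by omega)]

theorem vjump_rev_outer (i : ZMod d) : G.vjump lam (G.rev (G.outer i)) = 1 := by
  rw [RotationSystem.vjump, G.outer_next, ho,
    ha (i + 1) _ (G.rev_outer_ne_outer hd i) (G.tail_rev_outer i)]
  have h : out (i + 1) + 1 - out (i + 1) = ((1 : ℕ) : ZMod N) := by push_cast; ring
  rw [h, ZMod.val_cast_of_lt (by omega)]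

theorem sum_vjump_v [Fintype D] (k : ZMod d) :
    ∑ a : D with G.tail a = G.v k, G.vjump lam a = N := by
  rw [G.sum_tail_v hd k _ (fun a h ht => vjump_at_outer ha h ht), vjump_outer hd hN ho ha,
    vjump_rev_outer hd hN ho ha]
  omega

end Outer

variable {G} in
theorem fjump_rev_outer {lam : D → ZMod d} (hd : 3 ≤ d)
    (ha : ∀ i a, (∀ j, a ≠ G.outer j) → G.tail a = G.v i → lam a = i) (i : ZMod d) :
    G.fjump lam (G.rev (G.outer i)) = 1 := by
  rw [RotationSystem.fjump, ha (i + 1) _ (G.rev_outer_ne_outer hd i) (G.tail_rev_outer i),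
    G.rev_rev, ha i _ (G.cw_outer_ne_outer hd i) (by rw [G.tail_cw, tail_outer])]
  have h : i + 1 - i = ((1 : ℕ) : ZMod d) := by push_cast; ring
  rw [h, ZMod.val_cast_of_lt (by omega)]

theorem isGSLabeling_iff [Fintype D] [NeZero d] (hd : 3 ≤ d) (L : G.Labeling) :
    G.IsGSLabeling L ↔ G.IsFullLabeling (G.extend L) := by
  have hvert {x : G.Vertex} (hx : G.IsInnerVertex x) :
      ∑ c : G.InnerCorner with G.tail c.1 = x, L.jump c (G.nextAtVertex c)
        = ∑ a : D with G.tail a = x, G.vjump (G.extend L) a := by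
    rw [← G.sum_innerCorner_tail hx]
    refine Finset.sum_congr rfl fun c hc => ?_
    have h : G.IsInnerArc c.1 :=
      G.isInnerArc_of_isInnerVertex ((Finset.mem_filter.1 hc).2 ▸ hx)
    exact G.jump_nextAtVertex L h
  have hjump (c : G.InnerCorner) :
      L.jump c (G.nextInFace c) = G.fjump (G.extend L) (G.nextInFace c).1 := by
    rw [← jump_nextInFace_symm, Equiv.symm_apply_apply]
  have hface {f : G.Face} (hf : G.IsInnerFace f) :
      ∑ c : G.InnerCorner with G.leftFace c.1 = f, L.jump c (G.nextInFace c)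
        = ∑ a : D with G.leftFace a = f, G.fjump (G.extend L) a := by
    rw [← G.sum_innerCorner_leftFace hf]
    refine Finset.sum_equiv G.nextInFace (fun c => ?_) (fun c _ => hjump c)
    have : G.leftFace (G.nextInFace c).1 = G.leftFace c.1 := G.leftFace_faceCw c.1
    simp [this]
  constructor
  · intro h
    have ha : ∀ i a, (∀ j, a ≠ G.outer j) → G.tail a = G.v i → G.extend L a = i :=
      fun i a hin ht => by
        rw [G.extend_inner L hin]
        exact h.outer_label i (G.innerCorner hin) ht
    refine ⟨G.extend_outer L, ha, fun x => ?_, fun f hf => ?_, fun a hin => ?_, fun a hin => ?_⟩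
    · by_cases hx : G.IsInnerVertex x
      · rw [← hvert hx]
        exact h.sum_vertex x hx
      · obtain ⟨k, rfl⟩ := G.not_isInnerVertex_iff.1 hx
        exact sum_vjump_v hd (by omega) (G.extend_outer L) ha k
    · rw [← hface hf]
      exact h.sum_face f hf
    · have := h.jump_pos (G.nextInFace.symm (G.innerCorner hin))
      rw [hjump, Equiv.apply_symm_apply] at this
      exact this
    · have := h.edge_jump a hin
      rw [jump_nextInFace_symm, jump_nextAtVertex] at this
      have h2 : G.fjump (G.extend L) hin.corner.1 = G.fjump (G.extend L) a := rfl
      omega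
  · intro h
    refine ⟨fun i c ht => ?_, fun x hx => ?_, fun f hf => ?_, fun c => ?_, fun a hin => ?_⟩
    · rw [← G.extend_corner L]
      exact h.at_outer i c.1 c.2 ht
    · rw [hvert hx]
      exact h.sum_vertex x
    · rw [hface hf]
      exact h.sum_face f hf
    · rw [hjump]
      exact h.fjump_pos _ (G.nextInFace c).2
    · rw [jump_nextInFace_symm, jump_nextAtVertex]
      have := h.edge a hin
      have h2 : G.fjump (G.extend L) hin.corner.1 = G.fjump (G.extend L) a := rfl
      omega

end DMap

namespace DMap

variable {d : ℕ} {D : Type*} (G : DMap d D)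

/-! ### Consequences of the Euler relation -/

/-- The face jumps as integers, that of an outer corner being counted as `-1`. -/
def fjumpInt (lam : D → ZMod d) (a : D) : ℤ :=
  if ∀ i, a ≠ G.outer i then G.fjump lam a else -1

theorem fjumpInt_outer (lam : D → ZMod d) (i : ZMod d) : G.fjumpInt lam (G.outer i) = -1 :=
  if_neg fun h => h i rfl

theorem fjumpInt_inner (lam : D → ZMod d) {a : D} (h : ∀ i, a ≠ G.outer i) :
    G.fjumpInt lam a = G.fjump lam a := if_pos h

/-- The four jumps around an edge add up to a multiple of `d`. -/
theorem dvd_edge_sum [NeZero d] (lam : D → ZMod d) (a : D) :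
    d ∣ G.fjump lam a + G.vjump lam a + G.fjump lam (G.rev a) + G.vjump lam (G.rev a) := by
  rw [← ZMod.natCast_eq_zero_iff]
  push_cast
  have h1 := G.lam_fjump lam a
  have h2 := G.lam_cw lam a
  have h3 := G.lam_fjump lam (G.rev a)
  have h4 := G.lam_cw lam (G.rev a)
  rw [G.rev_rev] at h3
  linear_combination -h1 - h2 - h3 - h4

section Euler

variable [Fintype D] [NeZero d]

theorem sum_outerFace (g : D → ℤ) (hg : ∀ i, g (G.outer i) = -1) :
    ∑ a : D with G.leftFace a = G.outerFace, g a = -d := by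
  have h : ∑ i : ZMod d, g (G.outer i) = ∑ a : D with G.leftFace a = G.outerFace, g a := by
    refine Finset.sum_bij (fun i _ => G.outer i) ?_ ?_ ?_ ?_
    · intro i _
      simp [leftFace_outer]
    · intro i _ j _ hij
      exact G.outer_injective hij
    · intro a ha
      by_contra hcon
      have hin : ∀ i, a ≠ G.outer i := fun i hi => hcon ⟨i, Finset.mem_univ _, hi.symm⟩
      exact G.isInnerFace_iff.1 (G.isInnerFace_leftFace hin) (Finset.mem_filter.1 ha).2
    · intros; rfl
  rw [← h, Finset.sum_congr rfl fun i _ => hg i]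
  simp

/-- The Euler relation for jumps with the expected totals around the vertices.  The term `4 d` of
the general relation is the defect of the outer face, where the jumps add up to `-d`. -/
theorem sum_edge_defect (φ ε : D → ℤ) (hφ : ∀ i, φ (G.outer i) = -1)
    (hε : ∀ x, ∑ a : D with G.tail a = x, ε a = d) :
    ∑ a : D, (φ a + ε a + φ (G.rev a) + ε (G.rev a) - d)
      = 2 * ∑ f : G.Face with G.IsInnerFace f, (∑ a : D with G.leftFace a = f, φ a - d) := by
  rw [G.sum_balance G.euler]
  have h1 : ∑ x : G.Vertex, (∑ a : D with G.tail a = x, ε a - (d : ℤ)) = 0 :=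
    Finset.sum_eq_zero fun x _ => by rw [hε, sub_self]
  have h2 : (Finset.univ.filter fun f : G.Face => G.IsInnerFace f)
      = Finset.univ.erase G.outerFace := by
    ext f
    simp [isInnerFace_iff]
  rw [h1, h2, ← Finset.add_sum_erase _ _ (Finset.mem_univ G.outerFace), G.sum_outerFace φ hφ]
  ring

/-- Totals at least `d` around the edges are equal to `d`, when they are so around the vertices and
the inner faces. -/
theorem edge_eq_of_le {φ ε : D → ℤ} (hφ : ∀ i, φ (G.outer i) = -1)
    (hε : ∀ x, ∑ a : D with G.tail a = x, ε a = d)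
    (hf : ∀ f, G.IsInnerFace f → ∑ a : D with G.leftFace a = f, φ a = d)
    (he : ∀ a, d ≤ φ a + ε a + φ (G.rev a) + ε (G.rev a)) (a : D) :
    φ a + ε a + φ (G.rev a) + ε (G.rev a) = d := by
  have h := G.sum_edge_defect φ ε hφ hε
  rw [Finset.sum_eq_zero (s := Finset.univ.filter fun f : G.Face => G.IsInnerFace f)
    (fun f hin => by rw [hf f (Finset.mem_filter.1 hin).2, sub_self]), mul_zero,
    Finset.sum_eq_zero_iff_of_nonneg (fun a _ => sub_nonneg.2 (he a))] at h
  exact sub_eq_zero.1 (h a (Finset.mem_univ a))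

/-- Totals at least `d` around the inner faces are equal to `d`, when they are so around the vertices
and the edges. -/
theorem face_eq_of_le {φ ε : D → ℤ} (hφ : ∀ i, φ (G.outer i) = -1)
    (hε : ∀ x, ∑ a : D with G.tail a = x, ε a = d)
    (hf : ∀ f, G.IsInnerFace f → d ≤ ∑ a : D with G.leftFace a = f, φ a)
    (he : ∀ a, φ a + ε a + φ (G.rev a) + ε (G.rev a) = d) {f : G.Face} (hin : G.IsInnerFace f) :
    ∑ a : D with G.leftFace a = f, φ a = d := by
  have h := G.sum_edge_defect φ ε hφ hε
  rw [Finset.sum_eq_zero (fun a _ => by rw [he, sub_self])] at h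
  have h' := (mul_eq_zero.1 h.symm).resolve_left two_ne_zero
  rw [Finset.sum_eq_zero_iff_of_nonneg
    (fun f hf' => sub_nonneg.2 (hf f (Finset.mem_filter.1 hf').2))] at h'
  exact sub_eq_zero.1 (h' f (by simp [hin]))

theorem sum_fjumpInt (lam : D → ZMod d) {f : G.Face} (hf : G.IsInnerFace f) :
    ∑ a : D with G.leftFace a = f, G.fjumpInt lam a
      = (∑ a : D with G.leftFace a = f, G.fjump lam a : ℕ) := by
  rw [Nat.cast_sum]
  refine Finset.sum_congr rfl fun a ha => G.fjumpInt_inner lam fun i => ?_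
  exact G.ne_outer_of_isInnerFace (show G.IsInnerFace (G.leftFace a) by
    rwa [(Finset.mem_filter.1 ha).2]) i

omit [Fintype D] [NeZero d] in
theorem fjumpInt_edge_outer {lam : D → ZMod d} (hd : 3 ≤ d)
    (ho : ∀ i, lam (G.outer i) = i + 1)
    (ha : ∀ i a, (∀ j, a ≠ G.outer j) → G.tail a = G.v i → lam a = i) {a : D}
    (hin : ¬ G.IsInnerArc a) :
    G.fjumpInt lam a + G.vjump lam a + G.fjumpInt lam (G.rev a) + G.vjump lam (G.rev a) = d := by
  obtain ⟨i, rfl | rfl⟩ := G.not_isInnerArc_iff.1 hin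
  · rw [fjumpInt_outer, G.fjumpInt_inner _ (G.rev_outer_ne_outer hd i), fjump_rev_outer hd ha,
      vjump_rev_outer hd (by omega) ho ha, vjump_outer hd (by omega) ho ha]
    omega
  · rw [G.rev_rev, fjumpInt_outer, G.fjumpInt_inner _ (G.rev_outer_ne_outer hd i),
      fjump_rev_outer hd ha, vjump_rev_outer hd (by omega) ho ha, vjump_outer hd (by omega) ho ha]
    omega

variable {G} in
/-- The four jumps around an inner edge of a labeling add up to `d`, and not to a larger multiple. -/
theorem IsFullLabeling.edge_sum {lam : D → ZMod d} (hd : 3 ≤ d) (h : G.IsFullLabeling lam) {a : D}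
    (hin : G.IsInnerArc a) :
    G.fjump lam a + G.vjump lam a + G.fjump lam (G.rev a) + G.vjump lam (G.rev a) = d := by
  have key := G.edge_eq_of_le (φ := G.fjumpInt lam) (ε := fun a => G.vjump lam a)
    (G.fjumpInt_outer lam) (fun x => by exact_mod_cast h.sum_vertex x)
    (fun f hf => by rw [G.sum_fjumpInt lam hf, h.sum_face f hf]) (fun a => ?_) a
  · rw [G.fjumpInt_inner lam fun i => (hin i).1, G.fjumpInt_inner lam fun i => (hin.rev i).1] at key
    exact_mod_cast key
  · by_cases ha : G.IsInnerArc a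
    · rw [G.fjumpInt_inner lam fun i => (ha i).1, G.fjumpInt_inner lam fun i => (ha.rev i).1]
      have h1 := h.fjump_pos a fun i => (ha i).1
      exact_mod_cast Nat.le_of_dvd (by omega) (G.dvd_edge_sum lam a)
    · exact (G.fjumpInt_edge_outer hd h.outer h.at_outer ha).ge

end Euler

/-! ### Labelings and marked orientations -/

/-- The number of marks of the corner of an arc, counted as `0` for the outer corners. -/
def MarkedOrientation.marksAt {G : DMap d D} (M : G.MarkedOrientation) (a : D) : ℕ :=
  if h : ∀ i, a ≠ G.outer i then M.marks (G.innerCorner h) else 0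

theorem MarkedOrientation.marksAt_inner {G : DMap d D} (M : G.MarkedOrientation) {a : D}
    (h : ∀ i, a ≠ G.outer i) : M.marksAt a = M.marks (G.innerCorner h) := dif_pos h

theorem MarkedOrientation.marksAt_val {G : DMap d D} (M : G.MarkedOrientation)
    (c : G.InnerCorner) : M.marksAt c.1 = M.marks c := dif_pos c.2

theorem MarkedOrientation.ext' {G : DMap d D} {M M' : G.MarkedOrientation}
    (h1 : ∀ a, M.weight a = M'.weight a) (h2 : ∀ c, M.marks c = M'.marks c) : M = M' := by
  cases M
  cases M'
  congr 1
  · exact funext h1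
  · exact funext h2

theorem Phi_marks (L : G.Labeling) (c : G.InnerCorner) :
    (G.Phi L).marks c = G.fjump (G.extend L) c.1 - 1 := by
  rw [← jump_nextInFace_symm]
  rfl

theorem Phi_weight (L : G.Labeling) {a : D} (h : G.IsInnerArc a) :
    (G.Phi L).weight a = G.fjump (G.extend L) a + G.vjump (G.extend L) a - 1 := by
  rw [Phi]
  simp only [dif_pos h, jump_nextInFace_symm, jump_nextAtVertex]
  rfl

theorem Phi_weight_outer (L : G.Labeling) {a : D} (h : ¬ G.IsInnerArc a) :
    (G.Phi L).weight a = 0 := by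
  rw [Phi]
  simp only [dif_neg h]

section

variable {G} [Fintype D] [NeZero d]

theorem IsFullLabeling.sum_face_sub_one {lam : D → ZMod d} (h : G.IsFullLabeling lam) {f : G.Face}
    (hf : G.IsInnerFace f) :
    ∑ a : D with G.leftFace a = f, (G.fjump lam a - 1) + G.fdeg f = d := by
  rw [fdeg_eq_sum, ← Finset.sum_add_distrib]
  refine Eq.trans ?_ (h.sum_face f hf)
  refine Finset.sum_congr rfl fun a ha => ?_
  have := h.fjump_pos a (G.ne_outer_of_isInnerFace (show G.IsInnerFace (G.leftFace a) by
    rwa [(Finset.mem_filter.1 ha).2]))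
  omega

/-- The other jumps around the face are at least `1`. -/
theorem IsFullLabeling.fjump_add_fdeg_le {lam : D → ZMod d} (h : G.IsFullLabeling lam) {a : D}
    (hin : ∀ i, a ≠ G.outer i) : G.fjump lam a + G.fdeg (G.leftFace a) ≤ d + 1 := by
  have h1 := h.sum_face_sub_one (G.isInnerFace_leftFace hin)
  have h2 := Finset.single_le_sum (f := fun y => G.fjump lam y - 1)
    (s := Finset.univ.filter fun y => G.leftFace y = G.leftFace a) (fun _ _ => Nat.zero_le _)
    (show a ∈ _ by simp)
  omega

theorem IsFullLabeling.isGSMarked_Phi (hd : 3 ≤ d) {L : G.Labeling}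
    (h : G.IsFullLabeling (G.extend L)) : G.IsGSMarked (G.Phi L) := by
  refine ⟨fun a => G.Phi_weight_outer L, fun a hin ht => ?_, fun f hf => ?_, fun a hin => ?_,
    fun x hx => ?_, fun a hin => ?_⟩
  · obtain ⟨k, hk⟩ := G.not_isInnerVertex_iff.1 ht
    have h0 := vjump_at_outer h.at_outer hin hk
    rw [G.Phi_weight L hin, Phi_marks, h0]
    have h1 := h.edge a hin
    have h2 := h.fjump_add_fdeg_le fun i => (hin i).1
    have h3 : G.fjump (G.extend L) hin.corner.1 = G.fjump (G.extend L) a := rfl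
    omega
  · have h1 := h.sum_face_sub_one hf
    rw [Finset.sum_congr rfl fun c _ => G.Phi_marks L c,
      G.sum_innerCorner_leftFace hf fun a => G.fjump (G.extend L) a - 1]
    omega
  · rw [G.Phi_weight L hin, G.Phi_weight L hin.rev]
    have h1 := h.edge_sum hd hin
    have h2 := h.fjump_pos a fun i => (hin i).1
    have h3 := h.fjump_pos _ fun i => (hin.rev i).1
    omega
  · rw [Finset.sum_congr rfl fun c _ => G.Phi_marks L c,
      G.sum_innerCorner_tail hx fun a => G.fjump (G.extend L) a - 1]
    refine Eq.trans ?_ (congrArg (· + _) (h.sum_vertex x))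
    rw [← Finset.sum_add_distrib]
    refine Finset.sum_congr rfl fun a ha => ?_
    have hin : G.IsInnerArc a := G.isInnerArc_of_isInnerVertex (by
      rwa [(Finset.mem_filter.1 ha).2])
    rw [G.Phi_weight L hin]
    have h2 := h.fjump_pos a fun i => (hin i).1
    omega
  · rw [G.Phi_weight L hin]
    have h1 := h.edge a hin
    omega

/-- The map is connected, and the labels are normalized at the outer vertices. -/
theorem IsFullLabeling.eq_of_jumps {lam mu : D → ZMod d} (h : G.IsFullLabeling lam)
    (h' : G.IsFullLabeling mu)
    (hf : ∀ a, (∀ i, a ≠ G.outer i) → G.fjump lam a = G.fjump mu a)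
    (hv : ∀ a, G.IsInnerArc a → G.vjump lam a = G.vjump mu a) : lam = mu := by
  have hout : ∀ i, lam (G.outer i) = mu (G.outer i) := fun i => by rw [h.outer, h'.outer]
  have hat : ∀ i a, G.tail a = G.v i → lam a = mu a := fun i a ht => by
    by_cases ha : ∀ j, a ≠ G.outer j
    · rw [h.at_outer i a ha ht, h'.at_outer i a ha ht]
    · simp only [not_forall, not_not] at ha
      obtain ⟨j, rfl⟩ := ha
      exact hout j
  have htail : ∀ a, ¬ G.IsInnerArc a → ∃ i, G.tail a = G.v i := fun a ha => by
    obtain ⟨i, rfl | rfl⟩ := G.not_isInnerArc_iff.1 ha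
    · exact ⟨i, rfl⟩
    · exact ⟨i + 1, G.tail_rev_outer i⟩
  have hcw : ∀ a, lam (G.cw a) = mu (G.cw a) ↔ lam a = mu a := fun a => by
    by_cases ha : G.IsInnerArc a
    · rw [G.lam_cw lam a, G.lam_cw mu a, hv a ha, add_left_inj]
    · obtain ⟨i, hi⟩ := htail a ha
      exact iff_of_true (hat i _ (by rw [G.tail_cw, hi])) (hat i a hi)
  refine funext fun a => G.forall_of_connected G.connected (P := fun a => lam a = mu a) hcw
    (fun a => ?_) (hout 0) a
  by_cases ha : G.IsInnerArc a
  · rw [G.lam_fjump lam a, G.lam_fjump mu a, hf a fun i => (ha i).1, add_left_inj, hcw]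
  · obtain ⟨i, hi⟩ := htail a ha
    obtain ⟨j, hj⟩ := htail (G.rev a) fun h => ha (by simpa [G.rev_rev] using h.rev)
    exact iff_of_true (hat j _ hj) (hat i a hi)

theorem IsFullLabeling.eq_of_Phi_eq {L L' : G.Labeling}
    (h : G.IsFullLabeling (G.extend L)) (h' : G.IsFullLabeling (G.extend L'))
    (heq : G.Phi L = G.Phi L') : L = L' := by
  have hf : ∀ a, (∀ i, a ≠ G.outer i) → G.fjump (G.extend L) a = G.fjump (G.extend L') a := by
    intro a ha
    have h1 := congrArg (fun M => M.marks (G.innerCorner ha)) heq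
    simp only [Phi_marks] at h1
    have h2 := h.fjump_pos a ha
    have h3 := h'.fjump_pos a ha
    have h4 : (G.innerCorner ha).1 = a := rfl
    rw [h4] at h1
    omega
  refine G.extend_injective (h.eq_of_jumps h' hf fun a ha => ?_)
  have h1 := congrArg (fun M => M.weight a) heq
  simp only [G.Phi_weight _ ha] at h1
  have h2 := hf a fun i => (ha i).1
  have h3 := h.fjump_pos a fun i => (ha i).1
  omega

end

end DMap

/-! ### Labelings from marked orientations -/

namespace DMap

variable {d : ℕ} {D : Type*} (G : DMap d D) [Fintype D]

section Converse

variable {G}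

theorem IsGSMarked.marks_le [NeZero d] {M : G.MarkedOrientation} (h : G.IsGSMarked M)
    (c : G.InnerCorner) : M.marks c ≤ d - G.fdeg (G.leftFace c.1) := by
  rw [← h.face_marks _ (G.isInnerFace_leftFace c.2)]
  exact Finset.single_le_sum (f := fun c => M.marks c)
    (s := Finset.univ.filter fun c' : G.InnerCorner => G.leftFace c'.1 = G.leftFace c.1)
    (fun _ _ => Nat.zero_le _) (by simp)

theorem IsGSMarked.marksAt_le_weight [NeZero d] {M : G.MarkedOrientation} (h : G.IsGSMarked M)
    {a : D} (ha : G.IsInnerArc a) : M.marksAt a ≤ M.weight a := by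
  rw [M.marksAt_inner fun i => (ha i).1]
  exact (h.marks_le _).trans (h.arc_weight a ha)

/-- The jumps across the arcs prescribed by a marked orientation.  Those across the outer arcs are the
ones of the labels `i + 1` of the outer corners. -/
def MarkedOrientation.vjump (M : G.MarkedOrientation) (a : D) : ℤ :=
  if G.IsInnerArc a then M.weight a - M.marksAt a else if ∃ i, a = G.outer i then d - 1 else 1

/-- The jumps along the arcs prescribed by a marked orientation; as in `fjumpInt`, that of an outer
corner is `-1`. -/
def MarkedOrientation.fjump (M : G.MarkedOrientation) (a : D) : ℤ :=
  if ∀ i, a ≠ G.outer i then M.marksAt a + 1 else -1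

omit [Fintype D] in
theorem MarkedOrientation.vjump_inner (M : G.MarkedOrientation) {a : D} (h : G.IsInnerArc a) :
    M.vjump a = M.weight a - M.marksAt a := if_pos h

omit [Fintype D] in
theorem MarkedOrientation.vjump_outer (M : G.MarkedOrientation) (i : ZMod d) :
    M.vjump (G.outer i) = d - 1 := by
  rw [MarkedOrientation.vjump, if_neg fun h => (h i).1 rfl, if_pos ⟨i, rfl⟩]

omit [Fintype D] in
theorem MarkedOrientation.vjump_rev_outer (hd : 3 ≤ d) (M : G.MarkedOrientation) (i : ZMod d) :
    M.vjump (G.rev (G.outer i)) = 1 := by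
  rw [MarkedOrientation.vjump, if_neg fun h => (h i).2 rfl,
    if_neg fun ⟨j, hj⟩ => G.rev_outer_ne_outer hd i j hj]

omit [Fintype D] in
theorem MarkedOrientation.fjump_outer (M : G.MarkedOrientation) (i : ZMod d) :
    M.fjump (G.outer i) = -1 := if_neg fun h => h i rfl

omit [Fintype D] in
theorem MarkedOrientation.fjump_inner (M : G.MarkedOrientation) {a : D}
    (h : ∀ i, a ≠ G.outer i) : M.fjump a = M.marksAt a + 1 := if_pos h

theorem IsGSMarked.sum_vjump (hd : 3 ≤ d) {M : G.MarkedOrientation} (h : G.IsGSMarked M)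
    (x : G.Vertex) : ∑ a : D with G.tail a = x, M.vjump a = d := by
  by_cases hx : G.IsInnerVertex x
  · have h1 := h.vertex_weight x hx
    rw [Finset.sum_congr rfl fun c _ => (M.marksAt_val c).symm,
      G.sum_innerCorner_tail hx M.marksAt] at h1
    have h2 : ∑ a : D with G.tail a = x, M.vjump a
        = ∑ a : D with G.tail a = x, ((M.weight a : ℤ) - M.marksAt a) := by
      refine Finset.sum_congr rfl fun a ha => M.vjump_inner ?_
      exact G.isInnerArc_of_isInnerVertex (by rwa [(Finset.mem_filter.1 ha).2])
    rw [h2, Finset.sum_sub_distrib, ← Nat.cast_sum, ← Nat.cast_sum]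
    omega
  · obtain ⟨k, rfl⟩ := G.not_isInnerVertex_iff.1 hx
    rw [G.sum_tail_v hd, M.vjump_outer, M.vjump_rev_outer hd]
    · ring
    · intro a ha ht
      obtain ⟨h1, h2⟩ := h.at_outer a ha (by rw [ht]; exact hx)
      rw [M.vjump_inner ha, M.marksAt_inner fun i => (ha i).1, h1]
      have : M.marks (G.innerCorner fun i => (ha i).1) = d - G.fdeg (G.leftFace a) := h2
      rw [this, sub_self]

theorem IsGSMarked.sum_fjump [NeZero d] {M : G.MarkedOrientation} (h : G.IsGSMarked M)
    {f : G.Face} (hf : G.IsInnerFace f) : ∑ a : D with G.leftFace a = f, M.fjump a = d := by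
  have h1 := h.face_marks f hf
  rw [Finset.sum_congr rfl fun c _ => (M.marksAt_val c).symm,
    G.sum_innerCorner_leftFace hf M.marksAt] at h1
  have h2 : ∑ a : D with G.leftFace a = f, M.fjump a
      = ∑ a : D with G.leftFace a = f, ((M.marksAt a : ℤ) + (1 : ℕ)) := by
    refine Finset.sum_congr rfl fun a ha => M.fjump_inner ?_
    exact G.ne_outer_of_isInnerFace (show G.IsInnerFace (G.leftFace a) by
      rwa [(Finset.mem_filter.1 ha).2])
  have h3 : G.fdeg f ≤ d := by
    obtain ⟨c, rfl⟩ := hf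
    exact G.fdeg_leftFace_le c.2
  rw [h2, Finset.sum_add_distrib, ← Nat.cast_sum, ← Nat.cast_sum, ← fdeg_eq_sum]
  omega

/-- The prescribed jumps around an edge add up to `d`.  For the outer edges, this is a consequence
of the Euler relation. -/
theorem IsGSMarked.edge_sum (hd : 3 ≤ d) [NeZero d] {M : G.MarkedOrientation}
    (h : G.IsGSMarked M) (a : D) :
    M.fjump a + M.vjump a + M.fjump (G.rev a) + M.vjump (G.rev a) = d := by
  refine G.edge_eq_of_le M.fjump_outer (h.sum_vjump hd) (fun f hf => h.sum_fjump hf)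
    (fun a => ?_) a
  by_cases ha : G.IsInnerArc a
  · have h1 := h.edge_weight a ha
    rw [M.fjump_inner fun i => (ha i).1, M.fjump_inner fun i => (ha.rev i).1,
      M.vjump_inner ha, M.vjump_inner ha.rev]
    omega
  · obtain ⟨i, rfl | rfl⟩ := G.not_isInnerArc_iff.1 ha
    · rw [M.fjump_outer, M.vjump_outer, M.vjump_rev_outer hd,
        M.fjump_inner (G.rev_outer_ne_outer hd i)]
      omega
    · rw [G.rev_rev, M.fjump_outer, M.vjump_outer, M.vjump_rev_outer hd,
        M.fjump_inner (G.rev_outer_ne_outer hd i)]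
      omega

/-- Normalized labels with the jumps that a marked orientation prescribes. -/
theorem IsGSMarked.exists_labels (hd : 3 ≤ d) [NeZero d] {M : G.MarkedOrientation}
    (h : G.IsGSMarked M) :
    ∃ lam : D → ZMod d, (∀ i, lam (G.outer i) = i + 1) ∧
      ∀ a, lam a = lam (G.cw (G.rev a)) + M.fjump a ∧ lam (G.cw a) = lam a + M.vjump a := by
  obtain ⟨lam, hlam⟩ := G.exists_labels G.connected G.euler (G.outer 0)
    (fun a => (M.fjump a : ZMod d)) (fun a => (M.vjump a : ZMod d))
    (fun x => by
      rw [← Int.cast_sum, h.sum_vjump hd]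
      simp)
    (fun f => by
      rw [← Int.cast_sum]
      by_cases hf : G.IsInnerFace f
      · rw [h.sum_fjump hf]
        simp
      · rw [G.isInnerFace_iff, not_not] at hf
        rw [hf, G.sum_outerFace _ M.fjump_outer]
        simp)
    (fun a => by
      rw [← Int.cast_add, ← Int.cast_add, ← Int.cast_add, h.edge_sum hd]
      simp)
  refine ⟨fun a => lam a - lam (G.outer 0) + 1, fun i => ?_, fun a => ⟨?_, ?_⟩⟩
  · have step : ∀ i, lam (G.outer (i + 1)) = lam (G.outer i) + 1 := fun i => by
      have h1 := (hlam (G.outer i)).1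
      rw [G.outer_next, M.fjump_outer] at h1
      rw [h1]
      push_cast
      ring
    have key : lam (G.outer i) = lam (G.outer 0) + i := by
      rw [← ZMod.natCast_zmod_val i]
      induction i.val with
      | zero => simp
      | succ n ih =>
        push_cast
        rw [step, ih]
        ring
    simp only
    rw [key]
    ring
  · simp only
    rw [(hlam a).1]
    ring
  · simp only
    rw [(hlam a).2]
    ring

/-- `Phi` is surjective when no inner face has degree `1`: the only corner of such a face would have
`d - 1` marks, which stand for a jump `d` that is not less than `d`. -/
theorem IsGSMarked.exists_Phi_eq (hd : 3 ≤ d) [NeZero d]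
    (hdeg : ∀ a, (∀ i, a ≠ G.outer i) → 2 ≤ G.fdeg (G.leftFace a))
    {M : G.MarkedOrientation} (h : G.IsGSMarked M) :
    ∃ L, G.IsFullLabeling (G.extend L) ∧ G.Phi L = M := by
  obtain ⟨lam, ho, hlam⟩ := h.exists_labels hd
  obtain ⟨L, rfl⟩ := G.exists_extend ho
  have hv : ∀ a, G.IsInnerArc a → G.vjump (G.extend L) a = M.weight a - M.marksAt a := by
    intro a ha
    have h1 := h.edge_weight a ha
    have h2 := h.marksAt_le_weight ha
    rw [RotationSystem.vjump, (hlam a).2, add_sub_cancel_left, M.vjump_inner ha]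
    rw [← Int.ofNat_sub h2, Int.cast_natCast, ZMod.val_cast_of_lt (by omega)]
  have hf : ∀ a, (∀ i, a ≠ G.outer i) → G.fjump (G.extend L) a = M.marksAt a + 1 := by
    intro a ha
    have h1 := h.marks_le (G.innerCorner ha)
    have h2 : G.fdeg (G.leftFace (G.innerCorner ha).1) = G.fdeg (G.leftFace a) := rfl
    have h3 := hdeg a ha
    rw [← M.marksAt_inner ha] at h1
    rw [RotationSystem.fjump, (hlam a).1, add_sub_cancel_left, M.fjump_inner ha,
      ← Int.natCast_succ, Int.cast_natCast, ZMod.val_cast_of_lt (by omega)]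
  -- turning clockwise from `outer i`, the label `i + 1` becomes `i` and then does not change
  have hat : ∀ i a, (∀ j, a ≠ G.outer j) → G.tail a = G.v i → G.extend L a = i := by
    intro i a hin ht
    obtain ⟨k, rfl⟩ := G.exists_pow_of_tail_eq ((G.tail_outer i).trans ht.symm)
    have key : ∀ k : ℕ, (G.cw ^ k) (G.outer i) = G.outer i ∨
        G.extend L ((G.cw ^ k) (G.outer i)) = i := by
      intro k
      induction k with
      | zero => exact Or.inl rfl
      | succ k ih =>
        have htk : G.tail ((G.cw ^ k) (G.outer i)) = G.v i := by rw [G.tail_cw_pow, tail_outer]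
        rw [pow_succ', Equiv.Perm.mul_apply]
        by_cases hin : G.IsInnerArc ((G.cw ^ k) (G.outer i))
        · right
          obtain ⟨h1, h2⟩ := h.at_outer _ hin (by
            rw [htk, not_isInnerVertex_iff]; exact ⟨i, rfl⟩)
          have h3 : M.marksAt ((G.cw ^ k) (G.outer i)) = _ :=
            (M.marksAt_inner fun j => (hin j).1).trans h2
          rw [(hlam _).2, M.vjump_inner hin, h1, h3, sub_self, Int.cast_zero, add_zero]
          exact ih.resolve_left (hin i).1
        · rcases G.eq_of_outer_of_tail htk hin with h1 | h1
          · right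
            rw [h1, (hlam _).2, M.vjump_outer, ho]
            push_cast
            rw [ZMod.natCast_self]
            ring
          · left
            rw [h1, G.outer_next, sub_add_cancel]
    exact (key k).resolve_left (hin i)
  refine ⟨L, ⟨ho, hat, fun x => ?_, fun f hin => ?_, fun a ha => ?_, fun a ha => ?_⟩, ?_⟩
  · by_cases hx : G.IsInnerVertex x
    · have h1 := h.sum_vjump hd x
      have h2 : ((∑ a : D with G.tail a = x, G.vjump (G.extend L) a : ℕ) : ℤ) = d := by
        rw [Nat.cast_sum, ← h1]
        refine Finset.sum_congr rfl fun a ha => ?_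
        have hin : G.IsInnerArc a := G.isInnerArc_of_isInnerVertex (by
          rwa [(Finset.mem_filter.1 ha).2])
        rw [hv a hin, M.vjump_inner hin, Nat.cast_sub (h.marksAt_le_weight hin)]
      exact_mod_cast h2
    · obtain ⟨k, rfl⟩ := G.not_isInnerVertex_iff.1 hx
      exact sum_vjump_v hd (by omega) ho hat k
  · have h1 := h.sum_fjump hin
    have h2 : ((∑ a : D with G.leftFace a = f, G.fjump (G.extend L) a : ℕ) : ℤ) = d := by
      rw [Nat.cast_sum, ← h1]
      refine Finset.sum_congr rfl fun a ha => ?_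
      have hne := G.ne_outer_of_isInnerFace (show G.IsInnerFace (G.leftFace a) by
        rwa [(Finset.mem_filter.1 ha).2])
      rw [hf a hne, M.fjump_inner hne]
      push_cast
      rfl
    exact_mod_cast h2
  · rw [hf a ha]
    omega
  · have h1 := h.arc_weight a ha
    have h2 := h.marksAt_le_weight ha
    rw [hf a fun i => (ha i).1, hv a ha]
    omega
  · refine MarkedOrientation.ext' (fun a => ?_) (fun c => ?_)
    · by_cases ha : G.IsInnerArc a
      · have h2 := h.marksAt_le_weight ha
        rw [G.Phi_weight L ha, hf a fun i => (ha i).1, hv a ha]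
        omega
      · rw [G.Phi_weight_outer L ha, h.outer_weight a ha]
    · rw [Phi_marks, hf c.1 c.2, M.marksAt_val]
      rfl

end Converse

/-! ### Marked and angular orientations -/

theorem IsGSMarked.isGSAngular_Psi [NeZero d] {G : DMap d D} (hd : 2 ≤ d)
    {M : G.MarkedOrientation} (h : G.IsGSMarked M) : G.IsGSAngular (G.Psi M) := by
  refine ⟨fun a ha => if_neg ha, fun a ha ht => ?_, fun c hc hne => ?_, fun f hf => ?_,
    fun c => ?_, fun x hx => ?_, fun a ha => ?_⟩
  · show (if G.IsInnerArc a then _ else _) = 0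
    rw [if_pos ha, (h.at_outer a ha ht).1]
    have := G.fdeg_leftFace_le fun i => (ha i).1
    omega
  · show d - G.fdeg (G.leftFace c.1) - M.marks c = 0
    have ha : G.IsInnerArc c.1 := fun i => ⟨c.2 i, hne i⟩
    have h1 : M.marks c = _ := (h.at_outer c.1 ha hc).2
    omega
  · exact h.face_marks f hf
  · show d - G.fdeg (G.leftFace c.1) - M.marks c + M.marks c = _
    have := h.marks_le c
    omega
  · have h1 := h.vertex_weight x hx
    have h2 : ∀ c : G.InnerCorner, G.Psi M (.toStar c) + M.marksAt c.1
        = d - G.fdeg (G.leftFace c.1) := fun c => by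
      rw [M.marksAt_val]
      have := h.marks_le c
      show d - G.fdeg (G.leftFace c.1) - M.marks c + M.marks c = _
      omega
    have h3 : ∑ c : G.InnerCorner with G.tail c.1 = x, G.Psi M (.toStar c)
        + ∑ c : G.InnerCorner with G.tail c.1 = x, M.marksAt c.1
        = ∑ a : D with G.tail a = x, (d - G.fdeg (G.leftFace a)) := by
      rw [← Finset.sum_add_distrib, Finset.sum_congr rfl fun c _ => h2 c,
        G.sum_innerCorner_tail hx fun a => d - G.fdeg (G.leftFace a)]
    have h4 : ∑ a : D with G.tail a = x, G.Psi M (.orig a)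
        + ∑ a : D with G.tail a = x, (d - G.fdeg (G.leftFace a))
        = ∑ a : D with G.tail a = x, M.weight a := by
      rw [← Finset.sum_add_distrib]
      refine Finset.sum_congr rfl fun a ha => ?_
      have hin : G.IsInnerArc a := G.isInnerArc_of_isInnerVertex (by
        rwa [(Finset.mem_filter.1 ha).2])
      have h5 := h.arc_weight a hin
      have h6 := G.fdeg_leftFace_le fun i => (hin i).1
      show (if G.IsInnerArc a then _ else _) + _ = _
      rw [if_pos hin]
      omega
    rw [Finset.sum_congr rfl fun c _ => (M.marksAt_val c).symm] at h1
    omega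
  · have h1 := h.edge_weight a ha
    have h2 := h.arc_weight a ha
    have h3 := h.arc_weight _ ha.rev
    have h4 := G.fdeg_leftFace_le fun i => (ha i).1
    have h5 := G.fdeg_leftFace_le fun i => (ha.rev i).1
    show (((if G.IsInnerArc a then _ else _ : ℕ) : ℤ)
      + ((if G.IsInnerArc (G.rev a) then _ else _ : ℕ) : ℤ)) = _
    rw [if_pos ha, if_pos ha.rev, RotationSystem.rightFace]
    omega

/-- The marked orientation of an angular orientation; this is the inverse of `Psi`. -/
def angularToMarked (A : G.AngularOrientation) : G.MarkedOrientation where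
  weight a := if G.IsInnerArc a then A (.orig a) + (d - G.fdeg (G.leftFace a)) else 0
  marks c := A (.fromStar c)

theorem IsGSAngular.isGSMarked {G : DMap d D} (hd : 2 ≤ d) {A : G.AngularOrientation}
    (h : G.IsGSAngular A) : G.IsGSMarked (G.angularToMarked A) := by
  have hw : ∀ a, G.IsInnerArc a → (G.angularToMarked A).weight a
    = A (.orig a) + (d - G.fdeg (G.leftFace a)) := fun a ha => if_pos ha
  refine ⟨fun a ha => if_neg ha, fun a ha ht => ⟨?_, ?_⟩, fun f hf => h.star_out f hf,
    fun a ha => ?_, fun x hx => ?_, fun a ha => ?_⟩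
  · rw [hw a ha, h.at_outer_orig a ha ht, zero_add]
  · have h1 := h.star_edge ha.corner
    have h2 := h.at_outer_star ha.corner ht fun i => (ha i).2
    rw [h2, zero_add] at h1
    exact h1
  · rw [hw a ha, hw _ ha.rev]
    have h1 := h.edge_weight a ha
    have h4 := G.fdeg_leftFace_le fun i => (ha i).1
    have h5 := G.fdeg_leftFace_le fun i => (ha.rev i).1
    rw [RotationSystem.rightFace] at h1
    omega
  · have h1 := h.vertex_out x hx
    have h3 : ∑ c : G.InnerCorner with G.tail c.1 = x, A (.toStar c)
        + ∑ c : G.InnerCorner with G.tail c.1 = x, A (.fromStar c)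
        = ∑ a : D with G.tail a = x, (d - G.fdeg (G.leftFace a)) := by
      rw [← Finset.sum_add_distrib, Finset.sum_congr rfl fun c _ => h.star_edge c,
        G.sum_innerCorner_tail hx fun a => d - G.fdeg (G.leftFace a)]
    have h4 : ∑ a : D with G.tail a = x, (G.angularToMarked A).weight a
        = ∑ a : D with G.tail a = x, A (.orig a)
          + ∑ a : D with G.tail a = x, (d - G.fdeg (G.leftFace a)) := by
      rw [← Finset.sum_add_distrib]
      refine Finset.sum_congr rfl fun a ha => hw a ?_
      exact G.isInnerArc_of_isInnerVertex (by rwa [(Finset.mem_filter.1 ha).2])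
    show _ = d + ∑ c : G.InnerCorner with G.tail c.1 = x, A (.fromStar c)
    omega
  · rw [hw a ha]
    omega

theorem IsGSAngular.Psi_angularToMarked {G : DMap d D} {A : G.AngularOrientation}
    (h : G.IsGSAngular A) : G.Psi (G.angularToMarked A) = A := by
  funext x
  cases x with
  | orig a =>
    by_cases ha : G.IsInnerArc a
    · have h4 := G.fdeg_leftFace_le fun i => (ha i).1
      show (if G.IsInnerArc a then (if G.IsInnerArc a then _ else 0) + _ - _ else 0) = _
      rw [if_pos ha, if_pos ha]
      omega
    · rw [h.outer_weight a ha]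
      exact if_neg ha
  | toStar c =>
    have := h.star_edge c
    show d - G.fdeg (G.leftFace c.1) - A (.fromStar c) = _
    omega
  | fromStar c => rfl

theorem IsGSMarked.angularToMarked_Psi {G : DMap d D} {M : G.MarkedOrientation}
    (h : G.IsGSMarked M) : G.angularToMarked (G.Psi M) = M := by
  refine MarkedOrientation.ext' (fun a => ?_) (fun c => rfl)
  by_cases ha : G.IsInnerArc a
  · have h4 := G.fdeg_leftFace_le fun i => (ha i).1
    have h5 := h.arc_weight a ha
    show (if G.IsInnerArc a then (if G.IsInnerArc a then _ else 0) + _ else 0) = _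
    rw [if_pos ha, if_pos ha]
    omega
  · rw [h.outer_weight a ha]
    exact if_neg ha

end DMap

namespace DMap

/-! ### Parity -/

theorem val_add_mod_two {b : ℕ} [NeZero b] (x y : ZMod (2 * b)) :
    (x + y).val % 2 = (x.val + y.val) % 2 := by
  rw [ZMod.val_add, Nat.mod_mul_right_mod]

section Bipartite

variable {b : ℕ} {D : Type*} {G : DMap (2 * b) D} (κ : G.Bicoloring)

theorem Bicoloring.black_v [NeZero b] (hb : 2 ≤ b) (i : ZMod (2 * b)) :
    κ.black (G.v i) ↔ Odd i.val := by
  have step : ∀ i, κ.black (G.v (i + 1)) ↔ ¬ κ.black (G.v i) := fun i => by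
    have := κ.proper (G.outer i)
    rwa [RotationSystem.head, tail_rev_outer, tail_outer] at this
  have h1 : (1 : ZMod (2 * b)).val = 1 := by
    have := ZMod.val_cast_of_lt (n := 2 * b) (a := 1) (by omega)
    rwa [Nat.cast_one] at this
  have hstep' : ∀ i : ZMod (2 * b), Odd (i + 1).val ↔ ¬ Odd i.val := fun i => by
    have := val_add_mod_two i 1
    rw [h1] at this
    rw [Nat.odd_iff, Nat.odd_iff]
    omega
  have key : ∀ n : ℕ, κ.black (G.v (1 + n)) ↔ Odd (1 + n : ZMod (2 * b)).val := by
    intro n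
    induction n with
    | zero => simp [κ.black_one, h1]
    | succ n ih => push_cast; rw [← add_assoc, step, hstep', ih]
  have h2 := key (i - 1).val
  rwa [ZMod.natCast_zmod_val, add_sub_cancel] at h2

theorem Bicoloring.black_rev (a : D) :
    κ.black (G.tail (G.rev a)) ↔ ¬ κ.black (G.tail a) := κ.proper a

include κ in
theorem Bicoloring.even_fdeg [Fintype D] (f : G.Face) : Even (G.fdeg f) := by
  have h1 : G.fdeg f = ∑ a : D with G.leftFace a = f, (if κ.black (G.tail a) then 1 else 0)
      + ∑ a : D with G.leftFace a = f,
        (if κ.black (G.tail (G.cw (G.rev a))) then 1 else 0) := by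
    rw [fdeg_eq_sum, ← Finset.sum_add_distrib]
    refine Finset.sum_congr rfl fun a _ => ?_
    rw [G.tail_cw]
    have := κ.black_rev a
    by_cases h : κ.black (G.tail a) <;> simp [this, h]
  rw [G.sum_leftFace_comp f fun a => if κ.black (G.tail a) then 1 else 0] at h1
  exact ⟨_, h1⟩

include κ in
theorem Bicoloring.two_le_fdeg [Fintype D] (a : D) : 2 ≤ G.fdeg (G.leftFace a) := by
  have h1 := κ.even_fdeg (G.leftFace a)
  have h2 : 0 < G.fdeg (G.leftFace a) := by
    rw [fdeg_eq_sum]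
    exact Finset.sum_pos (fun _ _ => one_pos) ⟨a, by simp⟩
  obtain ⟨k, hk⟩ := h1
  omega

theorem mem_BGSLabelings_iff [Fintype D] [NeZero b] (hb : 2 ≤ b) {L : G.Labeling} :
    L ∈ G.BGSLabelings κ ↔ G.IsFullLabeling (G.extend L) ∧
      ∀ a, (∀ i, a ≠ G.outer i) → (Odd (G.extend L a).val ↔ κ.black (G.tail a)) := by
  rw [BGSLabelings, Set.mem_ofPred_eq, G.isGSLabeling_iff (by omega)]
  refine and_congr_right fun _ => ⟨fun h a ha => ?_, fun h c => ?_⟩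
  · have := h (G.innerCorner ha)
    rw [G.extend_inner L ha]
    have h2 : G.tail (G.innerCorner ha).1 = G.tail a := rfl
    rw [h2] at this
    by_cases hbl : κ.black (G.tail a)
    · exact iff_of_true (this.1 hbl) hbl
    · exact iff_of_false (Nat.not_odd_iff_even.2 (this.2 hbl)) hbl
  · have := h c.1 c.2
    rw [extend_corner] at this
    rw [← this, Nat.not_odd_iff_even]
    exact ⟨id, id⟩

theorem odd_fjump [NeZero b] {lam : D → ZMod (2 * b)}
    (hpar : ∀ a, (∀ i, a ≠ G.outer i) → (Odd (lam a).val ↔ κ.black (G.tail a))) {a : D}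
    (ha : ∀ i, a ≠ G.outer i) : Odd (G.fjump lam a) := by
  have h1 := hpar a ha
  have h2 := hpar (G.cw (G.rev a)) (fun i hi => by
    have := G.cw_eq_outer_iff.1 hi
    exact ha _ (G.rev_injective this))
  rw [G.tail_cw, κ.black_rev, ← h1] at h2
  have h3 := val_add_mod_two (lam a - lam (G.cw (G.rev a))) (lam (G.cw (G.rev a)))
  rw [sub_add_cancel] at h3
  rw [RotationSystem.fjump]
  rw [Nat.odd_iff, Nat.odd_iff] at h2
  rw [Nat.odd_iff]
  omega

theorem even_vjump [NeZero b] {lam : D → ZMod (2 * b)}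
    (hpar : ∀ a, (∀ i, a ≠ G.outer i) → (Odd (lam a).val ↔ κ.black (G.tail a))) {a : D}
    (ha : G.IsInnerArc a) : Even (G.vjump lam a) := by
  have h1 := hpar a fun i => (ha i).1
  have h2 := hpar (G.cw a) ha.cw_ne
  rw [G.tail_cw, ← h1] at h2
  have h3 := val_add_mod_two (lam (G.cw a) - lam a) (lam a)
  rw [sub_add_cancel] at h3
  rw [RotationSystem.vjump]
  rw [Nat.even_iff]
  rw [Nat.odd_iff, Nat.odd_iff] at h2
  omega

theorem bijOn_Phi [Fintype D] (hb : 2 ≤ b) :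
    Set.BijOn G.Phi (G.BGSLabelings κ) G.EvenGSMarked := by
  have : NeZero b := ⟨by omega⟩
  refine ⟨fun L hL => ?_, fun L hL L' hL' h => ?_, fun M hM => ?_⟩
  · obtain ⟨h, hpar⟩ := (mem_BGSLabelings_iff κ hb).1 hL
    refine ⟨h.isGSMarked_Phi (by omega), fun a ha => ?_, fun c => ?_⟩
    · rw [G.Phi_weight L ha]
      obtain ⟨k, hk⟩ := odd_fjump κ hpar fun i => (ha i).1
      obtain ⟨l, hl⟩ := even_vjump κ hpar ha
      exact ⟨k + l, by omega⟩
    · rw [Phi_marks]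
      obtain ⟨k, hk⟩ := odd_fjump κ hpar c.2
      exact ⟨k, by omega⟩
  · exact ((mem_BGSLabelings_iff κ hb).1 hL).1.eq_of_Phi_eq
      ((mem_BGSLabelings_iff κ hb).1 hL').1 h
  · obtain ⟨hM, hw, hm⟩ := hM
    obtain ⟨L, hL, rfl⟩ := hM.exists_Phi_eq (by omega) (fun a _ => κ.two_le_fdeg a)
    refine ⟨L, (mem_BGSLabelings_iff κ hb).2 ⟨hL, ?_⟩, rfl⟩
    have hf : ∀ a, (∀ i, a ≠ G.outer i) → Odd (G.fjump (G.extend L) a) := fun a ha => by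
      obtain ⟨k, hk⟩ := hm (G.innerCorner ha)
      rw [Phi_marks] at hk
      have h1 := hL.fjump_pos a ha
      have h2 : (G.innerCorner ha).1 = a := rfl
      rw [h2] at hk
      exact ⟨k, by omega⟩
    have hv : ∀ a, G.IsInnerArc a → Even (G.vjump (G.extend L) a) := fun a ha => by
      obtain ⟨k, hk⟩ := hw a ha
      rw [G.Phi_weight L ha] at hk
      obtain ⟨l, hl⟩ := hf a fun i => (ha i).1
      exact ⟨k - l, by omega⟩
    have hat : ∀ i a, G.tail a = G.v i → (∀ i, a ≠ G.outer i) →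
        (Odd (G.extend L a).val ↔ κ.black (G.tail a)) := fun i a ht ha => by
      rw [hL.at_outer i a ha ht, ht, κ.black_v hb]
    -- the parity condition propagates along the jumps, from the outer vertices to all vertices
    have htail : ∀ a, ¬ G.IsInnerArc a → ∃ i, G.tail a = G.v i := fun a ha => by
      obtain ⟨i, rfl | rfl⟩ := G.not_isInnerArc_iff.1 ha
      · exact ⟨i, rfl⟩
      · exact ⟨i + 1, G.tail_rev_outer i⟩
    have hcw : ∀ a, ((∀ i, G.cw a ≠ G.outer i) → (Odd (G.extend L (G.cw a)).val ↔
        κ.black (G.tail (G.cw a)))) ↔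
        ((∀ i, a ≠ G.outer i) → (Odd (G.extend L a).val ↔ κ.black (G.tail a))) := fun a => by
      by_cases ha : G.IsInnerArc a
      · rw [imp_iff_right ha.cw_ne, imp_iff_right fun i => (ha i).1, G.tail_cw,
          G.lam_cw (G.extend L) a, Nat.odd_iff, Nat.odd_iff, val_add_mod_two,
          ZMod.val_cast_of_lt (G.vjump_lt _ _)]
        have := Nat.even_iff.1 (hv a ha)
        rw [Nat.add_mod, this, add_zero, Nat.mod_mod]
      · obtain ⟨i, hi⟩ := htail a ha
        exact iff_of_true (hat i _ (by rw [G.tail_cw, hi])) (hat i a hi)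
    refine G.forall_of_connected G.connected (a₀ := G.outer 0)
      (P := fun a => (∀ i, a ≠ G.outer i) → (Odd (G.extend L a).val ↔ κ.black (G.tail a)))
      hcw (fun a => ?_) (fun h => absurd rfl (h 0))
    by_cases ha : G.IsInnerArc a
    · rw [← hcw (G.rev a), imp_iff_right fun i => (ha i).1,
        imp_iff_right (ha.rev.cw_ne), G.tail_cw, κ.black_rev,
        G.lam_fjump (G.extend L) a, Nat.odd_iff, Nat.odd_iff, val_add_mod_two,
        ZMod.val_cast_of_lt (G.fjump_lt _ _)]
      have := Nat.odd_iff.1 (hf a fun i => (ha i).1)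
      constructor
      · intro h
        have h' := not_congr h
        rw [not_not] at h'
        rw [← h']
        omega
      · intro h
        rw [← h]
        omega
    · obtain ⟨i, hi⟩ := htail a ha
      obtain ⟨j, hj⟩ := htail (G.rev a) fun h => ha (by simpa [G.rev_rev] using h.rev)
      exact iff_of_true (hat j _ hj) (hat i a hi)

include κ in
theorem bijOn_Psi [Fintype D] (hb : 2 ≤ b) :
    Set.BijOn G.Psi G.EvenGSMarked G.EvenGSAngular := by
  have : NeZero b := ⟨by omega⟩
  have hdeg : ∀ f, Even (G.fdeg f) := κ.even_fdeg
  refine ⟨fun M hM => ?_, fun M hM M' hM' h => ?_, fun A hA => ?_⟩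
  · obtain ⟨hM, hw, hm⟩ := hM
    refine ⟨hM.isGSAngular_Psi (by omega), fun x => ?_⟩
    cases x with
    | orig a =>
      show Even (if G.IsInnerArc a then M.weight a + G.fdeg (G.leftFace a) - 2 * b else 0)
      split_ifs with ha
      · obtain ⟨k, hk⟩ := hw a ha
        obtain ⟨l, hl⟩ := hdeg (G.leftFace a)
        exact ⟨k + l - b, by omega⟩
      · exact Even.zero
    | toStar c =>
      show Even (2 * b - G.fdeg (G.leftFace c.1) - M.marks c)
      obtain ⟨k, hk⟩ := hm c
      obtain ⟨l, hl⟩ := hdeg (G.leftFace c.1)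
      exact ⟨b - l - k, by omega⟩
    | fromStar c => exact hm c
  · rw [← hM.1.angularToMarked_Psi, h, hM'.1.angularToMarked_Psi]
  · obtain ⟨hA, he⟩ := hA
    refine ⟨G.angularToMarked A, ⟨hA.isGSMarked (by omega), fun a ha => ?_, fun c => he _⟩,
      hA.Psi_angularToMarked⟩
    show Even (if G.IsInnerArc a then _ else _)
    rw [if_pos ha]
    obtain ⟨k, hk⟩ := he (.orig a)
    obtain ⟨l, hl⟩ := hdeg (G.leftFace a)
    exact ⟨k + (b - l), by omega⟩

/-! ### Dividing by two -/

/-- Multiplying all weights and numbers of marks by 2. -/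
def doubleMarked (M : G.MarkedOrientation) : G.MarkedOrientation where
  weight a := 2 * M.weight a
  marks c := 2 * M.marks c

/-- Multiplying all weights by 2. -/
def doubleAngular (A : G.AngularOrientation) : G.AngularOrientation := fun x => 2 * A x

include κ in
theorem isGSMarked_double_iff [Fintype D] (hb : 2 ≤ b) {M : G.MarkedOrientation} :
    G.IsGSMarked (doubleMarked M) ↔ G.IsBGSMarked M := by
  have hdeg : ∀ f, 2 * b - G.fdeg f = 2 * (b - G.fdeg f / 2) := fun f => by
    obtain ⟨k, hk⟩ := κ.even_fdeg f
    omega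
  constructor
  · intro h
    refine ⟨fun a ha => ?_, fun a ha ht => ?_, fun f hf => ?_, fun a ha => ?_, fun x hx => ?_,
      fun a ha => ?_⟩
    · have h1 : 2 * M.weight a = 0 := h.outer_weight a ha
      omega
    · have h1 : 2 * M.weight a = _ ∧ 2 * M.marks ha.corner = _ := h.at_outer a ha ht
      rw [hdeg] at h1
      omega
    · have h1 : ∑ c : G.InnerCorner with G.leftFace c.1 = f, 2 * M.marks c = _ :=
        h.face_marks f hf
      rw [hdeg, ← Finset.mul_sum] at h1
      omega
    · have h1 : 2 * M.weight a + 2 * M.weight (G.rev a) = _ := h.edge_weight a ha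
      omega
    · have h1 : ∑ a : D with G.tail a = x, 2 * M.weight a
        = 2 * b + ∑ c : G.InnerCorner with G.tail c.1 = x, 2 * M.marks c := h.vertex_weight x hx
      rw [← Finset.mul_sum, ← Finset.mul_sum] at h1
      omega
    · have h1 : _ ≤ 2 * M.weight a := h.arc_weight a ha
      rw [hdeg] at h1
      omega
  · intro h
    refine ⟨fun a ha => ?_, fun a ha ht => ?_, fun f hf => ?_, fun a ha => ?_, fun x hx => ?_,
      fun a ha => ?_⟩
    · show 2 * M.weight a = 0
      rw [h.outer_weight a ha]
    · show 2 * M.weight a = _ ∧ 2 * M.marks ha.corner = _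
      rw [hdeg, (h.at_outer a ha ht).1, (h.at_outer a ha ht).2]
      exact ⟨rfl, rfl⟩
    · show ∑ c : G.InnerCorner with G.leftFace c.1 = f, 2 * M.marks c = _
      rw [hdeg, ← Finset.mul_sum, h.face_marks f hf]
    · show 2 * M.weight a + 2 * M.weight (G.rev a) = _
      have := h.edge_weight a ha
      omega
    · show ∑ a : D with G.tail a = x, 2 * M.weight a
        = 2 * b + ∑ c : G.InnerCorner with G.tail c.1 = x, 2 * M.marks c
      rw [← Finset.mul_sum, ← Finset.mul_sum, h.vertex_weight x hx]
      ring
    · show _ ≤ 2 * M.weight a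
      rw [hdeg]
      exact Nat.mul_le_mul_left _ (h.arc_weight a ha)

include κ in
theorem bijOn_halveMarked [Fintype D] (hb : 2 ≤ b) :
    Set.BijOn G.halveMarked G.EvenGSMarked G.BGSMarked := by
  have hdh : ∀ M ∈ G.EvenGSMarked, doubleMarked (G.halveMarked M) = M := by
    rintro M ⟨hM, hw, hm⟩
    refine MarkedOrientation.ext' (fun a => ?_) (fun c => ?_)
    · show 2 * (M.weight a / 2) = _
      by_cases ha : G.IsInnerArc a
      · exact Nat.two_mul_div_two_of_even (hw a ha)
      · rw [hM.outer_weight a ha]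
    · exact Nat.two_mul_div_two_of_even (hm c)
  have hhd : ∀ M : G.MarkedOrientation, G.halveMarked (doubleMarked M) = M := fun M =>
    MarkedOrientation.ext' (fun a => Nat.mul_div_cancel_left _ two_pos)
      (fun c => Nat.mul_div_cancel_left _ two_pos)
  refine ⟨fun M hM => ?_, fun M hM M' hM' h => ?_, fun M hM => ?_⟩
  · refine (isGSMarked_double_iff κ hb).1 ?_
    rw [hdh M hM]
    exact hM.1
  · rw [← hdh M hM, h, hdh M' hM']
  · exact ⟨doubleMarked M, ⟨(isGSMarked_double_iff κ hb).2 hM, fun a _ => even_two_mul _,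
      fun c => even_two_mul _⟩, hhd M⟩

include κ in
theorem isGSAngular_double_iff [Fintype D] {A : G.AngularOrientation} :
    G.IsGSAngular (doubleAngular A) ↔ G.IsBGSAngular A := by
  have hdeg : ∀ f, 2 * b - G.fdeg f = 2 * (b - G.fdeg f / 2) := fun f => by
    obtain ⟨k, hk⟩ := κ.even_fdeg f
    omega
  constructor
  · intro h
    refine ⟨fun a ha => ?_, fun a ha ht => ?_, fun c hc hne => ?_, fun f hf => ?_, fun c => ?_,
      fun x hx => ?_, fun a ha => ?_⟩
    · have h1 : 2 * A (.orig a) = 0 := h.outer_weight a ha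
      omega
    · have h1 : 2 * A (.orig a) = 0 := h.at_outer_orig a ha ht
      omega
    · have h1 : 2 * A (.toStar c) = 0 := h.at_outer_star c hc hne
      omega
    · have h1 : ∑ c : G.InnerCorner with G.leftFace c.1 = f, 2 * A (.fromStar c) = _ :=
        h.star_out f hf
      rw [hdeg, ← Finset.mul_sum] at h1
      omega
    · have h1 : 2 * A (.toStar c) + 2 * A (.fromStar c) = _ := h.star_edge c
      rw [hdeg] at h1
      omega
    · have h1 : ∑ a : D with G.tail a = x, 2 * A (.orig a)
        + ∑ c : G.InnerCorner with G.tail c.1 = x, 2 * A (.toStar c) = _ := h.vertex_out x hx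
      rw [← Finset.mul_sum, ← Finset.mul_sum] at h1
      omega
    · have h1 : ((2 * A (.orig a) : ℕ) + (2 * A (.orig (G.rev a)) : ℕ) : ℤ) = _ :=
        h.edge_weight a ha
      obtain ⟨k, hk⟩ := κ.even_fdeg (G.leftFace a)
      obtain ⟨l, hl⟩ := κ.even_fdeg (G.rightFace a)
      omega
  · intro h
    refine ⟨fun a ha => ?_, fun a ha ht => ?_, fun c hc hne => ?_, fun f hf => ?_, fun c => ?_,
      fun x hx => ?_, fun a ha => ?_⟩
    · show 2 * A (.orig a) = 0
      rw [h.outer_weight a ha]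
    · show 2 * A (.orig a) = 0
      rw [h.at_outer_orig a ha ht]
    · show 2 * A (.toStar c) = 0
      rw [h.at_outer_star c hc hne]
    · show ∑ c : G.InnerCorner with G.leftFace c.1 = f, 2 * A (.fromStar c) = _
      rw [hdeg, ← Finset.mul_sum, h.star_out f hf]
    · show 2 * A (.toStar c) + 2 * A (.fromStar c) = _
      rw [hdeg, ← h.star_edge c]
      ring
    · show ∑ a : D with G.tail a = x, 2 * A (.orig a)
        + ∑ c : G.InnerCorner with G.tail c.1 = x, 2 * A (.toStar c) = _
      rw [← Finset.mul_sum, ← Finset.mul_sum, ← mul_add, h.vertex_out x hx]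
    · show ((2 * A (.orig a) : ℕ) + (2 * A (.orig (G.rev a)) : ℕ) : ℤ) = _
      have h1 := h.edge_weight a ha
      obtain ⟨k, hk⟩ := κ.even_fdeg (G.leftFace a)
      obtain ⟨l, hl⟩ := κ.even_fdeg (G.rightFace a)
      omega

include κ in
theorem bijOn_halveAngular [Fintype D] :
    Set.BijOn G.halveAngular G.EvenGSAngular G.BGSAngular := by
  have hdh : ∀ A ∈ G.EvenGSAngular, doubleAngular (G.halveAngular A) = A := fun A hA =>
    funext fun x => Nat.two_mul_div_two_of_even (hA.2 x)
  refine ⟨fun A hA => ?_, fun A hA A' hA' h => ?_, fun A hA => ?_⟩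
  · refine (isGSAngular_double_iff κ).1 ?_
    rw [hdh A hA]
    exact hA.1
  · rw [← hdh A hA, h, hdh A' hA']
  · exact ⟨doubleAngular A, ⟨(isGSAngular_double_iff κ).2 hA, fun x => even_two_mul _⟩,
      funext fun x => Nat.mul_div_cancel_left _ two_pos⟩

end Bipartite

end DMap

/-! ### Labels and woods -/

namespace RotationSystem

variable {D : Type*} (G : RotationSystem D) {N : ℕ} [NeZero N] [Fintype D] {lam : D → ZMod N}
  {x : G.Vertex} (hsum : ∑ a : D with G.tail a = x, G.vjump lam a = N)
include hsum

theorem exists_family : ∃ a : ZMod N → D, ∀ i, G.tail (a i) = x ∧ G.HasColor lam i (a i) := by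
  choose a ha _ using fun i => G.existsUnique_hasColor hsum i
  exact ⟨a, ha⟩

theorem forall_strictlyBetween_iff {y : D} (hy : G.tail y = x) (j : ZMod N) {m : ℕ} (hm : m ≤ N) :
    (∀ a : ZMod N → D, (∀ i, G.tail (a i) = x ∧ G.HasColor lam i (a i)) →
      G.StrictlyBetween a j m y) ↔
      ∃ u : ℕ, lam y = j + 1 + u ∧ u + 1 + G.vjump lam y ≤ m := by
  obtain ⟨a, ha⟩ := G.exists_family hsum
  exact ⟨fun h => (G.strictlyBetween_iff hsum ha hy j hm).1 (h a ha),
    fun h a ha => (G.strictlyBetween_iff hsum ha hy j hm).2 h⟩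

theorem exists_strictlyBetween_iff {y : D} (hy : G.tail y = x) (j : ZMod N) {m : ℕ} (hm : m ≤ N) :
    (∃ a : ZMod N → D, (∀ i, G.tail (a i) = x ∧ G.HasColor lam i (a i)) ∧
      G.StrictlyBetween a j m y) ↔
      ∃ u : ℕ, lam y = j + 1 + u ∧ u + 1 + G.vjump lam y ≤ m := by
  obtain ⟨a, ha⟩ := G.exists_family hsum
  exact ⟨fun ⟨a, ha, h⟩ => (G.strictlyBetween_iff hsum ha hy j hm).1 h,
    fun h => ⟨a, ha, (G.strictlyBetween_iff hsum ha hy j hm).2 h⟩⟩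

end RotationSystem

theorem ZMod.nat_eq_of_cast_eq {N k l : ℕ} (h : (k : ZMod N) = l) (h1 : k < l + N)
    (h2 : l < k + N) : k = l := by
  rw [ZMod.natCast_eq_natCast_iff] at h
  refine h.eq_of_abs_lt ?_
  rw [abs_lt]
  constructor <;> omega

namespace DMap

variable {d : ℕ} {D : Type*} (G : DMap d D)

/-- Labels given separately around each inner vertex and at the outer vertices, put together. -/
theorem exists_glue {N : ℕ} (Λ : G.Vertex → D → ZMod N) (out : ZMod d → ZMod N) :
    ∃ lam : D → ZMod N, (∀ i, lam (G.outer i) = out i + 1) ∧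
      (∀ i a, (∀ j, a ≠ G.outer j) → G.tail a = G.v i → lam a = out i) ∧
      ∀ a, G.IsInnerVertex (G.tail a) → lam a = Λ (G.tail a) a := by
  refine ⟨fun a => if ha : G.IsInnerVertex (G.tail a) then Λ (G.tail a) a
    else if ∃ i, a = G.outer i then out (G.not_isInnerVertex_iff.1 ha).choose + 1
    else out (G.not_isInnerVertex_iff.1 ha).choose, fun i => ?_, fun i a hin ht => ?_,
    fun a ha => dif_pos ha⟩
  · have h : ¬ G.IsInnerVertex (G.tail (G.outer i)) := fun h => h i rfl
    simp only [dif_neg h]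
    rw [if_pos ⟨i, rfl⟩]
    have := (G.not_isInnerVertex_iff.1 h).choose_spec
    rw [← G.v_injective ((G.tail_outer i).symm.trans this)]
  · have h : ¬ G.IsInnerVertex (G.tail a) := fun h => h i ht
    simp only [dif_neg h]
    rw [if_neg fun ⟨j, hj⟩ => hin j hj]
    have := (G.not_isInnerVertex_iff.1 h).choose_spec
    rw [← G.v_injective (ht.symm.trans this)]

variable {G} in
theorem vjump_congr_vertex {N : ℕ} {lam mu : D → ZMod N} {x : G.Vertex}
    (h : ∀ a, G.tail a = x → lam a = mu a) {a : D} (ha : G.tail a = x) :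
    G.vjump lam a = G.vjump mu a := by
  rw [RotationSystem.vjump, RotationSystem.vjump, h a ha, h (G.cw a) (by rw [G.tail_cw, ha])]

section OuterColors

variable {G} {N : ℕ} [NeZero N] {lam : D → ZMod N} {out : ZMod d → ZMod N} (hd : 3 ≤ d)
  (hN : 2 ≤ N) (ho : ∀ i, lam (G.outer i) = out i + 1)
  (ha : ∀ i a, (∀ j, a ≠ G.outer j) → G.tail a = G.v i → lam a = out i)
include hd hN ho ha

theorem hasColor_outer_iff (i : ZMod N) (k : ZMod d) :
    G.HasColor lam i (G.outer k) ↔ out k ≠ i := by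
  rw [G.hasColor_iff, vjump_outer hd hN ho ha, ho]
  constructor
  · rintro ⟨u, hu, h1⟩ rfl
    have h2 : ((0 : ℕ) : ZMod N) = (1 + u : ℕ) := by
      push_cast
      linear_combination h1
    have := ZMod.nat_eq_of_cast_eq h2 (by omega) (by omega)
    omega
  · intro hk
    refine ⟨(i - (out k + 1)).val, ?_, by simp⟩
    have h1 := ZMod.val_lt (i - (out k + 1))
    by_contra hcon
    have h2 : (i - (out k + 1)).val + 1 = N := by omega
    have h3 : (((i - (out k + 1)).val + 1 : ℕ) : ZMod N) = 0 := by rw [h2, ZMod.natCast_self]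
    push_cast at h3
    rw [ZMod.natCast_zmod_val] at h3
    exact hk (by linear_combination -h3)

theorem hasColor_rev_outer_iff (i : ZMod N) (k : ZMod d) :
    G.HasColor lam i (G.rev (G.outer k)) ↔ i = out (k + 1) := by
  rw [G.hasColor_iff, vjump_rev_outer hd hN ho ha,
    ha (k + 1) _ (G.rev_outer_ne_outer hd k) (G.tail_rev_outer k)]
  simp

end OuterColors

/-- The labels `lam` of all the corners describe the sets of arcs `W`: the colors of an inner arc
form the cyclic interval between the labels on both of its sides. -/
structure Describes [Fintype D] (lam : D → ZMod d) (W : G.ArcTuple d) : Prop where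
  outer : ∀ i, lam (G.outer i) = i + 1
  at_outer : ∀ i a, (∀ j, a ≠ G.outer j) → G.tail a = G.v i → lam a = i
  sum_vertex : ∀ x, ∑ a : D with G.tail a = x, G.vjump lam a = d
  mem_inner : ∀ a, G.IsInnerArc a → ∀ i, a ∈ W i ↔ G.HasColor lam i a
  mem_outer : ∀ i k, G.outer k ∈ W i ↔ k ≠ i
  rev_outer : ∀ i k, G.rev (G.outer k) ∉ W i

section Describes

variable {G} [Fintype D] [NeZero d] {lam : D → ZMod d} {W : G.ArcTuple d}

theorem Describes.numColors (h : G.Describes lam W) {a : D} (ha : G.IsInnerArc a) :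
    G.numColors W a = G.vjump lam a := by
  rw [← G.natCard_hasColor lam a, DMap.numColors]
  exact Nat.card_congr (Equiv.subtypeEquivRight (h.mem_inner a ha))

theorem Describes.isOutArc_iff (hd : 3 ≤ d) (h : G.Describes lam W) {x : G.Vertex} {i : ZMod d}
    {a : D} : G.IsOutArc W x i a ↔ G.tail a = x ∧ G.HasColor lam i a := by
  have hout : ∀ k, G.HasColor lam i (G.outer k) ↔ k ≠ i :=
    hasColor_outer_iff hd (by omega) h.outer h.at_outer i
  have hrev : ∀ k, G.HasColor lam i (G.rev (G.outer k)) ↔ i = k + 1 :=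
    hasColor_rev_outer_iff hd (by omega) h.outer h.at_outer i
  by_cases hx : G.IsInnerVertex x
  · rw [IsOutArc]
    constructor
    · rintro (⟨h1, -⟩ | ⟨-, rfl, h1⟩)
      · exact absurd h1 (hx i)
      · exact ⟨rfl, (h.mem_inner a (G.isInnerArc_of_isInnerVertex hx) i).1 h1⟩
    · rintro ⟨rfl, h1⟩
      exact Or.inr ⟨hx i, rfl, (h.mem_inner a (G.isInnerArc_of_isInnerVertex hx) i).2 h1⟩
  · obtain ⟨k, rfl⟩ := G.not_isInnerVertex_iff.1 hx
    constructor
    · rintro (⟨h1, rfl⟩ | ⟨h0, h1, h2⟩)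
      · rw [tail_rev_outer, sub_add_cancel, h1, hrev, sub_add_cancel]
        exact ⟨rfl, rfl⟩
      · refine ⟨h1, ?_⟩
        by_cases ha : G.IsInnerArc a
        · exact (h.mem_inner a ha i).1 h2
        · rcases G.eq_of_outer_of_tail h1 ha with rfl | rfl
          · rw [hout]
            exact fun hk => h0 (by rw [hk])
          · exact absurd h2 (h.rev_outer i _)
    · rintro ⟨h1, h2⟩
      by_cases ha : G.IsInnerArc a
      · rw [RotationSystem.HasColor, vjump_at_outer h.at_outer ha h1] at h2
        exact absurd h2 (Nat.not_lt_zero _)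
      · rcases G.eq_of_outer_of_tail h1 ha with rfl | rfl
        · rw [hout] at h2
          exact Or.inr ⟨fun hk => h2 (G.v_injective hk), h1, (h.mem_outer i k).2 h2⟩
        · rw [hrev, sub_add_cancel] at h2
          subst h2
          exact Or.inl ⟨rfl, rfl⟩

theorem Describes.isOutFamily_iff (hd : 3 ≤ d) (h : G.Describes lam W) {x : G.Vertex}
    {a : ZMod d → D} :
    G.IsOutFamily W x a ↔ ∀ i, G.tail (a i) = x ∧ G.HasColor lam i (a i) :=
  forall_congr' fun _ => h.isOutArc_iff hd

theorem Describes.forall_strictlyBetween_iff (hd : 3 ≤ d) (h : G.Describes lam W) {y : D}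
    (j : ZMod d) {m : ℕ} (hm : m ≤ d) :
    (∀ a, G.IsOutFamily W (G.tail y) a → G.StrictlyBetween a j m y) ↔
      ∃ u : ℕ, lam y = j + 1 + u ∧ u + 1 + G.vjump lam y ≤ m := by
  simp only [h.isOutFamily_iff hd]
  exact G.forall_strictlyBetween_iff (h.sum_vertex _) rfl j hm

theorem Describes.exists_strictlyBetween_iff (hd : 3 ≤ d) (h : G.Describes lam W) {y : D}
    (j : ZMod d) {m : ℕ} (hm : m ≤ d) :
    (∃ a, G.IsOutFamily W (G.tail y) a ∧ G.StrictlyBetween a j m y) ↔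
      ∃ u : ℕ, lam y = j + 1 + u ∧ u + 1 + G.vjump lam y ≤ m := by
  simp only [h.isOutFamily_iff hd]
  exact G.exists_strictlyBetween_iff (h.sum_vertex _) rfl j hm

end Describes

variable [Fintype D] [NeZero d]

omit [NeZero d] in
theorem describes_Theta (hd : 3 ≤ d) {L : G.Labeling} (h : G.IsFullLabeling (G.extend L)) :
    G.Describes (G.extend L) (G.Theta L) := by
  refine ⟨h.outer, h.at_outer, h.sum_vertex, fun a ha i => ?_, fun i k => ?_, fun i k => ?_⟩
  · rw [RotationSystem.HasColor, ← G.jump_nextAtVertex L ha,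
      G.extend_inner L fun i => (ha i).1]
    constructor
    · rintro (⟨j, -, hj⟩ | ⟨_, h1⟩)
      · exact absurd hj (ha j).1
      · exact h1
    · exact fun h1 => Or.inr ⟨ha, h1⟩
  · constructor
    · rintro (⟨j, hj, h1⟩ | ⟨h1, -⟩)
      · rwa [G.outer_injective h1]
      · exact absurd rfl (h1 k).1
    · exact fun hk => Or.inl ⟨k, hk, rfl⟩
  · rintro (⟨j, -, h1⟩ | ⟨h1, -⟩)
    · exact G.rev_outer_ne_outer hd k j h1
    · exact (h1 k).2 rfl

variable {G}

omit [NeZero d] in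
theorem Describes.eq_Theta (hd : 3 ≤ d) {L : G.Labeling} {W : G.ArcTuple d}
    (hL : G.IsFullLabeling (G.extend L)) (h : G.Describes (G.extend L) W) : G.Theta L = W := by
  have h' := G.describes_Theta hd hL
  funext i
  ext a
  by_cases ha : G.IsInnerArc a
  · rw [h.mem_inner a ha, h'.mem_inner a ha]
  · obtain ⟨k, rfl | rfl⟩ := G.not_isInnerArc_iff.1 ha
    · rw [h.mem_outer, h'.mem_outer]
    · exact iff_of_false (h'.rev_outer i k) (h.rev_outer i k)

/-- The conditions on incoming arcs follow from the value `d` of the total of the four jumps around an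
edge. -/
theorem IsFullLabeling.isGSWood (hd : 3 ≤ d) {lam : D → ZMod d} {W : G.ArcTuple d}
    (hL : G.IsFullLabeling lam) (h : G.Describes lam W) : G.IsGSWood W := by
  have hrel : ∀ e, G.IsInnerArc e → lam (G.rev e)
      = lam e + (G.vjump lam e : ℕ) + (G.fjump lam (G.rev e) : ℕ) := fun e he => by
    rw [G.lam_fjump lam (G.rev e), G.rev_rev, G.lam_cw lam e]
  refine ⟨fun i x hx => ?_, fun i a ht hmem => ?_, fun i k => (h.mem_outer i k).2,
    fun i a ha ht hmem => ?_, fun x _ a ha => ?_, fun e i he hi => ?_,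
    fun e i k he hk hcol => ?_⟩
  · have h1 := G.existsUnique_hasColor (h.sum_vertex x) i
    simp only [← h.isOutArc_iff hd] at h1
    simpa [IsOutArc, hx] using h1
  · by_cases ha : G.IsInnerArc a
    · rw [h.mem_inner a ha, RotationSystem.HasColor, vjump_at_outer h.at_outer ha ht] at hmem
      exact absurd hmem (Nat.not_lt_zero _)
    · rcases G.eq_of_outer_of_tail ht ha with rfl | rfl
      · exact (h.mem_outer i i).1 hmem rfl
      · exact h.rev_outer i _ hmem
  · rw [h.mem_inner a ha, G.hasColor_iff] at hmem
    obtain ⟨u, hu, hi⟩ := hmem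
    have h1 := hL.edge_sum hd ha
    have h2 := hL.fjump_pos a fun i => (ha i).1
    have h3 := hL.fjump_pos _ fun i => (ha.rev i).1
    have h4 := hrel a ha
    rcases ht with ht | ht
    · rw [h.at_outer i _ (fun i => (ha.rev i).1) ht] at h4
      have h5 : ((u : ℕ) : ZMod d) = (G.vjump lam a + G.fjump lam (G.rev a) : ℕ) := by
        push_cast
        linear_combination h4 - hi
      have := ZMod.nat_eq_of_cast_eq h5 (by omega) (by omega)
      omega
    · rw [h.at_outer (i + 1) _ (fun i => (ha.rev i).1) ht] at h4
      have h5 : ((u + 1 : ℕ) : ZMod d) = (G.vjump lam a + G.fjump lam (G.rev a) : ℕ) := by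
        push_cast
        linear_combination h4 - hi
      have := ZMod.nat_eq_of_cast_eq h5 (by omega) (by omega)
      omega
  · rw [h.isOutFamily_iff hd] at ha
    exact G.sweep_eq_vdeg (h.sum_vertex x) ha 0
  · have hin : G.IsInnerArc e := by
      have := (G.isInnerArc_of_isInnerVertex he).rev
      rwa [G.rev_rev] at this
    refine (h.forall_strictlyBetween_iff hd _ (by omega)).2 ?_
    rw [h.mem_inner e hin, G.hasColor_iff] at hi
    obtain ⟨u, hu, rfl⟩ := hi
    have h1 := hL.edge_sum hd hin
    have h2 := hL.fjump_pos e fun i => (hin i).1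
    have h3 := hL.fjump_pos _ fun i => (hin.rev i).1
    obtain ⟨w, hw⟩ : ∃ w, G.vjump lam e + G.fjump lam (G.rev e) = u + 2 + w :=
      Nat.exists_eq_add_of_le (by omega)
    refine ⟨w, ?_, by omega⟩
    have hw' := congrArg (Nat.cast (R := ZMod d)) hw
    push_cast at hw'
    rw [hrel e hin]
    linear_combination hw'
  · refine (h.forall_strictlyBetween_iff hd _ (by omega)).2 ?_
    rw [h.numColors he.rev, RotationSystem.rightFace] at hk
    have h1 := hL.edge_sum hd he
    have h2 := hL.fjump_pos e fun i => (he i).1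
    have h3 := hL.edge _ he.rev
    rcases hcol with hcol | ⟨hno, hbet⟩
    · rw [h.mem_inner e he, G.hasColor_iff] at hcol
      obtain ⟨u, hu, rfl⟩ := hcol
      obtain ⟨w, hw⟩ : ∃ w, G.vjump lam e + G.fjump lam (G.rev e) = u + 2 + k + w :=
        Nat.exists_eq_add_of_le (by omega)
      refine ⟨w, ?_, by omega⟩
      have hw' := congrArg (Nat.cast (R := ZMod d)) hw
      push_cast at hw'
      rw [hrel e he]
      linear_combination hw'
    · rw [h.exists_strictlyBetween_iff hd _ (by omega)] at hbet
      obtain ⟨u, hu, hle⟩ := hbet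
      have hu0 : u = 0 := by omega
      have hv0 : G.vjump lam e = 0 := by omega
      rw [hu0, Nat.cast_zero, add_zero] at hu
      obtain ⟨w, hw⟩ : ∃ w, G.fjump lam (G.rev e) = 1 + k + w :=
        Nat.exists_eq_add_of_le (by omega)
      refine ⟨w, ?_, by omega⟩
      have hw' := congrArg (Nat.cast (R := ZMod d)) hw
      push_cast at hw'
      rw [hrel e he, hv0, hu]
      linear_combination hw'

/-- Given the jumps around the vertices and the edges, the total of the jumps around each inner
face, a positive multiple of `d`, must be equal to `d` by the Euler relation. -/
theorem isFullLabeling_of_edge_sum (hd : 3 ≤ d) {lam : D → ZMod d}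
    (ho : ∀ i, lam (G.outer i) = i + 1)
    (ha : ∀ i a, (∀ j, a ≠ G.outer j) → G.tail a = G.v i → lam a = i)
    (hv : ∀ x, G.IsInnerVertex x → ∑ a : D with G.tail a = x, G.vjump lam a = d)
    (hpos : ∀ a, G.IsInnerArc a → 0 < G.fjump lam a)
    (hedge : ∀ a, G.IsInnerArc a → d < G.fjump lam a + G.vjump lam a + G.fdeg (G.leftFace a))
    (hsum : ∀ a, G.IsInnerArc a →
      G.fjump lam a + G.vjump lam a + G.fjump lam (G.rev a) + G.vjump lam (G.rev a) = d) :
    G.IsFullLabeling lam := by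
  have hv' : ∀ x, ∑ a : D with G.tail a = x, G.vjump lam a = d := fun x => by
    by_cases hx : G.IsInnerVertex x
    · exact hv x hx
    · obtain ⟨k, rfl⟩ := G.not_isInnerVertex_iff.1 hx
      exact sum_vjump_v hd (by omega) ho ha k
  have hpos' : ∀ a, (∀ i, a ≠ G.outer i) → 0 < G.fjump lam a := fun a hin => by
    rcases G.isInnerArc_or hin with h | ⟨i, rfl⟩
    · exact hpos a h
    · rw [fjump_rev_outer hd ha]
      exact one_pos
  refine ⟨ho, ha, hv', fun f hf => ?_, hpos', hedge⟩
  have key := G.face_eq_of_le (φ := G.fjumpInt lam) (ε := fun a => G.vjump lam a)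
    (G.fjumpInt_outer lam) (fun x => by exact_mod_cast hv' x) (fun f hf => ?_) (fun a => ?_) hf
  · rw [G.sum_fjumpInt lam hf] at key
    exact_mod_cast key
  · rw [G.sum_fjumpInt lam hf]
    have hdvd : d ∣ ∑ a : D with G.leftFace a = f, G.fjump lam a := by
      rw [← ZMod.natCast_eq_zero_iff, Nat.cast_sum]
      have h1 : ∀ a, ((G.fjump lam a : ℕ) : ZMod d) = lam a - lam (G.cw (G.rev a)) := fun a => by
        simp [RotationSystem.fjump]
      simp only [h1]
      rw [Finset.sum_sub_distrib, G.sum_leftFace_comp, sub_self]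
    obtain ⟨c, rfl⟩ := hf
    have h0 : 0 < ∑ a : D with G.leftFace a = G.leftFace c.1, G.fjump lam a := by
      refine Finset.sum_pos (fun a hmem => hpos' a ?_) ⟨c.1, by simp⟩
      exact G.ne_outer_of_isInnerFace (by
        rw [(Finset.mem_filter.1 hmem).2]
        exact ⟨c, rfl⟩)
    exact_mod_cast Nat.le_of_dvd h0 hdvd
  · by_cases hin : G.IsInnerArc a
    · rw [G.fjumpInt_inner lam fun i => (hin i).1, G.fjumpInt_inner lam fun i => (hin.rev i).1]
      exact_mod_cast hsum a hin
    · exact G.fjumpInt_edge_outer hd ho ha hin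

omit [Fintype D] [NeZero d] in
theorem IsGSWood.rev_outer_notMem {W : G.ArcTuple d} (hd : 3 ≤ d) (hW : G.IsGSWood W)
    (i k : ZMod d) : G.rev (G.outer k) ∉ W i := by
  intro hmem
  by_cases hk : k + 1 = i
  · exact hW.root_out i _ (by rw [tail_rev_outer, hk]) hmem
  · have h := hW.existsUnique_out i (G.v (k + 1)) fun h => hk (G.v_injective h)
    exact G.rev_outer_ne_outer hd k (k + 1)
      (h.unique ⟨G.tail_rev_outer k, hmem⟩ ⟨rfl, hW.outer_mem i _ hk⟩)

/-- Labels are built around each inner vertex from the clockwise order of its outgoing arcs, and are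
normalized at the outer vertices. -/
theorem IsGSWood.exists_describes (hd : 3 ≤ d) {W : G.ArcTuple d} (hW : G.IsGSWood W) :
    ∃ lam, G.Describes lam W := by
  have hloc : ∀ x : G.Vertex, ∃ lam : D → ZMod d, G.IsInnerVertex x →
      (∀ y, G.tail y = x → ∀ i, G.HasColor lam i y ↔ y ∈ W i) ∧
      ∑ y : D with G.tail y = x, G.vjump lam y = d := by
    intro x
    by_cases hx : G.IsInnerVertex x
    · choose a ha hun using fun i => hW.existsUnique_out i x (hx i)
      have hsw : G.sweep a 0 d = G.vdeg x :=
        hW.cw_order x hx a fun i => Or.inr ⟨hx i, (ha i).1, (ha i).2⟩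
      obtain ⟨lam, hlam⟩ := G.exists_hasColor_iff (fun i => (ha i).1) hsw
      refine ⟨lam, fun _ => ⟨fun y hy i => ?_,
        G.sum_vjump_of_hasColor_iff (fun i => (ha i).1) hlam⟩⟩
      rw [hlam y hy]
      constructor
      · rintro rfl
        exact (ha i).2
      · exact fun h => (hun i y ⟨hy, h⟩).symm
    · exact ⟨0, fun h => absurd h hx⟩
  choose Λ hΛ using hloc
  obtain ⟨lam, ho, ha, hin⟩ := G.exists_glue Λ fun i => i
  have hcongr : ∀ x, G.IsInnerVertex x → ∀ a, G.tail a = x → lam a = Λ x a := fun x hx a hax => by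
    subst hax
    exact hin a hx
  refine ⟨lam, ho, ha, fun x => ?_, fun a hina i => ?_, fun i k => ⟨?_, hW.outer_mem i k⟩,
    hW.rev_outer_notMem hd⟩
  · by_cases hx : G.IsInnerVertex x
    · refine Eq.trans ?_ (hΛ x hx).2
      refine Finset.sum_congr rfl fun a hmem => ?_
      exact vjump_congr_vertex (hcongr x hx) (Finset.mem_filter.1 hmem).2
    · obtain ⟨k, rfl⟩ := G.not_isInnerVertex_iff.1 hx
      exact sum_vjump_v hd (by omega) ho ha k
  · by_cases hx : G.IsInnerVertex (G.tail a)
    · rw [← (hΛ _ hx).1 a rfl i, RotationSystem.HasColor, RotationSystem.HasColor,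
        vjump_congr_vertex (hcongr _ hx) rfl, hin a hx]
    · obtain ⟨k, hk⟩ := G.not_isInnerVertex_iff.1 hx
      refine iff_of_false (fun hmem => ?_) ?_
      · by_cases hki : k = i
        · exact hW.root_out i a (by rw [hk, hki]) hmem
        · have h := hW.existsUnique_out i (G.v k) fun h => hki (G.v_injective h)
          exact (hina k).1 (h.unique ⟨hk, hmem⟩ ⟨rfl, hW.outer_mem i k hki⟩)
      · rw [RotationSystem.HasColor, vjump_at_outer ha hina hk]
        exact Nat.not_lt_zero _
  · rintro hmem rfl
    exact hW.root_out k _ rfl hmem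

/-- The conditions on the incoming arcs bound the jumps around each inner edge so that their total, a
multiple of `d`, is less than `2 d`. -/
theorem Describes.isFullLabeling (hd : 3 ≤ d) {lam : D → ZMod d} {W : G.ArcTuple d}
    (h : G.Describes lam W) (hW : G.IsGSWood W) : G.IsFullLabeling lam := by
  have hrel : ∀ e, lam (G.rev e)
      = lam e + (G.vjump lam e : ℕ) + (G.fjump lam (G.rev e) : ℕ) := fun e => by
    rw [G.lam_fjump lam (G.rev e), G.rev_rev, G.lam_cw lam e]
  -- arcs with a color, at their terminal vertex
  have hcol : ∀ e, G.IsInnerArc e → ∀ u < G.vjump lam e, ∃ w : ℕ,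
      lam (G.rev e) = lam e + (u + 2 + w : ℕ) ∧ w + 3 + G.vjump lam (G.rev e) ≤ d := by
    intro e he u hu
    have hmem : e ∈ W (lam e + u) := (h.mem_inner e he _).2 (G.hasColor_iff.2 ⟨u, hu, rfl⟩)
    by_cases hx : G.IsInnerVertex (G.head e)
    · obtain ⟨w, hw, hle⟩ := (h.forall_strictlyBetween_iff hd _ (by omega)).1
        (hW.incoming e _ hx hmem)
      refine ⟨w, ?_, by omega⟩
      rw [hw]
      push_cast
      ring
    · obtain ⟨k, hk⟩ := G.not_isInnerVertex_iff.1 hx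
      have hv0 : G.vjump lam (G.rev e) = 0 := vjump_at_outer h.at_outer he.rev hk
      have hlam : lam (G.rev e) = k := h.at_outer k _ (fun i => (he.rev i).1) hk
      have h1 : lam (G.rev e) ≠ lam e + u := fun h' =>
        hW.inner_root _ e he (Or.inl (by rw [hk, ← hlam, h'])) hmem
      have h2 : lam (G.rev e) ≠ lam e + u + 1 := fun h' =>
        hW.inner_root _ e he (Or.inr (by rw [hk, ← hlam, h'])) hmem
      set z := lam (G.rev e) - (lam e + (u + 2 : ℕ)) with hz
      refine ⟨z.val, ?_, ?_⟩
      · push_cast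
        rw [ZMod.natCast_zmod_val, hz]
        push_cast
        ring
      · rw [hv0]
        have hlt := ZMod.val_lt z
        by_contra hcon
        have hz' : ((z.val : ℕ) : ZMod d) = z := ZMod.natCast_zmod_val z
        have hor : z.val + 2 = d ∨ z.val + 1 = d := by omega
        rcases hor with h3 | h3
        · have h4 := congrArg (Nat.cast (R := ZMod d)) h3
          push_cast at h4
          rw [hz', ZMod.natCast_self, hz] at h4
          push_cast at h4
          exact h1 (by linear_combination h4)
        · have h4 := congrArg (Nat.cast (R := ZMod d)) h3
          push_cast at h4
          rw [hz', ZMod.natCast_self, hz] at h4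
          push_cast at h4
          exact h2 (by linear_combination h4)
  -- all inner arcs, on the side of their right face
  have hface : ∀ e, G.IsInnerArc e → ∀ k,
      k + G.fdeg (G.leftFace (G.rev e)) + G.vjump lam (G.rev e) = d →
      k < G.fjump lam (G.rev e) := by
    intro e he k hk
    have hk' : k + G.fdeg (G.rightFace e) + G.numColors W (G.rev e) = d := by
      rw [h.numColors he.rev]
      exact hk
    obtain ⟨i, hi, hcol'⟩ : ∃ i, lam e + (G.vjump lam e : ℕ) = i + 1 ∧
        (e ∈ W i ∨ ((∀ j, e ∉ W j) ∧
          ∃ a, G.IsOutFamily W (G.tail e) a ∧ G.StrictlyBetween a i 1 e)) := by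
      rcases Nat.eq_zero_or_pos (G.vjump lam e) with h0 | h0
      · refine ⟨lam e - 1, by rw [h0]; simp, Or.inr ⟨fun j => ?_, ?_⟩⟩
        · rw [h.mem_inner e he, RotationSystem.HasColor, h0]
          exact Nat.not_lt_zero _
        · exact (h.exists_strictlyBetween_iff hd _ (by omega)).2 ⟨0, by simp, by omega⟩
      · refine ⟨lam e + (G.vjump lam e - 1 : ℕ), ?_, Or.inl ?_⟩
        · rw [Nat.cast_sub h0]
          push_cast
          ring
        · exact (h.mem_inner e he _).2 (G.hasColor_iff.2 ⟨_, by omega, rfl⟩)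
    obtain ⟨w, hw, hle⟩ := (h.forall_strictlyBetween_iff hd _ (by omega)).1
      (hW.incoming_face e i k he hk' hcol')
    have h1 : ((G.fjump lam (G.rev e) : ℕ) : ZMod d) = (k + 1 + w : ℕ) := by
      rw [hrel, hi] at hw
      push_cast
      linear_combination hw
    have h2 := G.fjump_lt lam (G.rev e)
    have := ZMod.nat_eq_of_cast_eq h1 (by omega) (by omega)
    omega
  have hpos' : ∀ e, G.IsInnerArc e → 0 < G.fjump lam (G.rev e) := by
    intro e he
    have hlt := G.fjump_lt lam (G.rev e)
    rcases Nat.eq_zero_or_pos (G.vjump lam e) with h0 | h0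
    · by_cases hk : G.fdeg (G.leftFace (G.rev e)) + G.vjump lam (G.rev e) ≤ d
      · have := hface e he (d - (G.fdeg (G.leftFace (G.rev e)) + G.vjump lam (G.rev e))) (by omega)
        omega
      · have := G.fdeg_leftFace_le fun i => (he.rev i).1
        obtain ⟨w, hw, hle⟩ := hcol (G.rev e) he.rev 0 (by omega)
        rw [G.rev_rev] at hw hle
        by_contra hcon
        have hf0 : G.fjump lam (G.rev e) = 0 := by omega
        have h1 := hrel e
        rw [h0, hf0] at h1
        have h2 : ((0 : ℕ) : ZMod d) = (0 + 2 + w : ℕ) := by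
          push_cast at h1 hw ⊢
          linear_combination h1 + hw
        have := ZMod.nat_eq_of_cast_eq h2 (by omega) (by omega)
        omega
    · obtain ⟨w, hw, hle⟩ := hcol e he (G.vjump lam e - 1) (by omega)
      rw [hrel e, add_assoc, add_right_inj, ← Nat.cast_add] at hw
      by_contra hcon
      have := ZMod.nat_eq_of_cast_eq hw (by omega) (by omega)
      omega
  -- otherwise, one of the colors of `e` is reached by the total jump reduced by `d`
  have hlt : ∀ e, G.IsInnerArc e → G.vjump lam e + G.fjump lam (G.rev e) < d := by
    intro e he
    have h1 := G.fjump_lt lam (G.rev e)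
    by_contra hcon
    obtain ⟨w, hw, hle⟩ := hcol e he (G.vjump lam e + G.fjump lam (G.rev e) - d) (by omega)
    rw [hrel e, add_assoc, add_right_inj, ← Nat.cast_add] at hw
    have h2 : ((G.vjump lam e + G.fjump lam (G.rev e) : ℕ) : ZMod d)
        = (G.vjump lam e + G.fjump lam (G.rev e) + 2 + w : ℕ) := by
      rw [hw, show G.vjump lam e + G.fjump lam (G.rev e) + 2 + w
        = (G.vjump lam e + G.fjump lam (G.rev e) - d + 2 + w) + d by omega, Nat.cast_add _ d,
        ZMod.natCast_self, add_zero]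
    have := ZMod.nat_eq_of_cast_eq h2 (by omega) (by omega)
    omega
  have hpos : ∀ e, G.IsInnerArc e → 0 < G.fjump lam e := fun e he => by
    have := hpos' _ he.rev
    rwa [G.rev_rev] at this
  refine isFullLabeling_of_edge_sum hd h.outer h.at_outer (fun x _ => h.sum_vertex x) hpos
    (fun e he => ?_) (fun e he => ?_)
  · by_contra hcon
    have h1 := hface _ he.rev (d - (G.fdeg (G.leftFace e) + G.vjump lam e)) (by
      rw [G.rev_rev]
      omega)
    rw [G.rev_rev] at h1
    omega
  · have h1 := G.dvd_edge_sum lam e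
    have h2 := hlt e he
    have h3 := hlt _ he.rev
    have h4 := hpos e he
    rw [G.rev_rev] at h3
    obtain ⟨q, hq⟩ := h1
    have hq1 : q = 1 := by
      have h5 : 0 < d * q := by omega
      have h6 : d * q < d * 2 := by omega
      have := Nat.lt_of_mul_lt_mul_left h6
      have := Nat.pos_of_mul_pos_left h5
      omega
    rw [hq, hq1, mul_one]

end DMap

namespace DMap

/-! ### Half labels, modulo `b` -/

section Doubling

variable {b : ℕ} [NeZero b]

omit [NeZero b] in
theorem dbl_natCast (n : ℕ) : dbl (n : ZMod b) = ((2 * n : ℕ) : ZMod (2 * b)) := by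
  rw [dbl, ZMod.val_natCast, ZMod.natCast_eq_natCast_iff, Nat.ModEq, ← Nat.mul_mod_mul_left,
    Nat.mod_mod]

theorem dbl_add (i j : ZMod b) : dbl (i + j) = dbl i + dbl j := by
  rw [← ZMod.natCast_zmod_val i, ← ZMod.natCast_zmod_val j, ← Nat.cast_add, dbl_natCast,
    dbl_natCast, dbl_natCast]
  push_cast
  ring

theorem dbl_sub (i j : ZMod b) : dbl (i - j) = dbl i - dbl j := by
  rw [eq_sub_iff_add_eq, ← dbl_add, sub_add_cancel]

theorem val_dbl_add (i : ZMod b) {t : ℕ} (ht : t ≤ 1) : (dbl i + t).val = 2 * i.val + t := by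
  have := ZMod.val_lt i
  rw [dbl, ← Nat.cast_add, ZMod.val_cast_of_lt (by omega)]

theorem val_dbl (i : ZMod b) : (dbl i).val = 2 * i.val := by
  have := val_dbl_add i zero_le_one
  simpa using this

theorem dbl_injective : Function.Injective (dbl (b := b)) := fun i j h => by
  have h1 := congrArg ZMod.val h
  rw [val_dbl, val_dbl] at h1
  exact ZMod.val_injective b (by omega)

/-- The index `i` modulo `b` for which `k` is one of `2 i - 1` and `2 i`. -/
def half (k : ZMod (2 * b)) : ZMod b := ((k.val + 1) / 2 : ℕ)

theorem dbl_half_of_even {k : ZMod (2 * b)} (h : Even k.val) : dbl (half k) = k := by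
  obtain ⟨n, hn⟩ := h
  rw [half, dbl_natCast, show 2 * ((k.val + 1) / 2) = k.val by omega, ZMod.natCast_zmod_val]

theorem dbl_half_of_odd {k : ZMod (2 * b)} (h : Odd k.val) : dbl (half k) = k + 1 := by
  obtain ⟨n, hn⟩ := h
  rw [half, dbl_natCast, show 2 * ((k.val + 1) / 2) = k.val + 1 by omega, Nat.cast_add,
    ZMod.natCast_zmod_val, Nat.cast_one]

theorem even_val_dbl (i : ZMod b) : Even (dbl i).val := by
  rw [val_dbl]
  exact even_two_mul _

theorem odd_val_dbl_sub_one (hb : 2 ≤ b) (i : ZMod b) : Odd (dbl i - 1).val := by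
  have h := val_add_mod_two (dbl i - 1) 1
  have h1 : (1 : ZMod (2 * b)).val = 1 := by
    have := ZMod.val_cast_of_lt (n := 2 * b) (a := 1) (by omega)
    rwa [Nat.cast_one] at this
  rw [sub_add_cancel, val_dbl, h1] at h
  rw [Nat.odd_iff]
  omega

theorem half_eq_iff (hb : 2 ≤ b) {k : ZMod (2 * b)} {i : ZMod b} :
    half k = i ↔ k = dbl i ∨ k = dbl i - 1 := by
  constructor
  · rintro rfl
    rcases Nat.even_or_odd k.val with h | h
    · exact Or.inl (dbl_half_of_even h).symm
    · exact Or.inr (by rw [dbl_half_of_odd h, add_sub_cancel_right])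
  · rintro (rfl | rfl)
    · exact dbl_injective (dbl_half_of_even (even_val_dbl i))
    · exact dbl_injective (by rw [dbl_half_of_odd (odd_val_dbl_sub_one hb i), sub_add_cancel])

end Doubling

variable {b : ℕ} {D : Type*} {G : DMap (2 * b) D} (κ : G.Bicoloring)

/-- `1` for the arcs out of a black vertex, and `0` for the arcs out of a white vertex. -/
def Bicoloring.shade (a : D) : ℕ := if κ.black (G.tail a) then 1 else 0

theorem Bicoloring.shade_le (a : D) : κ.shade a ≤ 1 := by
  rw [Bicoloring.shade]
  split_ifs <;> omega

theorem Bicoloring.shade_of_black {a : D} (h : κ.black (G.tail a)) : κ.shade a = 1 := if_pos h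

theorem Bicoloring.shade_of_white {a : D} (h : ¬ κ.black (G.tail a)) : κ.shade a = 0 := if_neg h

theorem Bicoloring.shade_cw (a : D) : κ.shade (G.cw a) = κ.shade a := by
  rw [Bicoloring.shade, Bicoloring.shade, G.tail_cw]

theorem Bicoloring.shade_add_rev (a : D) : κ.shade a + κ.shade (G.rev a) = 1 := by
  have := κ.black_rev a
  rw [Bicoloring.shade, Bicoloring.shade]
  by_cases h : κ.black (G.tail a) <;> simp [this, h]

/-- For labels modulo `b`, half of the excess over `1` of the corresponding face jump modulo
`2 b`. -/
def Bicoloring.hjump (l : D → ZMod b) (a : D) : ℕ :=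
  (l a - l (G.cw (G.rev a)) - κ.shade a).val

theorem Bicoloring.hjump_lt [NeZero b] (l : D → ZMod b) (a : D) : κ.hjump l a < b :=
  ZMod.val_lt _

theorem Bicoloring.l_hjump [NeZero b] (l : D → ZMod b) (a : D) :
    l a = l (G.cw (G.rev a)) + κ.shade a + κ.hjump l a := by
  simp [Bicoloring.hjump]

/-- The labels `l` modulo `b` stand for the labels `lam` modulo `2 b`: for the inner corners,
`lam = 2 l - 1` at black vertices and `lam = 2 l` at white vertices.  The labels of the outer
corners are those that make the jumps add up to the modulus around the outer vertices. -/
structure Halves (lam : D → ZMod (2 * b)) (l : D → ZMod b) : Prop where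
  lam_outer : ∀ i, lam (G.outer i) = i + 1
  l_outer : ∀ i, l (G.outer i) = half i + 1
  inner : ∀ a, (∀ i, a ≠ G.outer i) → lam a = dbl (l a) - κ.shade a

section Halves

variable {κ} [NeZero b] {lam : D → ZMod (2 * b)} {l : D → ZMod b}

theorem exists_l_halves {lam : D → ZMod (2 * b)} (ho : ∀ i, lam (G.outer i) = i + 1)
    (hpar : ∀ a, (∀ i, a ≠ G.outer i) → (Odd (lam a).val ↔ κ.black (G.tail a))) :
    ∃ l, Halves κ lam l := by
  refine ⟨fun a => if ∃ i, a = G.outer i then half (lam a - 1) + 1 else half (lam a), ho,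
    fun i => ?_, fun a ha => ?_⟩
  · rw [if_pos ⟨i, rfl⟩, ho, add_sub_cancel_right]
  · rw [if_neg fun ⟨i, hi⟩ => ha i hi, Bicoloring.shade]
    split_ifs with h
    · rw [dbl_half_of_odd ((hpar a ha).2 h)]
      simp
    · rw [dbl_half_of_even (Nat.not_odd_iff_even.1 fun h' => h ((hpar a ha).1 h'))]
      simp

omit [NeZero b] in
theorem exists_lam_halves {l : D → ZMod b} (ho : ∀ i, l (G.outer i) = half i + 1) :
    ∃ lam, Halves κ lam l := by
  obtain ⟨L, hL⟩ : ∃ L : G.Labeling, L = fun c => dbl (l c.1) - (κ.shade c.1 : ZMod (2 * b)) :=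
    ⟨_, rfl⟩
  refine ⟨G.extend L, G.extend_outer L, ho, fun a ha => ?_⟩
  rw [G.extend_inner L ha, hL]
  rfl

theorem Halves.vjump_eq (h : Halves κ lam l) {a : D} (ha : G.IsInnerArc a) :
    G.vjump lam a = 2 * G.vjump l a := by
  rw [RotationSystem.vjump, RotationSystem.vjump, h.inner a fun i => (ha i).1,
    h.inner _ ha.cw_ne, κ.shade_cw, sub_sub_sub_cancel_right, ← dbl_sub, val_dbl]

theorem Halves.fjump_eq (h : Halves κ lam l) {a : D} (ha : ∀ i, a ≠ G.outer i) :
    G.fjump lam a = 2 * κ.hjump l a + 1 := by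
  have ha' : ∀ i, G.cw (G.rev a) ≠ G.outer i := fun i hi =>
    ha _ (G.rev_injective (G.cw_eq_outer_iff.1 hi))
  have hsh : (κ.shade (G.rev a) : ZMod (2 * b)) = 1 - κ.shade a := by
    rw [← Nat.cast_one, ← κ.shade_add_rev a, Nat.cast_add, add_sub_cancel_left]
  have key : lam a - lam (G.cw (G.rev a))
      = dbl (l a - l (G.cw (G.rev a)) - (κ.shade a : ZMod b)) + ((1 : ℕ) : ZMod (2 * b)) := by
    rw [h.inner a ha, h.inner _ ha', κ.shade_cw, hsh, dbl_sub, dbl_sub, dbl_natCast]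
    push_cast
    ring
  rw [RotationSystem.fjump, key, val_dbl_add _ le_rfl, Bicoloring.hjump]

/-- An inner arc has both of the colors `2 i - 1` and `2 i` (at a black vertex), or `2 i` and
`2 i + 1` (at a white vertex), or none of them. -/
theorem Halves.hasColor_iff (h : Halves κ lam l) {a : D} (ha : G.IsInnerArc a) (i : ZMod b)
    {t : ℕ} (ht : t ≤ 1) :
    G.HasColor lam (dbl i - κ.shade a + t) a ↔ G.HasColor l i a := by
  rw [RotationSystem.HasColor, RotationSystem.HasColor, h.vjump_eq ha,
    h.inner a fun i => (ha i).1, show dbl i - κ.shade a + t - (dbl (l a) - κ.shade a)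
      = dbl i - dbl (l a) + (t : ZMod (2 * b)) by ring, ← dbl_sub, val_dbl_add _ ht]
  omega

theorem Halves.hasColor_dbl_iff (h : Halves κ lam l) {a : D} (ha : G.IsInnerArc a) (i : ZMod b) :
    G.HasColor lam (dbl i) a ↔ G.HasColor l i a := by
  rw [← h.hasColor_iff ha i (κ.shade_le a), sub_add_cancel]

theorem Halves.odd_iff (hb : 2 ≤ b) (h : Halves κ lam l) {a : D} (ha : ∀ i, a ≠ G.outer i) :
    Odd (lam a).val ↔ κ.black (G.tail a) := by
  rw [h.inner a ha, Bicoloring.shade]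
  split_ifs with hbl
  · rw [Nat.cast_one]
    exact iff_of_true (odd_val_dbl_sub_one hb _) hbl
  · rw [Nat.cast_zero, sub_zero]
    exact iff_of_false (Nat.not_odd_iff_even.2 (even_val_dbl _)) hbl

/-- The labels are normalized at the outer vertices for both moduli at once. -/
theorem Halves.at_outer_iff (hb : 2 ≤ b) (h : Halves κ lam l) {a : D} (ha : ∀ i, a ≠ G.outer i)
    {i : ZMod (2 * b)} (ht : G.tail a = G.v i) : lam a = i ↔ l a = half i := by
  have hbl := κ.black_v hb i
  rw [h.inner a ha, eq_comm (a := l a), half_eq_iff hb, Bicoloring.shade, ht]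
  split_ifs with hc
  · rw [Nat.cast_one]
    constructor
    · exact fun h' => Or.inr h'.symm
    · rintro (h' | h')
      · have := hbl.1 hc
        rw [h', ← Nat.not_even_iff_odd] at this
        exact absurd (even_val_dbl _) this
      · exact h'.symm
  · rw [Nat.cast_zero, sub_zero]
    constructor
    · exact fun h' => Or.inl h'.symm
    · rintro (h' | h')
      · exact h'.symm
      · have := fun h'' => hc (hbl.2 h'')
        rw [h'] at this
        exact absurd (odd_val_dbl_sub_one hb _) this

end Halves

/-- The labels `l` of all the corners, modulo `b`, describe the sets of arcs `W`. -/
structure BGSDescribes [Fintype D] (l : D → ZMod b) (W : G.ArcTuple b) : Prop where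
  outer : ∀ i, l (G.outer i) = half i + 1
  at_outer : ∀ i a, (∀ j, a ≠ G.outer j) → G.tail a = G.v i → l a = half i
  sum_vertex : ∀ x, ∑ a : D with G.tail a = x, G.vjump l a = b
  mem_inner : ∀ a, G.IsInnerArc a → ∀ i, a ∈ W i ↔ G.HasColor l i a
  mem_outer : ∀ i k, G.outer k ∈ W i ↔ k ≠ dbl i
  rev_outer : ∀ i k, G.rev (G.outer k) ∉ W i

section BGSDescribes

variable [Fintype D] [NeZero b] {l : D → ZMod b} {W : G.ArcTuple b}

theorem BGSDescribes.numColors (h : BGSDescribes l W) {a : D} (ha : G.IsInnerArc a) :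
    G.numColors W a = G.vjump l a := by
  rw [← G.natCard_hasColor l a, DMap.numColors]
  exact Nat.card_congr (Equiv.subtypeEquivRight (h.mem_inner a ha))

theorem BGSDescribes.isOutArc_iff (hb : 2 ≤ b) (h : BGSDescribes l W) {x : G.Vertex} {i : ZMod b}
    {a : D} : G.IsBGSOutArc W x i a ↔ G.tail a = x ∧ G.HasColor l i a := by
  have hout : ∀ k, G.HasColor l i (G.outer k) ↔ half k ≠ i :=
    hasColor_outer_iff (by omega) hb h.outer h.at_outer i
  have hrev : ∀ k, G.HasColor l i (G.rev (G.outer k)) ↔ i = half (k + 1) :=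
    hasColor_rev_outer_iff (by omega) hb h.outer h.at_outer i
  by_cases hx : G.IsInnerVertex x
  · rw [IsBGSOutArc]
    constructor
    · rintro (⟨h1, -⟩ | ⟨h1, -⟩ | ⟨-, -, rfl, h1⟩)
      · exact absurd h1 (hx _)
      · exact absurd h1 (hx _)
      · exact ⟨rfl, (h.mem_inner a (G.isInnerArc_of_isInnerVertex hx) i).1 h1⟩
    · rintro ⟨rfl, h1⟩
      exact Or.inr (Or.inr ⟨hx _, hx _, rfl,
        (h.mem_inner a (G.isInnerArc_of_isInnerVertex hx) i).2 h1⟩)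
  · obtain ⟨k, rfl⟩ := G.not_isInnerVertex_iff.1 hx
    have hroot : G.IsBGSOutArc W (G.v k) i a ↔ (half k = i ∧ a = G.rev (G.outer (k - 1))) ∨
        (half k ≠ i ∧ G.tail a = G.v k ∧ a ∈ W i) := by
      have hv : ∀ j, G.v k = G.v j ↔ k = j := fun j => ⟨fun h => G.v_injective h, fun h => h ▸ rfl⟩
      simp only [IsBGSOutArc, hv, ne_eq, half_eq_iff hb, not_or]
      have h2 : dbl i - 1 - 1 = dbl i - 2 := by ring
      constructor
      · rintro (⟨rfl, rfl⟩ | ⟨rfl, rfl⟩ | ⟨h3, h4, h5⟩)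
        · exact Or.inl ⟨Or.inl rfl, rfl⟩
        · exact Or.inl ⟨Or.inr rfl, by rw [h2]⟩
        · exact Or.inr ⟨⟨h3, h4⟩, h5⟩
      · rintro (⟨rfl | rfl, rfl⟩ | ⟨⟨h3, h4⟩, h5⟩)
        · exact Or.inl ⟨rfl, rfl⟩
        · exact Or.inr (Or.inl ⟨rfl, by rw [h2]⟩)
        · exact Or.inr (Or.inr ⟨h3, h4, h5⟩)
    rw [hroot]
    constructor
    · rintro (⟨h1, rfl⟩ | ⟨h0, h1, h2⟩)
      · rw [tail_rev_outer, sub_add_cancel, hrev, sub_add_cancel]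
        exact ⟨rfl, h1.symm⟩
      · refine ⟨h1, ?_⟩
        by_cases ha : G.IsInnerArc a
        · exact (h.mem_inner a ha i).1 h2
        · rcases G.eq_of_outer_of_tail h1 ha with rfl | rfl
          · rwa [hout]
          · exact absurd h2 (h.rev_outer i _)
    · rintro ⟨h1, h2⟩
      by_cases ha : G.IsInnerArc a
      · rw [RotationSystem.HasColor, vjump_at_outer h.at_outer ha h1] at h2
        exact absurd h2 (Nat.not_lt_zero _)
      · rcases G.eq_of_outer_of_tail h1 ha with rfl | rfl
        · rw [hout] at h2
          refine Or.inr ⟨h2, h1, (h.mem_outer i k).2 fun hk => h2 ?_⟩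
          exact (half_eq_iff hb).2 (Or.inl hk)
        · rw [hrev, sub_add_cancel] at h2
          exact Or.inl ⟨h2.symm, rfl⟩

theorem BGSDescribes.isOutFamily_iff (hb : 2 ≤ b) (h : BGSDescribes l W) {x : G.Vertex}
    {a : ZMod b → D} :
    G.IsBGSOutFamily W x a ↔ ∀ i, G.tail (a i) = x ∧ G.HasColor l i (a i) :=
  forall_congr' fun _ => h.isOutArc_iff hb

theorem BGSDescribes.forall_strictlyBetween_iff (hb : 2 ≤ b) (h : BGSDescribes l W) {y : D}
    (j : ZMod b) {m : ℕ} (hm : m ≤ b) :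
    (∀ a, G.IsBGSOutFamily W (G.tail y) a → G.StrictlyBetween a j m y) ↔
      ∃ u : ℕ, l y = j + 1 + u ∧ u + 1 + G.vjump l y ≤ m := by
  simp only [h.isOutFamily_iff hb]
  exact G.forall_strictlyBetween_iff (h.sum_vertex _) rfl j hm

theorem BGSDescribes.exists_strictlyBetween_iff (hb : 2 ≤ b) (h : BGSDescribes l W) {y : D}
    (j : ZMod b) {m : ℕ} (hm : m ≤ b) :
    (∃ a, G.IsBGSOutFamily W (G.tail y) a ∧ G.StrictlyBetween a j m y) ↔
      ∃ u : ℕ, l y = j + 1 + u ∧ u + 1 + G.vjump l y ≤ m := by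
  simp only [h.isOutFamily_iff hb]
  exact G.exists_strictlyBetween_iff (h.sum_vertex _) rfl j hm

theorem Halves.sum_vjump {κ : G.Bicoloring} {lam : D → ZMod (2 * b)} (h : Halves κ lam l)
    {x : G.Vertex} (hx : G.IsInnerVertex x) :
    ∑ a : D with G.tail a = x, G.vjump lam a = 2 * ∑ a : D with G.tail a = x, G.vjump l a := by
  rw [Finset.mul_sum]
  refine Finset.sum_congr rfl fun a ha => h.vjump_eq ?_
  exact G.isInnerArc_of_isInnerVertex (by rwa [(Finset.mem_filter.1 ha).2])

theorem Halves.bgsDescribes {κ : G.Bicoloring} (hb : 2 ≤ b) {lam : D → ZMod (2 * b)}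
    (h : Halves κ lam l) {W : G.ArcTuple (2 * b)} (hW : G.Describes lam W) :
    BGSDescribes l (G.keepEven W) := by
  have hat : ∀ i a, (∀ j, a ≠ G.outer j) → G.tail a = G.v i → l a = half i :=
    fun i a ha ht => (h.at_outer_iff hb ha ht).1 (hW.at_outer i a ha ht)
  refine ⟨h.l_outer, hat, fun x => ?_,
    fun a ha i => (hW.mem_inner a ha _).trans (h.hasColor_dbl_iff ha i),
    fun i k => hW.mem_outer (dbl i) k, fun i k => hW.rev_outer (dbl i) k⟩
  by_cases hx : G.IsInnerVertex x
  · have h1 := hW.sum_vertex x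
    rw [h.sum_vjump hx] at h1
    omega
  · obtain ⟨k, rfl⟩ := G.not_isInnerVertex_iff.1 hx
    exact sum_vjump_v (by omega) hb h.l_outer hat k

end BGSDescribes

end DMap

/-! ### Woods of bipartite maps -/

namespace DMap

variable {b : ℕ} [NeZero b] {D : Type*} [Fintype D] {G : DMap (2 * b) D} {κ : G.Bicoloring}
  {lam : D → ZMod (2 * b)} {l : D → ZMod b}

/-- The two cases of the conditions on incoming arcs, for black and for white terminal vertices,
amount to a single relation between half labels. -/
theorem BGSDescribes.forall_incoming_iff (hb : 2 ≤ b) {W : G.ArcTuple b} (h : BGSDescribes l W)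
    (κ : G.Bicoloring) {e : D} (i : ZMod b) (m : ℕ) {n : ℕ} (hn : n ≤ b) :
    (∀ a, G.IsBGSOutFamily W (G.head e) a →
      (κ.black (G.head e) → G.StrictlyBetween a (i + 1 + m) n (G.rev e)) ∧
      (¬ κ.black (G.head e) → G.StrictlyBetween a (i + m) n (G.rev e))) ↔
    ∃ w : ℕ, l (G.rev e) = i + κ.shade (G.rev e) + (m + 1 + w : ℕ) ∧
      w + 1 + G.vjump l (G.rev e) ≤ n := by
  rw [Bicoloring.shade, ← RotationSystem.head]
  by_cases hbl : κ.black (G.head e)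
  · rw [if_pos hbl]
    simp only [hbl, true_implies, not_true_eq_false, false_implies, and_true]
    refine (h.forall_strictlyBetween_iff hb _ hn).trans (exists_congr fun w => ?_)
    push_cast
    rw [show i + 1 + (m : ZMod b) + 1 + w = i + 1 + (m + 1 + w) by ring]
  · rw [if_neg hbl]
    simp only [hbl, false_implies, not_false_eq_true, true_implies, true_and]
    refine (h.forall_strictlyBetween_iff hb _ hn).trans (exists_congr fun w => ?_)
    push_cast
    rw [show i + (m : ZMod b) + 1 + w = i + 0 + (m + 1 + w) by ring]

omit [Fintype D] in
theorem Bicoloring.l_rev (κ : G.Bicoloring) (l : D → ZMod b) (e : D) :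
    l (G.rev e) = l e + κ.shade (G.rev e) + (G.vjump l e + κ.hjump l (G.rev e) : ℕ) := by
  rw [κ.l_hjump l (G.rev e), G.rev_rev, G.lam_cw l e]
  push_cast
  ring

/-- Halving the jumps around an inner edge, which are even across the arcs and odd along the faces,
leaves the total `b - 1`. -/
theorem Halves.isBGSWood (hb : 2 ≤ b) (h : Halves κ lam l) (hL : G.IsFullLabeling lam)
    {W : G.ArcTuple (2 * b)} (hW : G.Describes lam W) : G.IsBGSWood κ (G.keepEven W) := by
  have hGS := hL.isGSWood (by omega) hW
  have hl := h.bgsDescribes hb hW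
  -- half of the relation between the four jumps around the edge of `e`
  have hnum : ∀ e, G.IsInnerArc e → ∀ m,
      m = b - G.fdeg (G.rightFace e) / 2 - G.numColors (G.keepEven W) (G.rev e) →
      m ≤ κ.hjump l (G.rev e) ∧
        G.vjump l e + κ.hjump l (G.rev e) + G.vjump l (G.rev e) + 1 ≤ b := by
    intro e he m hm
    have h1 := hL.edge_sum (by omega) he
    have h2 := hL.edge _ he.rev
    rw [h.vjump_eq he, h.vjump_eq he.rev, h.fjump_eq fun i => (he i).1,
      h.fjump_eq fun i => (he.rev i).1] at h1
    rw [h.vjump_eq he.rev, h.fjump_eq fun i => (he.rev i).1] at h2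
    rw [hl.numColors he.rev, RotationSystem.rightFace] at hm
    omega
  refine ⟨fun i => hGS.existsUnique_out (dbl i), fun i => hGS.root_out (dbl i),
    fun i => hGS.outer_mem (dbl i), fun i => hGS.inner_root (dbl i), fun x _ a ha => ?_,
    fun e i m he hm hmem => ?_, fun e i m he hm hno hbet => ?_⟩
  · rw [hl.isOutFamily_iff hb] at ha
    exact G.sweep_eq_vdeg (hl.sum_vertex x) ha 0
  · obtain ⟨h1, h2⟩ := hnum e he m hm
    rw [hl.mem_inner e he, G.hasColor_iff] at hmem
    obtain ⟨u, hu, rfl⟩ := hmem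
    refine (hl.forall_incoming_iff hb κ _ _ (by omega)).2 ?_
    obtain ⟨w, hw⟩ : ∃ w, G.vjump l e + κ.hjump l (G.rev e) = u + (m + 1 + w) := by
      obtain ⟨w, hw⟩ := Nat.exists_eq_add_of_le
        (show u + (m + 1) ≤ G.vjump l e + κ.hjump l (G.rev e) by omega)
      exact ⟨w, by omega⟩
    refine ⟨w, ?_, by omega⟩
    rw [κ.l_rev l e, hw, Nat.cast_add u]
    ring
  · obtain ⟨h1, h2⟩ := hnum e he m hm
    rw [hl.exists_strictlyBetween_iff hb _ (by omega)] at hbet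
    obtain ⟨u, hu, hle⟩ := hbet
    have hu0 : u = 0 := by omega
    have hv0 : G.vjump l e = 0 := by omega
    rw [hu0, Nat.cast_zero, add_zero] at hu
    refine (hl.forall_incoming_iff hb κ _ _ (by omega)).2 ?_
    obtain ⟨w, hw⟩ := Nat.exists_eq_add_of_le h1
    refine ⟨w, ?_, by omega⟩
    rw [κ.l_rev l e, hv0, hu, hw]
    push_cast
    ring

omit [Fintype D] [NeZero b] in
theorem IsBGSWood.rev_outer_notMem {W : G.ArcTuple b} (hb : 2 ≤ b) (hW : G.IsBGSWood κ W)
    (i : ZMod b) (k : ZMod (2 * b)) : G.rev (G.outer k) ∉ W i := by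
  intro hmem
  by_cases hk : k + 1 = dbl i
  · exact hW.root_out i _ (by rw [tail_rev_outer, hk]) hmem
  · have h := hW.existsUnique_out i (G.v (k + 1)) fun h => hk (G.v_injective h)
    exact G.rev_outer_ne_outer (by omega) k (k + 1)
      (h.unique ⟨G.tail_rev_outer k, hmem⟩ ⟨rfl, hW.outer_mem i _ hk⟩)

theorem IsBGSWood.exists_describes (hb : 2 ≤ b) {W : G.ArcTuple b} (hW : G.IsBGSWood κ W) :
    ∃ l, BGSDescribes l W := by
  have hloc : ∀ x : G.Vertex, ∃ l : D → ZMod b, G.IsInnerVertex x →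
      (∀ y, G.tail y = x → ∀ i, G.HasColor l i y ↔ y ∈ W i) ∧
      ∑ y : D with G.tail y = x, G.vjump l y = b := by
    intro x
    by_cases hx : G.IsInnerVertex x
    · choose a ha hun using fun i => hW.existsUnique_out i x (hx _)
      have hsw : G.sweep a 0 b = G.vdeg x :=
        hW.cw_order x hx a fun i => Or.inr (Or.inr ⟨hx _, hx _, (ha i).1, (ha i).2⟩)
      obtain ⟨l, hl⟩ := G.exists_hasColor_iff (fun i => (ha i).1) hsw
      refine ⟨l, fun _ => ⟨fun y hy i => ?_,
        G.sum_vjump_of_hasColor_iff (fun i => (ha i).1) hl⟩⟩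
      rw [hl y hy]
      constructor
      · rintro rfl
        exact (ha i).2
      · exact fun h => (hun i y ⟨hy, h⟩).symm
    · exact ⟨0, fun h => absurd h hx⟩
  choose Λ hΛ using hloc
  obtain ⟨l, ho, ha, hin⟩ := G.exists_glue Λ half
  have hcongr : ∀ x, G.IsInnerVertex x → ∀ a, G.tail a = x → l a = Λ x a := fun x hx a hax => by
    subst hax
    exact hin a hx
  refine ⟨l, ho, ha, fun x => ?_, fun a hina i => ?_, fun i k => ⟨?_, hW.outer_mem i k⟩,
    hW.rev_outer_notMem hb⟩
  · by_cases hx : G.IsInnerVertex x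
    · refine Eq.trans ?_ (hΛ x hx).2
      refine Finset.sum_congr rfl fun a hmem => ?_
      exact vjump_congr_vertex (hcongr x hx) (Finset.mem_filter.1 hmem).2
    · obtain ⟨k, rfl⟩ := G.not_isInnerVertex_iff.1 hx
      exact sum_vjump_v (by omega) hb ho ha k
  · by_cases hx : G.IsInnerVertex (G.tail a)
    · rw [← (hΛ _ hx).1 a rfl i, RotationSystem.HasColor, RotationSystem.HasColor,
        vjump_congr_vertex (hcongr _ hx) rfl, hin a hx]
    · obtain ⟨k, hk⟩ := G.not_isInnerVertex_iff.1 hx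
      refine iff_of_false (fun hmem => ?_) ?_
      · by_cases hki : k = dbl i
        · exact hW.root_out i a (by rw [hk, hki]) hmem
        · have h := hW.existsUnique_out i (G.v k) fun h => hki (G.v_injective h)
          exact (hina k).1 (h.unique ⟨hk, hmem⟩ ⟨rfl, hW.outer_mem i k hki⟩)
      · rw [RotationSystem.HasColor, vjump_at_outer ha hina hk]
        exact Nat.not_lt_zero _
  · rintro hmem rfl
    exact hW.root_out i _ rfl hmem

/-- Bounds on the half jumps that follow from the conditions on the incoming arc `e`. -/
theorem BGSDescribes.hjump_bounds (hb : 2 ≤ b) {W : G.ArcTuple b} (h : BGSDescribes l W)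
    (hW : G.IsBGSWood κ W) {e : D} (he : G.IsInnerArc e) :
    b ≤ κ.hjump l (G.rev e) + G.vjump l (G.rev e) + G.fdeg (G.leftFace (G.rev e)) / 2 ∧
      G.vjump l e + κ.hjump l (G.rev e) < b := by
  obtain ⟨m, hm⟩ : ∃ m, m = b - G.fdeg (G.rightFace e) / 2 - G.numColors W (G.rev e) := ⟨_, rfl⟩
  have hm' := hm
  rw [h.numColors he.rev, RotationSystem.rightFace] at hm'
  have hf := κ.hjump_lt l (G.rev e)
  have hcol : ∀ u < G.vjump l e, ∃ w : ℕ,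
      ((G.vjump l e + κ.hjump l (G.rev e) : ℕ) : ZMod b) = (u + (m + 1 + w) : ℕ) ∧
        w + 1 + G.vjump l (G.rev e) ≤ b - 1 - m := by
    intro u hu
    have hmem : e ∈ W (l e + u) := (h.mem_inner e he _).2 (G.hasColor_iff.2 ⟨u, hu, rfl⟩)
    obtain ⟨w, hw, hle⟩ := (h.forall_incoming_iff hb κ _ _ (by omega)).1
      (hW.incoming e _ m he hm hmem)
    refine ⟨w, ?_, hle⟩
    rw [κ.l_rev l e] at hw
    rw [Nat.cast_add u]
    linear_combination hw
  suffices hmf : m ≤ κ.hjump l (G.rev e) ∧ G.vjump l e + κ.hjump l (G.rev e) < b from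
    ⟨by omega, hmf.2⟩
  rcases Nat.eq_zero_or_pos (G.vjump l e) with h0 | h0
  · have hno : ∀ j, e ∉ W j := fun j => by
      rw [h.mem_inner e he, RotationSystem.HasColor, h0]
      exact Nat.not_lt_zero _
    obtain ⟨w, hw, hle⟩ := (h.forall_incoming_iff hb κ (l e - 1) m (by omega)).1
      (hW.incoming_uncolored e _ m he hm hno
        ((h.exists_strictlyBetween_iff hb _ (by omega)).2 ⟨0, by simp, by omega⟩))
    rw [κ.l_rev l e, h0, zero_add] at hw
    have h1 : ((κ.hjump l (G.rev e) : ℕ) : ZMod b) = (m + w : ℕ) := by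
      push_cast at hw ⊢
      linear_combination hw
    have := ZMod.nat_eq_of_cast_eq h1 (by omega) (by omega)
    omega
  · constructor
    · obtain ⟨w, hw, hle⟩ := hcol (G.vjump l e - 1) (by omega)
      rw [show G.vjump l e - 1 + (m + 1 + w) = G.vjump l e + (m + w) by omega, Nat.cast_add,
        Nat.cast_add (G.vjump l e), add_right_inj] at hw
      have := ZMod.nat_eq_of_cast_eq hw (by omega) (by omega)
      omega
    · -- otherwise, take the color for which the total jump is a multiple of `b`
      by_contra hcon
      obtain ⟨w, hw, hle⟩ := hcol (G.vjump l e + κ.hjump l (G.rev e) - b) (by omega)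
      have h1 : ((b : ℕ) : ZMod b) = (m + 1 + w : ℕ) := by
        have h2 : G.vjump l e + κ.hjump l (G.rev e)
            = (G.vjump l e + κ.hjump l (G.rev e) - b) + b := by omega
        rw [Nat.cast_add _ (m + 1 + w)] at hw
        rw [h2, Nat.cast_add _ b, Nat.add_sub_cancel, add_right_inj] at hw
        exact hw
      have := ZMod.nat_eq_of_cast_eq h1 (by omega) (by omega)
      omega

/-- By `hjump_bounds`, the total of the half jumps around an inner edge, congruent to `-1` modulo `b`,
is `b - 1`. -/
theorem BGSDescribes.isFullLabeling (hb : 2 ≤ b) {W : G.ArcTuple b} (h : BGSDescribes l W)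
    (hW : G.IsBGSWood κ W) (hlam : Halves κ lam l) : G.IsFullLabeling lam := by
  refine isFullLabeling_of_edge_sum (by omega) hlam.lam_outer
    (fun i a ha ht => (hlam.at_outer_iff hb ha ht).2 (h.at_outer i a ha ht))
    (fun x hx => ?_) (fun a ha => ?_) (fun a ha => ?_) (fun a ha => ?_)
  · rw [hlam.sum_vjump hx, h.sum_vertex]
  · rw [hlam.fjump_eq fun i => (ha i).1]
    omega
  · have h1 := (h.hjump_bounds hb hW ha.rev).1
    rw [G.rev_rev] at h1
    rw [hlam.fjump_eq fun i => (ha i).1, hlam.vjump_eq ha]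
    obtain ⟨q, hq⟩ := κ.even_fdeg (G.leftFace a)
    omega
  · rw [hlam.fjump_eq fun i => (ha i).1, hlam.vjump_eq ha,
      hlam.fjump_eq fun i => (ha.rev i).1, hlam.vjump_eq ha.rev]
    have h1 := (h.hjump_bounds hb hW ha).2
    have h2 := (h.hjump_bounds hb hW ha.rev).2
    have h3 := κ.l_rev l a
    have h4 := κ.l_rev l (G.rev a)
    rw [G.rev_rev] at h2 h4
    have h5 : ((κ.shade a + κ.shade (G.rev a) : ℕ) : ZMod b) = (1 : ℕ) := by
      rw [κ.shade_add_rev]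
    have h6 : ((G.vjump l a + κ.hjump l (G.rev a) + (G.vjump l (G.rev a) + κ.hjump l a) + 1 : ℕ) :
        ZMod b) = (b : ℕ) := by
      rw [ZMod.natCast_self]
      push_cast at h3 h4 h5 ⊢
      linear_combination -h3 - h4 - h5
    have := ZMod.nat_eq_of_cast_eq h6 (by omega) (by omega)
    omega

omit [NeZero b] in
theorem BGSDescribes.arcTuple_eq {W W' : G.ArcTuple b} (h : BGSDescribes l W)
    (h' : BGSDescribes l W') : W = W' := by
  funext i
  ext a
  by_cases ha : G.IsInnerArc a
  · rw [h.mem_inner a ha, h'.mem_inner a ha]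
  · obtain ⟨k, rfl | rfl⟩ := G.not_isInnerArc_iff.1 ha
    · rw [h.mem_outer, h'.mem_outer]
    · exact iff_of_false (h.rev_outer i k) (h'.rev_outer i k)

theorem BGSDescribes.labels_eq {l' : D → ZMod b} {W : G.ArcTuple b} (h : BGSDescribes l W)
    (h' : BGSDescribes l' W) : l = l' := by
  funext a
  by_cases hx : G.IsInnerVertex (G.tail a)
  · refine G.eq_of_hasColor_iff (h.sum_vertex _) (h'.sum_vertex _) (fun y hy i => ?_) rfl
    have hy' : G.IsInnerArc y := G.isInnerArc_of_isInnerVertex (by rwa [hy])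
    rw [← h.mem_inner y hy', h'.mem_inner y hy']
  · by_cases ha : ∀ i, a ≠ G.outer i
    · obtain ⟨k, hk⟩ := G.not_isInnerVertex_iff.1 hx
      rw [h.at_outer k a ha hk, h'.at_outer k a ha hk]
    · simp only [not_forall, not_not] at ha
      obtain ⟨i, rfl⟩ := ha
      rw [h.outer, h'.outer]

omit [Fintype D] [NeZero b] in
theorem Halves.labels_eq {lam' : D → ZMod (2 * b)} (h : Halves κ lam l) (h' : Halves κ lam' l) :
    lam = lam' := by
  funext a
  by_cases ha : ∀ i, a ≠ G.outer i
  · rw [h.inner a ha, h'.inner a ha]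
  · simp only [not_forall, not_not] at ha
    obtain ⟨i, rfl⟩ := ha
    rw [h.lam_outer, h'.lam_outer]

/-- Half labels of a labeling, with the descriptions of the woods that they give. -/
theorem exists_halves_of_mem (hb : 2 ≤ b) {L : G.Labeling} (hL : L ∈ G.BGSLabelings κ) :
    ∃ l, Halves κ (G.extend L) l ∧ G.Describes (G.extend L) (G.Theta L) ∧
      BGSDescribes l (G.keepEven (G.Theta L)) := by
  obtain ⟨h, hpar⟩ := (mem_BGSLabelings_iff κ hb).1 hL
  obtain ⟨l, hl⟩ := exists_l_halves (κ := κ) h.outer hpar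
  have hT := G.describes_Theta (by omega) h
  exact ⟨l, hl, hT, hl.bgsDescribes hb hT⟩

/-- The even colors of the wood of a labeling determine its half labels, and conversely. -/
theorem bijOn_keepEven_Theta (hb : 2 ≤ b) :
    Set.BijOn (G.keepEven ∘ G.Theta) (G.BGSLabelings κ) (G.BGSWoods κ) := by
  refine ⟨fun L hL => ?_, fun L hL L' hL' heq => ?_, fun W hW => ?_⟩
  · obtain ⟨l, h1, h2, -⟩ := exists_halves_of_mem hb hL
    exact h1.isBGSWood hb ((mem_BGSLabelings_iff κ hb).1 hL).1 h2
  · obtain ⟨l, h1, -, h3⟩ := exists_halves_of_mem hb hL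
    obtain ⟨l', h1', -, h3'⟩ := exists_halves_of_mem hb hL'
    have heq' : G.keepEven (G.Theta L) = G.keepEven (G.Theta L') := heq
    rw [← heq'] at h3'
    obtain rfl := h3.labels_eq h3'
    exact G.extend_injective (h1.labels_eq h1')
  · obtain ⟨l, hl⟩ := IsBGSWood.exists_describes hb hW
    obtain ⟨lam, hlam⟩ := exists_lam_halves (κ := κ) hl.outer
    obtain ⟨L, rfl⟩ := G.exists_extend hlam.lam_outer
    have hfull := hl.isFullLabeling hb hW hlam
    refine ⟨L, (mem_BGSLabelings_iff κ hb).2 ⟨hfull, fun a ha => hlam.odd_iff hb ha⟩, ?_⟩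
    exact (hlam.bgsDescribes hb (G.describes_Theta (by omega) hfull)).arcTuple_eq hl

/-- In an even wood, the colors of an arc out of a black vertex start with an odd color, and those
of an arc out of a white vertex start with an even color. -/
theorem Describes.odd_iff_of_vjump_pos {W : G.ArcTuple (2 * b)}
    (h : G.Describes lam W) (hW : W ∈ G.EvenGSWoods κ) {a : D} (ha : G.IsInnerVertex (G.tail a))
    (hpos : 0 < G.vjump lam a) : Odd (lam a).val ↔ κ.black (G.tail a) := by
  have hin := G.isInnerArc_of_isInnerVertex ha
  have h1 : a ∈ W (lam a) := (h.mem_inner a hin _).2 (G.hasColor_iff.2 ⟨0, hpos, by simp⟩)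
  have h2 : a ∉ W (lam a - 1) := fun hmem => by
    obtain ⟨u, hu, hu'⟩ := G.hasColor_iff.1 ((h.mem_inner a hin _).1 hmem)
    have hlt := G.vjump_lt lam a
    have h3 : ((u + 1 : ℕ) : ZMod (2 * b)) = (0 : ℕ) := by
      push_cast
      linear_combination -hu'
    by_cases h4 : u + 1 < 2 * b
    · have := ZMod.nat_eq_of_cast_eq h3 (by omega) (by omega)
      omega
    · omega
  constructor
  · intro hodd
    by_contra hw
    have h3 := (hW.2 (half (lam a) - 1) a ha).2 hw
    have h4 : dbl (half (lam a) - 1) = lam a - 1 := by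
      have h5 := dbl_natCast (b := b) 1
      rw [Nat.cast_one] at h5
      rw [dbl_sub, dbl_half_of_odd hodd, h5]
      push_cast
      ring
    rw [h4, sub_add_cancel] at h3
    exact h2 (h3.2 h1)
  · intro hbl
    by_contra heven
    have h3 := (hW.2 (half (lam a)) a ha).1 hbl
    rw [dbl_half_of_even (Nat.not_odd_iff_even.1 heven)] at h3
    exact h2 (h3.1 h1)

theorem Describes.odd_iff (hb : 2 ≤ b) {W : G.ArcTuple (2 * b)} (h : G.Describes lam W)
    (hW : W ∈ G.EvenGSWoods κ) {a : D} (ha : ∀ i, a ≠ G.outer i) :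
    Odd (lam a).val ↔ κ.black (G.tail a) := by
  by_cases hx : G.IsInnerVertex (G.tail a)
  · -- turn clockwise, with a constant label, up to an arc that has colors
    obtain ⟨y, hy, hy0⟩ : ∃ y, G.tail y = G.tail a ∧ 0 < G.vjump lam y := by
      have h1 : ∑ y : D with G.tail y = G.tail a, G.vjump lam y ≠ 0 := by
        rw [h.sum_vertex]
        omega
      obtain ⟨y, hy, hy0⟩ := Finset.exists_ne_zero_of_sum_ne_zero h1
      exact ⟨y, (Finset.mem_filter.1 hy).2, Nat.pos_of_ne_zero hy0⟩
    obtain ⟨n, hn⟩ := G.exists_pow_of_tail_eq hy.symm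
    clear ha
    induction n generalizing a with
    | zero =>
      obtain rfl : a = y := by simpa using hn
      exact h.odd_iff_of_vjump_pos hW hx hy0
    | succ n ih =>
      rcases Nat.eq_zero_or_pos (G.vjump lam a) with h0 | h0
      · have h1 := ih (a := G.cw a) (by rwa [G.tail_cw]) (by rw [G.tail_cw, hy]) (by
          rw [← hn, pow_succ, Equiv.Perm.mul_apply])
        rwa [G.lam_cw lam a, h0, Nat.cast_zero, add_zero, G.tail_cw] at h1
      · exact h.odd_iff_of_vjump_pos hW hx h0
  · obtain ⟨k, hk⟩ := G.not_isInnerVertex_iff.1 hx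
    rw [h.at_outer k a ha hk, hk, κ.black_v hb]

theorem bijOn_Theta (hb : 2 ≤ b) : Set.BijOn G.Theta (G.BGSLabelings κ) (G.EvenGSWoods κ) := by
  refine ⟨fun L hL => ?_, fun L hL L' hL' heq => ?_, fun W hW => ?_⟩
  · obtain ⟨l, hl, hT, -⟩ := exists_halves_of_mem hb hL
    refine ⟨((mem_BGSLabelings_iff κ hb).1 hL).1.isGSWood (by omega) hT, fun i a ha => ?_⟩
    have hin := G.isInnerArc_of_isInnerVertex ha
    have h0 := hl.hasColor_iff hin i zero_le_one
    have h1 := hl.hasColor_iff hin i le_rfl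
    rw [← hT.mem_inner a hin] at h0 h1
    refine ⟨fun hbl => ?_, fun hbl => ?_⟩
    · rw [κ.shade_of_black hbl, Nat.cast_zero, Nat.cast_one, add_zero] at h0
      rw [κ.shade_of_black hbl, Nat.cast_one, sub_add_cancel] at h1
      rw [h0, h1]
    · rw [κ.shade_of_white hbl, Nat.cast_zero, sub_zero, add_zero] at h0
      rw [κ.shade_of_white hbl, Nat.cast_zero, Nat.cast_one, sub_zero] at h1
      rw [h0, h1]
  · exact (bijOn_keepEven_Theta hb).injOn hL hL' (congrArg G.keepEven heq)
  · obtain ⟨lam, hlam⟩ := hW.1.exists_describes (by omega)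
    obtain ⟨L, rfl⟩ := G.exists_extend hlam.outer
    have hfull := hlam.isFullLabeling (by omega) hW.1
    exact ⟨L, (mem_BGSLabelings_iff κ hb).2 ⟨hfull, fun a ha => hlam.odd_iff hb hW ha⟩,
      hlam.eq_Theta (by omega) hfull⟩

theorem bijOn_keepEven (hb : 2 ≤ b) :
    Set.BijOn G.keepEven (G.EvenGSWoods κ) (G.BGSWoods κ) := by
  have h1 := bijOn_Theta (κ := κ) hb
  have h2 := bijOn_keepEven_Theta (κ := κ) hb
  refine ⟨fun W hW => ?_, fun W hW W' hW' heq => ?_, fun W hW => ?_⟩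
  · obtain ⟨L, hL, rfl⟩ := h1.surjOn hW
    exact h2.mapsTo hL
  · obtain ⟨L, hL, rfl⟩ := h1.surjOn hW
    obtain ⟨L', hL', rfl⟩ := h1.surjOn hW'
    exact congrArg G.Theta (h2.injOn hL hL' heq)
  · obtain ⟨L, hL, rfl⟩ := h2.surjOn hW
    exact ⟨_, h1.mapsTo hL, rfl⟩

end DMap

end

theorem theorem7p1 {D : Type*} [Fintype D] (b : ℕ) (hb : 2 ≤ b)
    (G : DMap (2 * b) D) (κ : G.Bicoloring) :
    (Nonempty (G.BGSLabelings κ ≃ G.BGSWoods κ) ∧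
      Nonempty (G.BGSLabelings κ ≃ G.BGSMarked) ∧
      Nonempty (G.BGSLabelings κ ≃ G.BGSAngular)) ∧
    (Set.BijOn G.Phi (G.BGSLabelings κ) G.EvenGSMarked ∧
      Set.BijOn G.Psi G.EvenGSMarked G.EvenGSAngular ∧
      Set.BijOn G.Theta (G.BGSLabelings κ) (G.EvenGSWoods κ)) ∧
    (Set.BijOn G.halveMarked G.EvenGSMarked G.BGSMarked ∧
      Set.BijOn G.halveAngular G.EvenGSAngular G.BGSAngular ∧
      Set.BijOn G.keepEven (G.EvenGSWoods κ) (G.BGSWoods κ)) := by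
  have : NeZero b := ⟨by omega⟩
  have hPhi := DMap.bijOn_Phi κ hb
  have hPsi := DMap.bijOn_Psi κ hb
  have hM := DMap.bijOn_halveMarked κ hb
  have hA := DMap.bijOn_halveAngular κ
  exact ⟨⟨⟨(DMap.bijOn_keepEven_Theta hb).equiv⟩, ⟨(hM.comp hPhi).equiv⟩,
    ⟨(hA.comp (hPsi.comp hPhi)).equiv⟩⟩, ⟨hPhi, hPsi, DMap.bijOn_Theta hb⟩,
    hM, hA, DMap.bijOn_keepEven hb⟩
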